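/- Let $d\ge 3$, $D=\binom{d+1}{2}$ and $W=\mathbb R^{d+1}$. Let $G=(V,E)$ be a finite graph, possibly with parallel edges but without loops, and let $\mathcal P=\{B,R\}$ be an ordered partition of $V$ into two (possibly empty) sets. *Rod-configurations.* A rod-configuration is an injective map $\mathbf r:R\to Gr(d-1,W)$ into the set of $(d-1)$-dimensional linear subspaces of $W$. Let $[r_v]$ be the Plücker point of $\mathbf r(v)$ in $\mathbb P(\bigwedge^{d-1}W)$. For $p\in\bigwedge^2W$ and $q\in\bigwedge^{d-1}W$, put $\langle p,q\rangle=\sum_{i<j}(-1)^{i+j}p_{ij}\,q_{[d+1]\setminus\{i,j\}}$, where the coordinates are taken with respect to the standard bases. Let $H_{\mathbf r}(v)=\{p\in\bigwedge^2W:\langle p,r_v\rangle=0\}$ for $v\in R$ and $H_{\mathbf r}(v)=\bigwedge^2W$ for $v\in B$. *The flats.* For an edge $e=uv$, let $A_e(\mathbf r)$ be the flat of $\mathbb P\big(\prod_{w\in V}\bigwedge^2W\big)$ associated with the linear subspace of all vectors that have $\alpha$ in the block of $u$, $-\alpha$ in the block of $v$ and $0$ in all the other blocks, where $\alpha\in H_{\mathbf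 r}(u)\cap H_{\mathbf r}(v)$. Let $\mathcal A(\mathbf r)=\{A_e(\mathbf r):e\in E\}$. *The generic matroid.* Representative points $x_e\in A_e(\mathbf r)$, $e\in E$, are in generic position if, for all $e\in F\subseteq E$, whenever $x_e$ lies in the span of $\{x_{e'}:e'\in F\setminus\{e\}\}$, the whole flat $A_e(\mathbf r)$ lies in that span. The generic matroid $\mathcal M(\mathcal A(\mathbf r))$ is the linear matroid on $E$ of the points $x_e$ for representative points in generic position. *The count matroid.* For $F\subseteq E$ let $V(F)$ be the set of the vertices incident to an edge of $F$, let $R(F)=V(F)\cap R$, and let $f(F)=D(|V(F)|-1)-|R(F)|$. The count matroid $\mathcal M_f(G,\mathcal P)$ is the matroid on $E$ in which $I\subseteq E$ is independent if and only if $|F|\le f(F)$ for every nonempty $F\subseteq I$. **Statement.** For almost all rod-configurations $\mathbf r$ (that is, for all $\mathbf r$ outside a proper algebraic subset of $Gr(d-1,W)^R$), $$\mathcal M(\mathcal A(\mathbf r))=\mathcal M_f(G,\mathcal P).$$ That is, representative points of $\mathcal A(\mathbf r)$ in generic position exist, and for every choice of such points the linear matroid that they define on $E$ is $\mathcal M_f(G,\mathcal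 P)$. -/

import Mathlib

namespace RodBar

/-! ### Matroids of point families and of flat families

A flat of the projective space `ℙ(M)` is represented by the linear subspace of `M` associated with
it, and a projective point by a nonzero vector representing it. -/

section LinearMatroid

variable {β M : Type*} [AddCommGroup M] [Module ℝ M]

open Classical in
/-- The linear matroid `(E, rank_X)` of a family `X = (x e)` of vectors indexed by `E`:
a set is independent iff its vectors are linearly independent. -/
noncomputable def linearMatroid (E : Set β) (x : β → M) : Matroid β :=
  (IndepMatroid.ofFinset E (fun I => (I : Set β) ⊆ E ∧ LinearIndepOn ℝ x (I : Set β))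
    (by simp)
    (fun I J hJ hIJ => ⟨(Finset.coe_subset.2 hIJ).trans hJ.1, hJ.2.mono (Finset.coe_subset.2 hIJ)⟩)
    (by
      rintro I J ⟨hIE, hI⟩ ⟨hJE, hJ⟩ hcard
      by_contra! hcon
      have hsub : Submodule.span ℝ (x '' (J : Set β)) ≤ Submodule.span ℝ (x '' (I : Set β)) := by
        rw [Submodule.span_le]
        rintro _ ⟨e, he, rfl⟩
        by_cases heI : e ∈ I
        · exact Submodule.subset_span ⟨e, heI, rfl⟩
        · by_contra hnot
          refine hcon e he heI ?_ ?_
          · rw [Finset.coe_insert]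
            exact Set.insert_subset (hJE he) hIE
          · rw [Finset.coe_insert]
            exact (linearIndepOn_insert (by simpa using heI)).2 ⟨hI, hnot⟩
      have key : ∀ K : Finset β, LinearIndepOn ℝ x (K : Set β) →
          Module.finrank ℝ (Submodule.span ℝ (x '' (K : Set β))) = K.card := by
        intro K hK
        have h := finrank_span_eq_card (R := ℝ) (b := fun i : (K : Set β) => x i) hK
        rw [Set.image_eq_range]
        simpa using h
      have : Module.Finite ℝ (Submodule.span ℝ (x '' (I : Set β))) :=
        FiniteDimensional.span_of_finite ℝ ((Finset.finite_toSet I).image x)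
      have h := Submodule.finrank_mono hsub
      rw [key I hI, key J hJ] at h
      omega)
    (fun _ h => h.1)).matroid

theorem linearMatroid_ground (E : Set β) (x : β → M) : (linearMatroid E x).E = E := rfl

theorem linearMatroid_indep_iff (E : Set β) (x : β → M) (I : Finset β) :
    (linearMatroid E x).Indep (I : Set β) ↔
      (I : Set β) ⊆ E ∧ LinearIndepOn ℝ x (I : Set β) := by
  classical
  unfold linearMatroid
  rw [IndepMatroid.matroid_Indep]
  exact IndepMatroid.ofFinset_indep ..

/-- The points `[x e]`, `e ∈ E`, are representative points of the flats `A e` (i.e. `[x e]` is a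
point of `A e`), and they are in generic position: for every subfamily `X'` of the points and every
member `x e` of it, if `x e` lies in the span of the other members of `X'`, then so does the whole
flat `A e`. -/
structure IsGenericRepresentatives (E : Set β) (A : β → Submodule ℝ M) (x : β → M) : Prop where
  mem : ∀ e ∈ E, x e ∈ A e
  ne_zero : ∀ e ∈ E, x e ≠ 0
  generic : ∀ F ⊆ E, ∀ e ∈ F, x e ∈ Submodule.span ℝ (x '' (F \ {e})) →
    A e ≤ Submodule.span ℝ (x '' (F \ {e}))

/-- `N` is the generic matroid `M(A)` of the family `A = {A e : e ∈ E}` of flats: representative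
points of `A` in generic position exist, and whichever of them are chosen, their linear matroid
is `N`. -/
def IsGenericMatroid (E : Set β) (A : β → Submodule ℝ M) (N : Matroid β) : Prop :=
  (∃ x : β → M, IsGenericRepresentatives E A x) ∧
    ∀ x : β → M, IsGenericRepresentatives E A x → linearMatroid E x = N

end LinearMatroid

/-! ### The matroid induced by a monotone submodular function -/

section InducedMatroid

variable {β : Type*}

open Classical in
theorem induced_augment (f : Finset β → ℤ) (hmono : ∀ X Y, X ⊆ Y → f X ≤ f Y)
    (hsub : ∀ X Y, f (X ∪ Y) + f (X ∩ Y) ≤ f X + f Y) (I J : Finset β)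
    (hI : ∀ F ⊆ I, F.Nonempty → (F.card : ℤ) ≤ f F)
    (hJ : ∀ F ⊆ J, F.Nonempty → (F.card : ℤ) ≤ f F) (hcard : I.card < J.card) :
    ∃ e ∈ J, e ∉ I ∧ ∀ F ⊆ insert e I, F.Nonempty → (F.card : ℤ) ≤ f F := by
  by_contra! hcon
  let T : Finset β → Prop := fun A =>
    A ⊆ I ∪ J ∧ (A ∩ I).Nonempty ∧ f A ≤ ((A ∩ I).card : ℤ)
  have hunion : ∀ A B, T A → T B → (A ∩ B ∩ I).Nonempty → T (A ∪ B) := by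
    rintro A B ⟨hA, hA', hA''⟩ ⟨hB, hB', hB''⟩ hAB
    refine ⟨Finset.union_subset hA hB, ?_, ?_⟩
    · exact hA'.mono (Finset.inter_subset_inter_right Finset.subset_union_left)
    · have h1 := hsub A B
      have h2 := hI _ Finset.inter_subset_right hAB
      have h3 := hmono _ _ (Finset.inter_subset_left : A ∩ B ∩ I ⊆ A ∩ B)
      have h4 := Finset.card_union_add_card_inter (A ∩ I) (B ∩ I)
      have h5 : (A ∩ I) ∪ (B ∩ I) = (A ∪ B) ∩ I := (Finset.union_inter_distrib_right _ _ _).symm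
      have h6 : (A ∩ I) ∩ (B ∩ I) = A ∩ B ∩ I := (Finset.inter_inter_distrib_right _ _ _).symm
      rw [h5, h6] at h4
      omega
  have hcover : ∀ e ∈ J, e ∉ I → ∃ A, T A ∧ e ∈ A := by
    intro e he heI
    obtain ⟨F, hF, hFne, hlt⟩ := hcon e he heI
    have heF : e ∈ F := by
      by_contra heF
      exact absurd (hI F ((Finset.subset_insert_iff_of_notMem heF).1 hF) hFne) (not_le.2 hlt)
    have hFI : F ∩ I = F.erase e := by
      ext y
      have hy := @hF y
      simp only [Finset.mem_inter, Finset.mem_erase, Finset.mem_insert] at hy ⊢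
      constructor
      · rintro ⟨h1, h2⟩
        exact ⟨fun h => heI (h ▸ h2), h1⟩
      · rintro ⟨h1, h2⟩
        exact ⟨h2, (hy h2).resolve_left h1⟩
    have hFIJ : F ⊆ I ∪ J :=
      hF.trans (Finset.insert_subset (Finset.mem_union_right _ he) Finset.subset_union_left)
    have hc : (F.erase e).card + 1 = F.card := Finset.card_erase_add_one heF
    refine ⟨F, ⟨hFIJ, ?_, ?_⟩, heF⟩
    · rw [hFI]
      by_contra hne
      rw [Finset.not_nonempty_iff_eq_empty] at hne
      have h1 := hJ {e} (by simpa using he) (by simp)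
      have h2 := hmono {e} F (by simpa using heF)
      rw [hne] at hc
      simp at h1 hc
      omega
    · rw [hFI]
      omega
  let S : Finset (Finset β) := (I ∪ J).powerset.filter (fun A => Maximal T A)
  have hS : ∀ A, A ∈ S ↔ Maximal T A := by
    intro A
    simp only [S, Finset.mem_filter, Finset.mem_powerset]
    exact ⟨fun h => h.2, fun h => ⟨h.1.1, h⟩⟩
  have hmax : ∀ A, T A → ∃ B, A ⊆ B ∧ B ∈ S := by
    intro A hA
    have hfin : {A | T A}.Finite :=
      (Finset.finite_toSet (I ∪ J).powerset).subset (fun A hA => Finset.mem_coe.2 (Finset.mem_powerset.2 hA.1))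
    obtain ⟨B, hAB, hB⟩ := hfin.exists_le_maximal hA
    exact ⟨B, hAB, (hS B).2 hB⟩
  have hdisj : ∀ A ∈ S, ∀ B ∈ S, A ≠ B → Disjoint (A ∩ I) (B ∩ I) := by
    intro A hA B hB hne
    rw [hS] at hA hB
    by_contra hd
    rw [Finset.not_disjoint_iff] at hd
    obtain ⟨x, hx1, hx2⟩ := hd
    have hT := hunion A B hA.1 hB.1 ⟨x, by simp only [Finset.mem_inter] at hx1 hx2 ⊢; tauto⟩
    have h1 := hA.eq_of_le hT Finset.subset_union_left
    have h2 := hB.eq_of_le hT Finset.subset_union_right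
    exact hne (h1.trans h2.symm)
  have hc1 : (S.biUnion (fun A => J ∩ A)).card ≤ ∑ A ∈ S, (J ∩ A).card := Finset.card_biUnion_le
  have hc2 : (S.biUnion (fun A => A ∩ I)).card = ∑ A ∈ S, (A ∩ I).card :=
    Finset.card_biUnion hdisj
  have hc3 : ∑ A ∈ S, (J ∩ A).card ≤ ∑ A ∈ S, (A ∩ I).card := by
    refine Finset.sum_le_sum (fun A hA => ?_)
    rcases (J ∩ A).eq_empty_or_nonempty with h | h
    · simp [h]
    · have h1 := hJ _ Finset.inter_subset_left h
      have h2 := hmono _ _ (Finset.inter_subset_right : J ∩ A ⊆ A)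
      have h3 := ((hS A).1 hA).1.2.2
      omega
  let U : Finset β := S.biUnion id
  have hJU : J ⊆ S.biUnion (fun A => J ∩ A) ∪ (I \ U) := by
    intro e he
    by_cases heU : e ∈ U
    · simp only [U, Finset.mem_biUnion, id] at heU
      obtain ⟨A, hA, heA⟩ := heU
      exact Finset.mem_union_left _ (Finset.mem_biUnion.2 ⟨A, hA, Finset.mem_inter.2 ⟨he, heA⟩⟩)
    · refine Finset.mem_union_right _ (Finset.mem_sdiff.2 ⟨?_, heU⟩)
      by_contra heI
      obtain ⟨A, hA, heA⟩ := hcover e he heI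
      obtain ⟨B, hAB, hB⟩ := hmax A hA
      exact heU (Finset.mem_biUnion.2 ⟨B, hB, hAB heA⟩)
  have hIU : S.biUnion (fun A => A ∩ I) = I ∩ U := by
    ext e
    simp only [U, Finset.mem_biUnion, Finset.mem_inter, id]
    tauto
  have h1 := (Finset.card_le_card hJU).trans (Finset.card_union_le _ _)
  have h2 := Finset.card_inter_add_card_sdiff I U
  rw [hIU] at hc2
  omega

open Classical in
/-- The matroid on `E` induced by a monotone submodular function `f`: a set `I ⊆ E` is independent
iff `|F| ≤ f F` for every nonempty `F ⊆ I`. -/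
noncomputable def inducedMatroid (E : Set β) (f : Finset β → ℤ)
    (hmono : ∀ X Y, X ⊆ Y → f X ≤ f Y)
    (hsub : ∀ X Y, f (X ∪ Y) + f (X ∩ Y) ≤ f X + f Y) : Matroid β :=
  (IndepMatroid.ofFinset E
    (fun I => (I : Set β) ⊆ E ∧ ∀ F ⊆ I, F.Nonempty → (F.card : ℤ) ≤ f F)
    (by
      refine ⟨by simp, fun F hF hne => ?_⟩
      rw [Finset.subset_empty] at hF
      exact absurd hF hne.ne_empty)
    (fun I J hJ hIJ =>
      ⟨(Finset.coe_subset.2 hIJ).trans hJ.1, fun F hF hne => hJ.2 F (hF.trans hIJ) hne⟩)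
    (by
      rintro I J ⟨hIE, hI⟩ ⟨hJE, hJ⟩ hcard
      obtain ⟨e, he, heI, h⟩ := induced_augment f hmono (by convert hsub) I J hI hJ hcard
      refine ⟨e, he, heI, ?_, h⟩
      rw [Finset.coe_insert]
      exact Set.insert_subset (hJE he) hIE)
    (fun _ h => h.1)).matroid

open Classical in
theorem inducedMatroid_indep_iff (E : Set β) (f : Finset β → ℤ)
    (hmono : ∀ X Y, X ⊆ Y → f X ≤ f Y)
    (hsub : ∀ X Y, f (X ∪ Y) + f (X ∩ Y) ≤ f X + f Y) (I : Finset β) :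
    (inducedMatroid E f hmono hsub).Indep (I : Set β) ↔
      (I : Set β) ⊆ E ∧ ∀ F ⊆ I, F.Nonempty → (F.card : ℤ) ≤ f F := by
  unfold inducedMatroid
  rw [IndepMatroid.matroid_Indep]
  exact IndepMatroid.ofFinset_indep ..

end InducedMatroid

/-! ### The count matroid -/

section CountMatroid

variable {α β : Type*}

/-- The set `V(F)` of vertices spanned by a set `F` of edges. -/
def spanned (G : Graph α β) (F : Finset β) : Set α := {v | ∃ e ∈ F, G.Inc e v}

theorem spanned_finite (G : Graph α β) (F : Finset β) : (spanned G F).Finite := by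
  have h : spanned G F = ⋃ e ∈ F, {v | G.Inc e v} := by
    ext v
    simp [spanned]
  rw [h]
  refine Set.Finite.biUnion (Finset.finite_toSet F) (fun e _ => ?_)
  by_cases he : ∃ x y, G.IsLink e x y
  · obtain ⟨x, y, hxy⟩ := he
    exact (Set.toFinite {x, y}).subset (fun v hv => hv.eq_or_eq_of_isLink hxy)
  · convert Set.finite_empty (α := α)
    ext v
    simp only [Set.mem_ofPred_eq, Set.mem_empty_iff_false, iff_false]
    rintro ⟨y, hy⟩
    exact he ⟨v, y, hy⟩

/-- The count function `f(F) = D(|V(F)| - 1) - |R(F)|`, with `D = (d+1 choose 2)` and `R(F)` the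
set of the vertices of `R` spanned by `F`. -/
noncomputable def countFunction (G : Graph α β) (R : Set α) (d : ℕ) (F : Finset β) : ℤ :=
  ((d + 1).choose 2 : ℤ) * (((spanned G F).ncard : ℤ) - 1) - ((spanned G F ∩ R).ncard : ℤ)

theorem countFunction_eq (G : Graph α β) (R : Set α) (d : ℕ) (F : Finset β) :
    countFunction G R d F = ((d + 1).choose 2 : ℤ) * ((spanned G F \ R).ncard : ℤ) +
      (((d + 1).choose 2 : ℤ) - 1) * ((spanned G F ∩ R).ncard : ℤ) - ((d + 1).choose 2 : ℤ) := by
  have h := Set.ncard_inter_add_ncard_sdiff_eq_ncard (spanned G F) R (spanned_finite G F)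
  unfold countFunction
  rw [← h]
  push_cast
  ring

theorem one_le_choose {d : ℕ} (hd : 1 ≤ d) : (1 : ℤ) ≤ ((d + 1).choose 2 : ℤ) := by
  exact_mod_cast Nat.choose_pos (by omega)

theorem countFunction_mono (G : Graph α β) (R : Set α) {d : ℕ} (hd : 1 ≤ d) (X Y : Finset β)
    (h : X ⊆ Y) : countFunction G R d X ≤ countFunction G R d Y := by
  have hs : spanned G X ⊆ spanned G Y := fun v ⟨e, he, hv⟩ => ⟨e, h he, hv⟩
  have hD := one_le_choose hd
  have h1 : (spanned G X \ R).ncard ≤ (spanned G Y \ R).ncard :=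
    Set.ncard_le_ncard (Set.sdiff_subset_sdiff_left hs) ((spanned_finite G Y).sdiff)
  have h2 : (spanned G X ∩ R).ncard ≤ (spanned G Y ∩ R).ncard :=
    Set.ncard_le_ncard (Set.inter_subset_inter_left _ hs) ((spanned_finite G Y).inter_of_left _)
  rw [countFunction_eq, countFunction_eq]
  have h3 := mul_le_mul_of_nonneg_left (Int.ofNat_le.2 h1)
    (show (0 : ℤ) ≤ ((d + 1).choose 2 : ℤ) by omega)
  have h4 := mul_le_mul_of_nonneg_left (Int.ofNat_le.2 h2)
    (show (0 : ℤ) ≤ ((d + 1).choose 2 : ℤ) - 1 by omega)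
  linarith

open Classical in
theorem countFunction_submodular (G : Graph α β) (R : Set α) {d : ℕ} (hd : 1 ≤ d)
    (X Y : Finset β) : countFunction G R d (X ∪ Y) + countFunction G R d (X ∩ Y) ≤
      countFunction G R d X + countFunction G R d Y := by
  have hD := one_le_choose hd
  have hu : spanned G (X ∪ Y) = spanned G X ∪ spanned G Y := by
    ext v
    simp only [spanned, Finset.mem_union, Set.mem_ofPred_eq, Set.mem_union]
    grind
  have hi : spanned G (X ∩ Y) ⊆ spanned G X ∩ spanned G Y := by
    rintro v ⟨e, he, hv⟩
    rw [Finset.mem_inter] at he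
    exact ⟨⟨e, he.1, hv⟩, ⟨e, he.2, hv⟩⟩
  have key : ∀ S : Set α, ((spanned G (X ∪ Y) ∩ S).ncard : ℤ) + ((spanned G (X ∩ Y) ∩ S).ncard : ℤ)
      ≤ ((spanned G X ∩ S).ncard : ℤ) + ((spanned G Y ∩ S).ncard : ℤ) := by
    intro S
    have hX := (spanned_finite G X).inter_of_left S
    have hY := (spanned_finite G Y).inter_of_left S
    have h1 := Set.ncard_union_add_ncard_inter (spanned G X ∩ S) (spanned G Y ∩ S) hX hY
    have h2 : (spanned G X ∩ S) ∪ (spanned G Y ∩ S) = spanned G (X ∪ Y) ∩ S := by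
      rw [hu]
      exact (Set.union_inter_distrib_right _ _ _).symm
    have h3 : (spanned G (X ∩ Y) ∩ S).ncard ≤ ((spanned G X ∩ S) ∩ (spanned G Y ∩ S)).ncard := by
      refine Set.ncard_le_ncard (fun v hv => ?_) (hX.inter_of_left _)
      exact ⟨⟨(hi hv.1).1, hv.2⟩, ⟨(hi hv.1).2, hv.2⟩⟩
    rw [h2] at h1
    omega
  have h3 := mul_le_mul_of_nonneg_left (key Rᶜ) (show (0 : ℤ) ≤ ((d + 1).choose 2 : ℤ) by omega)
  have h4 := mul_le_mul_of_nonneg_left (key R) (show (0 : ℤ) ≤ ((d + 1).choose 2 : ℤ) - 1 by omega)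
  simp only [countFunction_eq, Set.sdiff_eq]
  linarith

/-- The count matroid `M_f(G, {B, R})`: the matroid on the edge set of `G` induced by the count
function `f`. (It depends on the bipartition through `R` only, as `B` is the complement of `R`;
`f` is monotone for `d ≥ 1`.) -/
noncomputable def countMatroid (G : Graph α β) (R : Set α) (d : ℕ) (hd : 1 ≤ d) : Matroid β :=
  inducedMatroid G.edgeSet (countFunction G R d) (countFunction_mono G R hd)
    (fun X Y => by convert countFunction_submodular G R hd X Y)

end CountMatroid

/-! ### Plücker coordinates -/

/-- The exterior power `⋀ᵏ W` of `W = ℝ^{d+1}`, in coordinates with respect to the basis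
`e_{i₁} ∧ ⋯ ∧ e_{iₖ}`, `i₁ < ⋯ < iₖ`; the coordinates are indexed by the `k`-element subsets. -/
abbrev Wedge (d k : ℕ) : Type := Set.powersetCard (Fin (d + 1)) k → ℝ

/-- The vector `b₁ ∧ ⋯ ∧ bₖ`: its coordinates are the `k × k` minors of the `k × (d+1)` matrix
with rows `b₁, …, bₖ`. -/
noncomputable def wedge {d k : ℕ} (b : Fin k → Fin (d + 1) → ℝ) : Wedge d k :=
  fun s => Matrix.det (Matrix.of fun i j => b i (s.1.orderEmbOfFin s.2 j))

/-- The complement of a `2`-element subset of the `d+1` indices. -/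
def complPair {d : ℕ} (s : Set.powersetCard (Fin (d + 1)) 2) :
    Set.powersetCard (Fin (d + 1)) (d - 1) :=
  ⟨s.1ᶜ, by
    have h : s.1.card = 2 := s.2
    change s.1ᶜ.card = d - 1
    rw [Finset.card_compl, h, Fintype.card_fin]
    omega⟩

/-- The product `⟨p, q⟩ = ∑_{i < j} (-1)^{i+j} p_{ij} q_{[d+1] \ {i, j}}` of `p ∈ ⋀² W` and
`q ∈ ⋀^{d-1} W`, the indices running over `1, …, d+1`. -/
noncomputable def pairing {d : ℕ} (p : Wedge d 2) (q : Wedge d (d - 1)) : ℝ :=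
  ∑ s, (-1 : ℝ) ^ (∑ i ∈ s.1, (i.val + 1)) * p s * q (complPair s)

/-! ### Rod-configurations and the associated flats -/

/-- A rod-configuration: it assigns to each vertex `v ∈ R` a `(d-1)`-dimensional linear subspace of
`W = ℝ^{d+1}` (a point of `Gr(d-1, W)`, i.e. a `(d-2)`-dimensional flat of projective `d`-space),
distinct vertices having distinct rods. -/
structure RodConfiguration {α : Type*} (d : ℕ) (R : Set α) where
  rod : R → Submodule ℝ (Fin (d + 1) → ℝ)
  finrank_rod : ∀ v, Module.finrank ℝ (rod v) = d - 1
  injective : Function.Injective rod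

/-- `P` holds for almost all rod-configurations: it holds outside a proper algebraic subset of
`Gr(d-1, W)^R`, i.e. there is a nonzero polynomial `Q` in the entries of the
`(d-1) × (d+1)` matrices `b v`, `v ∈ R`, such that `P r` holds whenever `Q` does not vanish at some
choice of the matrices `b v` whose rows form a basis of the rod of `v`. -/
def AlmostAll {α : Type*} {d : ℕ} {R : Set α} (P : RodConfiguration d R → Prop) : Prop :=
  ∃ Q : MvPolynomial (R × Fin (d - 1) × Fin (d + 1)) ℝ, Q ≠ 0 ∧
    ∀ (r : RodConfiguration d R) (b : R → Fin (d - 1) → Fin (d + 1) → ℝ),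
      (∀ v, Submodule.span ℝ (Set.range (b v)) = r.rod v) →
      MvPolynomial.eval (fun i => b i.1 i.2.1 i.2.2) Q ≠ 0 → P r

/-- The dual hyperplane in `⋀² W` of a `(d-1)`-dimensional subspace `X` of `W`: the vectors `p`
with `⟨p, q⟩ = 0` for the Plücker vector `q` of `X`. (The Plücker vectors `b₁ ∧ ⋯ ∧ b_{d-1}` of
the bases of `X` are the nonzero multiples of one vector, and `b₁ ∧ ⋯ ∧ b_{d-1} = 0` for the other
families of vectors of `X`.) -/
noncomputable def dualHyperplane {d : ℕ} (X : Submodule ℝ (Fin (d + 1) → ℝ)) :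
    Submodule ℝ (Wedge d 2) where
  carrier := {p | ∀ b : Fin (d - 1) → Fin (d + 1) → ℝ, (∀ i, b i ∈ X) → pairing p (wedge b) = 0}
  add_mem' := by
    intro p q hp hq b hb
    have h1 := hp b hb
    have h2 := hq b hb
    simp only [pairing] at h1 h2 ⊢
    rw [← add_zero (0 : ℝ)]
    nth_rewrite 1 [← h1]
    rw [← h2, ← Finset.sum_add_distrib]
    refine Finset.sum_congr rfl (fun s _ => ?_)
    simp only [Pi.add_apply]
    ring
  zero_mem' := by
    intro b _
    simp [pairing]
  smul_mem' := by
    intro c p hp b hb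
    have h1 := hp b hb
    simp only [pairing] at h1 ⊢
    rw [← mul_zero c, ← h1, Finset.mul_sum]
    refine Finset.sum_congr rfl (fun s _ => ?_)
    simp only [Pi.smul_apply, smul_eq_mul]
    ring

section Flats

variable {α β : Type*} {d : ℕ} {R : Set α}

open Classical in
/-- `H_r(v)`: the dual hyperplane of the rod of `v` if `v ∈ R`, and all of `⋀² W` otherwise. -/
noncomputable def RodConfiguration.hyperplane (r : RodConfiguration d R) (v : α) :
    Submodule ℝ (Wedge d 2) :=
  if h : v ∈ R then dualHyperplane (r.rod ⟨v, h⟩) else ⊤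

open Classical in
/-- The flat `A_e(r)` of an edge `e = uv`: the space of the vectors of `V_V = ∏_u ⋀² W` that have
`a` in the block of `u`, `-a` in the block of `v`, and `0` elsewhere, for
`a ∈ H_r(u) ∩ H_r(v)`. -/
noncomputable def RodConfiguration.flat (r : RodConfiguration d R) (G : Graph α β) (e : β) :
    Submodule ℝ (α → Wedge d 2) :=
  Submodule.span ℝ {x | ∃ u v, G.IsLink e u v ∧ ∃ a ∈ r.hyperplane u ⊓ r.hyperplane v,
    x = Pi.single u a - Pi.single v a}

open Classical in
/-- The vectors in the definition of `A_e(r)` form a linear subspace already. -/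
theorem RodConfiguration.mem_flat_iff (r : RodConfiguration d R) (G : Graph α β) {e : β} {u v : α}
    (h : G.IsLink e u v) (x : α → Wedge d 2) :
    x ∈ r.flat G e ↔ ∃ a ∈ r.hyperplane u ⊓ r.hyperplane v,
      x = Pi.single u a - Pi.single v a := by
  constructor
  · intro hx
    refine Submodule.span_induction ?_ ?_ ?_ ?_ hx
    · rintro x ⟨u', v', h', a, ha, rfl⟩
      rcases h.eq_and_eq_or_eq_and_eq h' with ⟨rfl, rfl⟩ | ⟨rfl, rfl⟩
      · exact ⟨a, ha, rfl⟩
      · refine ⟨-a, Submodule.neg_mem _ (by rwa [inf_comm]), ?_⟩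
        simp only [Pi.single_neg]
        abel
    · exact ⟨0, Submodule.zero_mem _, by simp⟩
    · rintro _ _ _ _ ⟨a, ha, rfl⟩ ⟨b, hb, rfl⟩
      refine ⟨a + b, Submodule.add_mem _ ha hb, ?_⟩
      simp only [Pi.single_add]
      abel
    · rintro c _ _ ⟨a, ha, rfl⟩
      refine ⟨c • a, Submodule.smul_mem _ c ha, ?_⟩
      simp only [Pi.single_smul, smul_sub]
  · rintro ⟨a, ha, rfl⟩
    exact Submodule.subset_span ⟨u, v, h, a, ha, rfl⟩

end Flats

end RodBar

/-!
The flats of the edges of `F` span the orthogonal complement of the space of the infinitesimal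
motions `motions q F`, the families `m` of vectors of `⋀² W` with `m u - m w ∈ span {q u, q w}` for
the edges `uw` of `F`; here `q v` is the normal vector of the hyperplane of a rod `v`, and `q v = 0`
for a body `v` (`orthogonal_iSup_edgeFlat`). The trivial motions (all of `V(F)` moves together, but
each rod may rotate about itself) show that the flats of `F` span a space of dimension at most
`f F` (`le_finrank_motions`). On the other hand, points in generic position of a family of flats are
independent as soon as any `k` of the flats span a space of dimension at least `k`
(`IsGenericRepresentatives.linearIndepOn`). So it has to be shown that the flats of an edge set `I`
that is independent in the count matroid span a space of dimension at least `|I|` for generic rods,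
that is, `dim (motions q I) + |I| ≤ D |V|`. As the dimension of the space of motions is upper
semicontinuous (`eventually_finrank_motions_le`), it suffices to find one suitable choice of rods
for each such `I` (`IsRodFamily.exists_finrank_motions_add_card_le`).

This is done by induction on the number of vertices. A vertex `v` is removed, a body if there is
one and otherwise a rod of degree at most `2 D - 3`. Let `W` be the remaining graph and `N` the
set of the neighbours of `v`. The edges `W` can be extended by edges `J` within `N` such that `W ∪
J` is still independent and contains a tight set with `N` among its vertices
(`exists_sparse_extension`), which bounds the degree of `v` by `|J| + D`, or `|J| + D - 1` if `v`
is a rod (`Sparse.card_star_le`). Every motion of `W ∪ N²` is a motion of `W ∪ J`, so that by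
induction its space has codimension at least `|W| + |J|`. If the edges at `v` force all the
conditions for the pairs of neighbours, then their codimension is as large as needed. A body does
so, but a rod need not, since the conditions at `v` leave to the relative motion of two neighbours
a component along the normal vector of `v`. In the remaining case, for a generic rod at `v`, a
condition that is not forced has codimension at least `D - 2` for the motions of `W`, which makes
up for the loss (`IsRodFamily.exists_rod`); the delicate case is the one in which the condition
for one pair of neighbours implies those for the others. It is excluded by the fact that a linear
map that has the normal vectors of all rods as eigenvectors is scalar
(`IsRodFamily.exists_scalar`, `IsRodFamily.eventually_relative_mem`). All that is used of the rods
is that their Plücker vectors contain the standard basis and sufficiently many sums of two basis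
vectors (`isRodFamily_rodNormal`).
-/

namespace RodBar

/-! ### Polynomial functions and generic points of an affine space -/

section Generic

/-- The algebra of the polynomial functions on `τ → ℝ`. -/
noncomputable def polyFun (τ : Type*) : Subalgebra ℝ ((τ → ℝ) → ℝ) :=
  (MvPolynomial.aeval (fun (i : τ) (b : τ → ℝ) => b i) :
    MvPolynomial τ ℝ →ₐ[ℝ] ((τ → ℝ) → ℝ)).range

theorem mem_polyFun_iff {τ : Type*} {f : (τ → ℝ) → ℝ} :
    f ∈ polyFun τ ↔ ∃ Q : MvPolynomial τ ℝ, ∀ b, MvPolynomial.eval b Q = f b := by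
  have key : ∀ (Q : MvPolynomial τ ℝ) (b : τ → ℝ),
      MvPolynomial.aeval (fun (i : τ) (b : τ → ℝ) => b i) Q b = MvPolynomial.eval b Q := by
    intro Q b
    induction Q using MvPolynomial.induction_on with
    | C a => simp [Pi.algebraMap_apply]
    | add p q hp hq => simp [hp, hq]
    | mul_X p i hp => simp [hp]
  constructor
  · rintro ⟨Q, rfl⟩
    exact ⟨Q, fun b => (key Q b).symm⟩
  · rintro ⟨Q, hQ⟩
    exact ⟨Q, funext fun b => (key Q b).trans (hQ b)⟩

theorem coord_mem_polyFun {τ : Type*} (i : τ) : (fun b : τ → ℝ => b i) ∈ polyFun τ :=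
  mem_polyFun_iff.2 ⟨MvPolynomial.X i, fun b => by simp⟩

theorem const_mem_polyFun {τ : Type*} (c : ℝ) : (fun _ : τ → ℝ => c) ∈ polyFun τ :=
  mem_polyFun_iff.2 ⟨MvPolynomial.C c, fun b => by simp⟩

theorem sum_mem_polyFun {τ ι : Type*} (s : Finset ι) {f : ι → (τ → ℝ) → ℝ}
    (h : ∀ i ∈ s, f i ∈ polyFun τ) : (fun b => ∑ i ∈ s, f i b) ∈ polyFun τ := by
  have := sum_mem h
  convert this using 1
  ext b
  simp

theorem det_mem_polyFun {τ n : Type*} [Fintype n] [DecidableEq n]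
    {M : (τ → ℝ) → Matrix n n ℝ} (h : ∀ i j, (fun b => M b i j) ∈ polyFun τ) :
    (fun b => (M b).det) ∈ polyFun τ := by
  simp only [Matrix.det_apply]
  refine sum_mem_polyFun _ fun π _ => ?_
  have h1 := prod_mem (t := Finset.univ) (fun i (_ : i ∈ Finset.univ) => h (π i) i)
  have h2 := (polyFun τ).smul_mem h1 ((Equiv.Perm.sign π : ℤ) : ℝ)
  convert h2 using 1
  ext b
  simp [Units.smul_def]

/-- Polynomial functions are stable under a polynomial change of variables. -/
theorem comp_mem_polyFun {τ σ : Type*} {f : (σ → ℝ) → ℝ} (hf : f ∈ polyFun σ)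
    {g : (τ → ℝ) → σ → ℝ} (hg : ∀ i, (fun b => g b i) ∈ polyFun τ) :
    (fun b => f (g b)) ∈ polyFun τ := by
  obtain ⟨Q, hQ⟩ := mem_polyFun_iff.1 hf
  simp only [← hQ]
  induction Q using MvPolynomial.induction_on generalizing f with
  | C a => simpa using const_mem_polyFun a
  | add p q hp hq =>
    simp only [map_add]
    exact add_mem (hp (f := fun b => MvPolynomial.eval b p) (mem_polyFun_iff.2 ⟨p, fun _ => rfl⟩)
      fun _ => rfl) (hq (f := fun b => MvPolynomial.eval b q) (mem_polyFun_iff.2 ⟨q, fun _ => rfl⟩)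
      fun _ => rfl)
  | mul_X p i hp =>
    simp only [map_mul, MvPolynomial.eval_X]
    exact mul_mem (hp (f := fun b => MvPolynomial.eval b p) (mem_polyFun_iff.2 ⟨p, fun _ => rfl⟩)
      fun _ => rfl) (hg i)

/-- The filter of the sets of points of `τ → ℝ` that contain the complement of a proper algebraic
subset: a property holds eventually along it iff it holds for generic points. -/
def generic (τ : Type*) : Filter (τ → ℝ) where
  sets := {S | ∃ Q : MvPolynomial τ ℝ, Q ≠ 0 ∧ ∀ b, MvPolynomial.eval b Q ≠ 0 → b ∈ S}
  univ_sets := ⟨1, one_ne_zero, fun _ _ => trivial⟩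
  sets_of_superset := by
    rintro S T ⟨Q, hQ, h⟩ hST
    exact ⟨Q, hQ, fun b hb => hST (h b hb)⟩
  inter_sets := by
    rintro S T ⟨Q, hQ, h⟩ ⟨Q', hQ', h'⟩
    refine ⟨Q * Q', mul_ne_zero hQ hQ', fun b hb => ?_⟩
    rw [map_mul] at hb
    exact ⟨h b (left_ne_zero_of_mul hb), h' b (right_ne_zero_of_mul hb)⟩

theorem eventually_generic_iff {τ : Type*} {P : (τ → ℝ) → Prop} :
    (∀ᶠ b in generic τ, P b) ↔
      ∃ Q : MvPolynomial τ ℝ, Q ≠ 0 ∧ ∀ b, MvPolynomial.eval b Q ≠ 0 → P b := Iff.rfl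

instance generic_neBot (τ : Type*) : (generic τ).NeBot := by
  rw [← Filter.empty_mem_iff_bot.not.trans Filter.neBot_iff.symm]
  rintro ⟨Q, hQ, h⟩
  refine hQ (MvPolynomial.funext fun b => ?_)
  by_contra hb
  exact h b (by simpa using hb)

theorem eventually_ne_zero {τ : Type*} {f : (τ → ℝ) → ℝ} (hf : f ∈ polyFun τ) {b₀ : τ → ℝ}
    (h : f b₀ ≠ 0) : ∀ᶠ b in generic τ, f b ≠ 0 := by
  obtain ⟨Q, hQ⟩ := mem_polyFun_iff.1 hf
  refine ⟨Q, ?_, fun b hb => ?_⟩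
  · rintro rfl
    exact h (by simp [← hQ])
  · change f b ≠ 0
    rwa [← hQ]

/-- A finite family of vectors of `κ → ℝ` is linearly independent iff its Gram determinant does
not vanish. -/
theorem linearIndependent_iff_gram_det_ne_zero {ι κ : Type*} [Fintype ι] [DecidableEq ι]
    [Fintype κ] (v : ι → κ → ℝ) :
    LinearIndependent ℝ v ↔ (Matrix.of v * (Matrix.of v).transpose).det ≠ 0 := by
  rw [Ne, ← Matrix.exists_vecMul_eq_zero_iff, not_exists, Fintype.linearIndependent_iff]
  have hsum : ∀ c : ι → ℝ, ∑ i, c i • v i = Matrix.vecMul c (Matrix.of v) := by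
    intro c
    ext k
    simp [Matrix.vecMul, dotProduct]
  simp only [hsum]
  constructor
  · rintro h c ⟨hc, hc0⟩
    refine hc (funext (h c ?_))
    rw [← Matrix.vecMul_vecMul, Matrix.vecMul_transpose] at hc0
    have h1 : Matrix.vecMul c (Matrix.of v) ⬝ᵥ Matrix.vecMul c (Matrix.of v) = 0 := by
      rw [← Matrix.dotProduct_mulVec, hc0, dotProduct_zero]
    exact dotProduct_self_eq_zero.1 h1
  · intro h c hc
    have h1 := h c
    rw [← Matrix.vecMul_vecMul, hc, Matrix.zero_vecMul] at h1
    have h2 : c = 0 := by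
      by_contra hne
      exact h1 ⟨hne, rfl⟩
    exact congrFun h2

/-- Linear independence of polynomially parametrized vectors is a generic property as soon as it
holds at one point. -/
theorem eventually_linearIndependent {τ ι κ : Type*} [Finite ι] [Finite κ]
    {v : (τ → ℝ) → ι → κ → ℝ} (hv : ∀ i k, (fun b => v b i k) ∈ polyFun τ) {b₀ : τ → ℝ}
    (h : LinearIndependent ℝ (v b₀)) : ∀ᶠ b in generic τ, LinearIndependent ℝ (v b) := by
  classical
  have := Fintype.ofFinite ι
  have := Fintype.ofFinite κ
  simp only [linearIndependent_iff_gram_det_ne_zero] at h ⊢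
  refine eventually_ne_zero (det_mem_polyFun fun i j => ?_) h
  simp only [Matrix.mul_apply, Matrix.of_apply, Matrix.transpose_apply]
  exact sum_mem_polyFun _ fun k _ => mul_mem (hv i k) (hv j k)

end Generic

/-! ### Infinitesimal motions -/

section Motions

variable {V K : Type*}

/-- The space of the families `m` of vectors of `ℝ^K` (one per vertex, an infinitesimal motion of
the body or rod at that vertex) with `m u - m w ∈ span {q u, q w}` for all pairs `(u, w) ∈ S`.
Here `q v` is the normal vector of the hyperplane `H(v)` of a rod `v`, and `q v = 0` for a body
`v`; the space is the orthogonal complement of the span of the flats of the edges `uw`, `(u, w) ∈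
S`. -/
def motions (q : V → K → ℝ) (S : Set (V × V)) : Submodule ℝ (V → K → ℝ) where
  carrier := {m | ∀ p ∈ S, m p.1 - m p.2 ∈ Submodule.span ℝ {q p.1, q p.2}}
  add_mem' := by
    intro m m' hm hm' p hp
    have := add_mem (hm p hp) (hm' p hp)
    simpa [add_sub_add_comm] using this
  zero_mem' := by
    intro p _
    simp
  smul_mem' := by
    intro c m hm p hp
    have := Submodule.smul_mem _ c (hm p hp)
    simpa [smul_sub] using this

theorem motions_anti (q : V → K → ℝ) {S T : Set (V × V)} (h : S ⊆ T) :
    motions q T ≤ motions q S := fun _ hm p hp => hm p (h hp)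

/-- The normal vectors vanish at the bodies, and those of the rods are nonzero and pairwise not
parallel. -/
structure Nondegenerate (R : Set V) (q : V → K → ℝ) : Prop where
  eq_zero : ∀ v ∉ R, q v = 0
  ne_zero : ∀ v ∈ R, q v ≠ 0
  pair : ∀ u ∈ R, ∀ w ∈ R, u ≠ w → LinearIndependent ℝ ![q u, q w]

theorem Nondegenerate.pair_eq_zero {R : Set V} {q : V → K → ℝ} (h : Nondegenerate R q) {u w : V}
    (huw : u ≠ w) {a b : ℝ} (hab : a • q u + b • q w = 0) : (u ∈ R → a = 0) ∧ (w ∈ R → b = 0) := by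
  by_cases hu : u ∈ R <;> by_cases hw : w ∈ R
  · have := LinearIndependent.pair_iff.1 (h.pair u hu w hw huw) a b hab
    exact ⟨fun _ => this.1, fun _ => this.2⟩
  · rw [h.eq_zero w hw, smul_zero, add_zero] at hab
    exact ⟨fun _ => (smul_eq_zero.1 hab).resolve_right (h.ne_zero u hu), fun h' => absurd h' hw⟩
  · rw [h.eq_zero u hu, smul_zero, zero_add] at hab
    exact ⟨fun h' => absurd h' hu, fun _ => (smul_eq_zero.1 hab).resolve_right (h.ne_zero w hw)⟩
  · exact ⟨fun h' => absurd h' hu, fun h' => absurd h' hw⟩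

open Classical in
/-- Among the polynomially parametrized families of normal vectors, the dimension of the space of
motions is upper semicontinuous at the nondegenerate ones, in the Zariski topology. -/
theorem eventually_finrank_motions_le [Finite V] [Finite K] {τ : Type*} {R : Set V}
    {q : (τ → ℝ) → V → K → ℝ} (hq : ∀ v k, (fun b => q b v k) ∈ polyFun τ)
    (hq0 : ∀ b, ∀ v ∉ R, q b v = 0) {b₀ : τ → ℝ} (hb₀ : Nondegenerate R (q b₀))
    {S : Set (V × V)} (hS : ∀ p ∈ S, p.1 ≠ p.2) :
    ∀ᶠ b in generic τ,
      Module.finrank ℝ (motions (q b) S) ≤ Module.finrank ℝ (motions (q b₀) S) := by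
  have := Fintype.ofFinite V
  have := Fintype.ofFinite K
  have hSfin : Fintype S := Fintype.ofFinite S
  obtain ⟨U, hU⟩ := Submodule.exists_isCompl (motions (q b₀) S)
  let u := Module.finBasis ℝ U
  -- A linear relation of the family below expresses that a vector of `U` is a motion.
  let F : (τ → ℝ) → (Fin (Module.finrank ℝ U) ⊕ ({x : S // x.1.1 ∈ R} ⊕ {x : S // x.1.2 ∈ R})) →
      (S × K) → ℝ := fun b => Sum.elim (fun i y => (u i : V → K → ℝ) y.1.1.1 y.2 -
        (u i : V → K → ℝ) y.1.1.2 y.2)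
      (Sum.elim (fun s y => if y.1 = s.1 then q b y.1.1.1 y.2 else 0)
        (fun s y => if y.1 = s.1 then q b y.1.1.2 y.2 else 0))
  have hF : ∀ (b : τ → ℝ) (g : _ → ℝ) (y : S × K), (∑ i, g i • F b i) y =
      (∑ i, g (Sum.inl i) • (u i : V → K → ℝ)) y.1.1.1 y.2 -
        (∑ i, g (Sum.inl i) • (u i : V → K → ℝ)) y.1.1.2 y.2 +
      ((if h : y.1.1.1 ∈ R then g (Sum.inr (Sum.inl ⟨y.1, h⟩)) else 0) * q b y.1.1.1 y.2 +
        (if h : y.1.1.2 ∈ R then g (Sum.inr (Sum.inr ⟨y.1, h⟩)) else 0) * q b y.1.1.2 y.2) := by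
    intro b g y
    rw [Fintype.sum_sum_type, Fintype.sum_sum_type]
    simp only [F, Sum.elim_inl, Sum.elim_inr, Pi.add_apply, Finset.sum_apply, Pi.smul_apply,
      smul_eq_mul, mul_sub, Finset.sum_sub_distrib]
    congr 2
    · split_ifs with h
      · rw [Finset.sum_eq_single ⟨y.1, h⟩]
        · simp
        · rintro s - hs
          rw [if_neg, mul_zero]
          rintro h'
          exact hs (Subtype.ext h'.symm)
        · simp
      · rw [zero_mul]
        refine Finset.sum_eq_zero fun s _ => ?_
        rw [if_neg, mul_zero]
        rintro h'
        exact h (h' ▸ s.2)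
    · split_ifs with h
      · rw [Finset.sum_eq_single ⟨y.1, h⟩]
        · simp
        · rintro s - hs
          rw [if_neg, mul_zero]
          rintro h'
          exact hs (Subtype.ext h'.symm)
        · simp
      · rw [zero_mul]
        refine Finset.sum_eq_zero fun s _ => ?_
        rw [if_neg, mul_zero]
        rintro h'
        exact h (h' ▸ s.2)
  have hFpoly : ∀ i y, (fun b => F b i y) ∈ polyFun τ := by
    rintro (i | s | s) y
    · exact const_mem_polyFun _
    · simp only [F, Sum.elim_inl, Sum.elim_inr]
      split_ifs
      · exact hq _ _
      · exact const_mem_polyFun _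
    · simp only [F, Sum.elim_inr]
      split_ifs
      · exact hq _ _
      · exact const_mem_polyFun _
  have hF₀ : LinearIndependent ℝ (F b₀) := by
    rw [Fintype.linearIndependent_iff]
    intro g hg
    set m : V → K → ℝ := ∑ i, g (Sum.inl i) • (u i : V → K → ℝ) with hm
    have hg' : ∀ x : S, m x.1.1 - m x.1.2 +
        ((if h : x.1.1 ∈ R then g (Sum.inr (Sum.inl ⟨x, h⟩)) else 0) • q b₀ x.1.1 +
        (if h : x.1.2 ∈ R then g (Sum.inr (Sum.inr ⟨x, h⟩)) else 0) • q b₀ x.1.2) = 0 := by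
      intro x
      ext k
      have := congrFun hg (x, k)
      rw [hF] at this
      exact this
    have hmU : m ∈ U := sum_mem fun i _ => U.smul_mem _ (u i).2
    have hmZ : m ∈ motions (q b₀) S := by
      intro p hp
      rw [eq_neg_of_add_eq_zero_left (hg' ⟨p, hp⟩)]
      exact Submodule.neg_mem _ (Submodule.mem_span_pair.2 ⟨_, _, rfl⟩)
    have hm0 : m = 0 := Submodule.disjoint_def.1 hU.disjoint m hmZ hmU
    have hinl : ∀ i, g (Sum.inl i) = 0 := by
      have h1 : ∑ i, g (Sum.inl i) • u i = 0 := by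
        apply Subtype.ext
        rw [Submodule.coe_zero, ← hm0, hm]
        simp
      exact Fintype.linearIndependent_iff.1 u.linearIndependent _ h1
    simp only [hm0, Pi.zero_apply, sub_zero, zero_add] at hg'
    have hpair := fun x : S => hb₀.pair_eq_zero (hS x.1 x.2) (hg' x)
    rintro (i | s | s)
    · exact hinl i
    · have := (hpair s.1).1 s.2
      rwa [dif_pos s.2] at this
    · have := (hpair s.1).2 s.2
      rwa [dif_pos s.2] at this
  filter_upwards [eventually_linearIndependent hFpoly hF₀] with b hb
  have hdisj : Disjoint (motions (q b) S) U := by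
    rw [Submodule.disjoint_def]
    intro m hmZ hmU
    have h1 : ∀ x : S, ∃ α β : ℝ, α • q b x.1.1 + β • q b x.1.2 = m x.1.1 - m x.1.2 :=
      fun x => Submodule.mem_span_pair.1 (hmZ x.1 x.2)
    choose α β hαβ using h1
    have hsum : ∑ i, u.repr ⟨m, hmU⟩ i • (u i : V → K → ℝ) = m := by
      have := congrArg U.subtype (u.sum_repr ⟨m, hmU⟩)
      rwa [map_sum] at this
    have hzero := Fintype.linearIndependent_iff.1 hb
      (Sum.elim (fun i => u.repr ⟨m, hmU⟩ i) (Sum.elim (fun s => -α s.1) (fun s => -β s.1))) (by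
        ext y
        rw [hF]
        simp only [Sum.elim_inl, Sum.elim_inr, hsum, Pi.zero_apply]
        have h2 := congrFun (hαβ y.1) y.2
        simp only [Pi.add_apply, Pi.smul_apply, smul_eq_mul, Pi.sub_apply] at h2
        rw [← h2]
        split_ifs with h3 h4 h4
        · ring
        · rw [hq0 b _ h4]
          simp
        · rw [hq0 b _ h3]
          simp
        · rw [hq0 b _ h3, hq0 b _ h4]
          simp)
    rw [← hsum]
    exact Finset.sum_eq_zero fun i _ => by simp [show u.repr ⟨m, hmU⟩ i = 0 from hzero (Sum.inl i)]
  have h1 := Submodule.finrank_sup_add_finrank_inf_eq (motions (q b) S) U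
  rw [hdisj.eq_bot, finrank_bot, add_zero] at h1
  have h2 := Submodule.finrank_le (motions (q b) S ⊔ U)
  have h3 := Submodule.finrank_add_eq_of_isCompl hU
  omega

open Classical in
/-- Adding a vertex `v` cuts down a space of motions: if `Z₁` contains the translations of `v`, and
no nonzero translation of `v` by a vector of `C` belongs to `Z₂ ⊆ Z₁`, the codimension is at least
`dim C`. -/
theorem finrank_add_finrank_le_of_translations [Finite V] [Finite K]
    {Z₁ Z₂ : Submodule ℝ (V → K → ℝ)} (h : Z₂ ≤ Z₁) {v : V} (C : Submodule ℝ (K → ℝ))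
    (hZ₁ : ∀ x, Pi.single v x ∈ Z₁) (hC : ∀ x ∈ C, Pi.single v x ∈ Z₂ → x = 0) :
    Module.finrank ℝ Z₂ + Module.finrank ℝ C ≤ Module.finrank ℝ Z₁ := by
  have := Fintype.ofFinite V
  have := Fintype.ofFinite K
  let L : (K → ℝ) →ₗ[ℝ] (V → K → ℝ) := LinearMap.single ℝ (fun _ => K → ℝ) v
  have hL : Function.Injective L := LinearMap.ker_eq_bot.1 (LinearMap.ker_single ..)
  have hdisj : Disjoint Z₂ (C.map L) := by
    rw [Submodule.disjoint_def]
    rintro _ hx ⟨x, hxC, rfl⟩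
    rw [hC x hxC hx, map_zero]
  have h1 := Submodule.finrank_sup_add_finrank_inf_eq Z₂ (C.map L)
  rw [hdisj.eq_bot, finrank_bot, add_zero] at h1
  have h2 : Module.finrank ℝ (C.map L) = Module.finrank ℝ C :=
    (Submodule.equivMapOfInjective L hL C).finrank_eq.symm
  have h3 : Z₂ ⊔ C.map L ≤ Z₁ := by
    refine sup_le h ?_
    rintro _ ⟨x, -, rfl⟩
    exact hZ₁ x
  have h4 := Submodule.finrank_mono h3
  omega

end Motions

/-! ### Sparse multigraphs and tight sets -/

section Sparse

open Classical

variable {V : Type*}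

/-- The set of the end vertices of the edges of `F`. Here and below an edge of a multigraph on `V`
is a triple `(u, w, i)`: the `i`-th parallel edge with the ends `u` and `w`. -/
noncomputable def verts (F : Finset (V × V × ℕ)) : Finset V :=
  F.image (fun e => e.1) ∪ F.image (fun e => e.2.1)

theorem mem_verts {F : Finset (V × V × ℕ)} {v : V} :
    v ∈ verts F ↔ ∃ e ∈ F, v = e.1 ∨ v = e.2.1 := by
  simp only [verts, Finset.mem_union, Finset.mem_image]
  grind

theorem verts_mono {F F' : Finset (V × V × ℕ)} (h : F ⊆ F') : verts F ⊆ verts F' := by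
  intro v hv
  rw [mem_verts] at hv ⊢
  obtain ⟨e, he, hv⟩ := hv
  exact ⟨e, h he, hv⟩

theorem verts_union (F F' : Finset (V × V × ℕ)) : verts (F ∪ F') = verts F ∪ verts F' := by
  ext v
  simp only [mem_verts, Finset.mem_union]
  grind

/-- The count `D (|X| - 1) - |X ∩ R|` of a set `X` of vertices. -/
noncomputable def vertexCount (D : ℕ) (R : Set V) (X : Finset V) : ℤ :=
  (D : ℤ) * ((X.card : ℤ) - 1) - ((X.filter (· ∈ R)).card : ℤ)

/-- A multigraph without loops in which every nonempty set `F` of edges has at most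
`D (|V(F)| - 1) - |R(F)|` members. -/
structure Sparse (D : ℕ) (R : Set V) (I : Finset (V × V × ℕ)) : Prop where
  loopless : ∀ e ∈ I, e.1 ≠ e.2.1
  le : ∀ F ⊆ I, F.Nonempty → (F.card : ℤ) ≤ vertexCount D R (verts F)

variable {D : ℕ} {R : Set V}

theorem Sparse.mono {I J : Finset (V × V × ℕ)} (h : Sparse D R J) (hIJ : I ⊆ J) : Sparse D R I :=
  ⟨fun e he => h.loopless e (hIJ he), fun F hF => h.le F (hF.trans hIJ)⟩

theorem vertexCount_union_add_inter (X Y : Finset V) :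
    vertexCount D R (X ∪ Y) + vertexCount D R (X ∩ Y) =
      vertexCount D R X + vertexCount D R Y := by
  have h1 := Finset.card_union_add_card_inter X Y
  have h2 := Finset.card_union_add_card_inter (X.filter (· ∈ R)) (Y.filter (· ∈ R))
  rw [← Finset.filter_union, ← Finset.filter_inter_distrib] at h2
  have h1' : ((X ∪ Y).card : ℤ) = X.card + Y.card - (X ∩ Y).card := by omega
  unfold vertexCount
  rw [h1']
  have h2' : (((X ∪ Y).filter (· ∈ R)).card : ℤ) = (X.filter (· ∈ R)).card +
    (Y.filter (· ∈ R)).card - ((X ∩ Y).filter (· ∈ R)).card := by omega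
  rw [h2']
  ring

theorem vertexCount_strictMono (hD : 2 ≤ D) {X Y : Finset V} (h : X ⊂ Y) :
    vertexCount D R X < vertexCount D R Y := by
  have h1 := Finset.card_lt_card h
  have h2 : (Y.filter (· ∈ R)).card ≤ (X.filter (· ∈ R)).card + (Y.card - X.card) := by
    have h3 : Y.filter (· ∈ R) ⊆ X.filter (· ∈ R) ∪ (Y \ X) := by
      intro v hv
      simp only [Finset.mem_union, Finset.mem_filter, Finset.mem_sdiff] at hv ⊢
      tauto
    have h4 := (Finset.card_le_card h3).trans (Finset.card_union_le _ _)
    rwa [Finset.card_sdiff_of_subset h.1] at h4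
  unfold vertexCount
  have h5 : (1 : ℤ) ≤ (Y.card : ℤ) - X.card := by omega
  have h6 : (2 : ℤ) * ((Y.card : ℤ) - X.card) ≤ D * ((Y.card : ℤ) - X.card) :=
    mul_le_mul_of_nonneg_right (by exact_mod_cast hD) (by omega)
  have h7 : (D : ℤ) * ((Y.card : ℤ) - 1) - D * ((X.card : ℤ) - 1) =
    D * ((Y.card : ℤ) - X.card) := by ring
  omega

theorem vertexCount_mono (hD : 2 ≤ D) {X Y : Finset V} (h : X ⊆ Y) :
    vertexCount D R X ≤ vertexCount D R Y := by
  rcases h.eq_or_ssubset with rfl | h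
  · exact le_rfl
  · exact (vertexCount_strictMono hD h).le

theorem vertexCount_insert (R : Set V) {v : V} {X : Finset V} (hv : v ∉ X) :
    vertexCount D R (insert v X) = vertexCount D R X + D - if v ∈ R then 1 else 0 := by
  unfold vertexCount
  rw [Finset.card_insert_of_notMem hv, Finset.filter_insert]
  split_ifs
  · rw [Finset.card_insert_of_notMem (by simp [hv])]
    push_cast
    ring
  · push_cast
    ring

theorem vertexCount_singleton (v : V) :
    vertexCount D R {v} = - if v ∈ R then 1 else 0 := by
  unfold vertexCount
  rw [Finset.filter_singleton]
  split_ifs <;> simp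

theorem vertexCount_pair {u w : V} (h : u ≠ w) : vertexCount D R {u, w} =
    D - (if u ∈ R then 1 else 0) - if w ∈ R then 1 else 0 := by
  rw [vertexCount_insert R (by simpa using h), vertexCount_singleton]
  ring

theorem vertexCount_nonneg (hD : 2 ≤ D) {X : Finset V} (h : 2 ≤ X.card) :
    0 ≤ vertexCount D R X := by
  obtain ⟨Y, hY, hYc⟩ := Finset.exists_subset_card_eq h
  obtain ⟨u, w, huw, rfl⟩ := Finset.card_eq_two.1 hYc
  refine le_trans ?_ (vertexCount_mono hD hY)
  rw [vertexCount_pair huw]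
  split_ifs <;> omega

/-- `X` is the vertex set of a nonempty set of edges of `I` attaining its count. -/
def Tight (D : ℕ) (R : Set V) (I : Finset (V × V × ℕ)) (X : Finset V) : Prop :=
  ∃ F ⊆ I, F.Nonempty ∧ verts F = X ∧ (F.card : ℤ) = vertexCount D R X

theorem eq_empty_of_verts_subset {I F : Finset (V × V × ℕ)} (hI : Sparse D R I) (hF : F ⊆ I)
    {X : Finset V} (hX : X.card ≤ 1) (h : verts F ⊆ X) : F = ∅ := by
  by_contra hne
  obtain ⟨e, he⟩ := Finset.nonempty_iff_ne_empty.2 hne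
  refine hI.loopless e (hF he) (Finset.card_le_one.1 hX _ (h ?_) _ (h ?_))
  · exact mem_verts.2 ⟨e, he, Or.inl rfl⟩
  · exact mem_verts.2 ⟨e, he, Or.inr rfl⟩

theorem verts_inter_subset (F F' : Finset (V × V × ℕ)) : verts (F ∩ F') ⊆ verts F ∩ verts F' :=
  Finset.subset_inter (verts_mono Finset.inter_subset_left) (verts_mono Finset.inter_subset_right)

/-- Tight sets with two common vertices are closed under unions, by modularity of the count. -/
theorem Tight.union (hD : 2 ≤ D) {I : Finset (V × V × ℕ)} (hI : Sparse D R I) {X Y : Finset V}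
    (hX : Tight D R I X) (hY : Tight D R I Y) (hXY : 2 ≤ (X ∩ Y).card) :
    Tight D R I (X ∪ Y) := by
  obtain ⟨F, hF, hFne, rfl, hFc⟩ := hX
  obtain ⟨F', hF', hFne', rfl, hFc'⟩ := hY
  refine ⟨F ∪ F', Finset.union_subset hF hF', hFne.mono Finset.subset_union_left,
    verts_union F F', le_antisymm ?_ ?_⟩
  · rw [← verts_union]
    exact hI.le _ (Finset.union_subset hF hF') (hFne.mono Finset.subset_union_left)
  · have h1 := vertexCount_union_add_inter (D := D) (R := R) (verts F) (verts F')
    have h2 := Finset.card_union_add_card_inter F F'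
    have h3 : ((F ∩ F').card : ℤ) ≤ vertexCount D R (verts F ∩ verts F') := by
      rcases (F ∩ F').eq_empty_or_nonempty with h | h
      · rw [h]
        exact vertexCount_nonneg hD hXY
      · exact (hI.le _ (Finset.inter_subset_left.trans hF) h).trans
          (vertexCount_mono hD (verts_inter_subset F F'))
    omega

/-- Three tight sets cannot share pairwise exactly one vertex, these three vertices being distinct:
together they would violate the count. -/
theorem not_tight_triangle (hD : 4 ≤ D) {I : Finset (V × V × ℕ)} (hI : Sparse D R I)
    {X Y Z : Finset V} (hX : Tight D R I X) (hY : Tight D R I Y) (hZ : Tight D R I Z)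
    {u w x : V} (hux : u ≠ w) (hXY : X ∩ Y = {u}) (hXZ : X ∩ Z = {w}) (hYZ : Y ∩ Z = {x}) :
    False := by
  obtain ⟨F, hF, hFne, rfl, hFc⟩ := hX
  obtain ⟨F', hF', hFne', rfl, hFc'⟩ := hY
  obtain ⟨F'', hF'', hFne'', rfl, hFc''⟩ := hZ
  have hxu : x ≠ u := by
    rintro rfl
    have h1 : x ∈ verts F ∩ verts F'' := by
      have h2 : x ∈ verts F ∩ verts F' := by rw [hXY]; simp
      have h3 : x ∈ verts F' ∩ verts F'' := by rw [hYZ]; simp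
      rw [Finset.mem_inter] at h2 h3 ⊢
      exact ⟨h2.1, h3.2⟩
    rw [hXZ, Finset.mem_singleton] at h1
    exact hux h1
  have hd1 : F ∩ F' = ∅ := eq_empty_of_verts_subset hI (Finset.inter_subset_left.trans hF)
    (by simp) ((verts_inter_subset F F').trans hXY.subset)
  have hd2 : (F ∪ F') ∩ F'' = ∅ := by
    rw [Finset.union_inter_distrib_right, Finset.union_eq_empty]
    exact ⟨eq_empty_of_verts_subset hI (Finset.inter_subset_left.trans hF)
      (by simp) ((verts_inter_subset F F'').trans hXZ.subset),
      eq_empty_of_verts_subset hI (Finset.inter_subset_left.trans hF')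
      (by simp) ((verts_inter_subset F' F'').trans hYZ.subset)⟩
  have hc1 := Finset.card_union_add_card_inter F F'
  have hc2 := Finset.card_union_add_card_inter (F ∪ F') F''
  rw [hd1, Finset.card_empty, add_zero] at hc1
  rw [hd2, Finset.card_empty, add_zero] at hc2
  have hle := hI.le ((F ∪ F') ∪ F'') (Finset.union_subset (Finset.union_subset hF hF') hF'')
    (hFne''.mono Finset.subset_union_right)
  rw [verts_union, verts_union] at hle
  have h1 := vertexCount_union_add_inter (D := D) (R := R) (verts F) (verts F')
  have h2 := vertexCount_union_add_inter (D := D) (R := R) (verts F ∪ verts F') (verts F'')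
  rw [hXY, vertexCount_singleton] at h1
  have h3 : (verts F ∪ verts F') ∩ verts F'' = {w, x} := by
    rw [Finset.union_inter_distrib_right, hXZ, hYZ]
    rfl
  have hwx : w ≠ x := by
    rintro rfl
    have h4 : w ∈ verts F ∩ verts F' := by
      have h5 : w ∈ verts F ∩ verts F'' := by rw [hXZ]; simp
      have h6 : w ∈ verts F' ∩ verts F'' := by rw [hYZ]; simp
      rw [Finset.mem_inter] at h5 h6 ⊢
      exact ⟨h5.1, h6.1⟩
    rw [hXY, Finset.mem_singleton] at h4
    exact hux h4.symm
  rw [h3, vertexCount_pair hwx] at h2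
  split_ifs at h1 h2 <;> omega

/-- If every two vertices of `N` belong to a common tight set, all of them do. -/
theorem exists_tight_superset (hD : 4 ≤ D) {I : Finset (V × V × ℕ)} (hI : Sparse D R I)
    {N : Finset V} (hN : 2 ≤ N.card)
    (h : ∀ u ∈ N, ∀ w ∈ N, u ≠ w → ∃ X, Tight D R I X ∧ u ∈ X ∧ w ∈ X) :
    ∃ X, Tight D R I X ∧ N ⊆ X := by
  -- Take a tight set containing two vertices of `N` and as many vertices of `N` as possible.
  obtain ⟨Y, hY, hYc⟩ := Finset.exists_subset_card_eq hN
  obtain ⟨u₀, w₀, huw₀, rfl⟩ := Finset.card_eq_two.1 hYc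
  obtain ⟨X₀, hX₀, hu₀, hw₀⟩ := h u₀ (hY (by simp)) w₀ (hY (by simp)) huw₀
  have hfin : {X | Tight D R I X}.Finite := by
    refine ((Finset.finite_toSet I.powerset).image verts).subset ?_
    rintro X ⟨F, hF, -, rfl, -⟩
    exact ⟨F, by simpa using hF, rfl⟩
  obtain ⟨X, hX, hmax⟩ := hfin.exists_maximalFor (fun X => (N ∩ X).card) _ ⟨X₀, hX₀⟩
  have hmax' : ∀ X', Tight D R I X' → (N ∩ X').card ≤ (N ∩ X).card := by
    intro X' hX'
    rcases le_total (N ∩ X').card (N ∩ X).card with h1 | h1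
    · exact h1
    · exact hmax hX' h1
  have hX2 : 2 ≤ (N ∩ X).card := by
    refine le_trans ?_ (hmax' X₀ hX₀)
    rw [← hYc]
    refine Finset.card_le_card (fun v hv => Finset.mem_inter.2 ⟨hY hv, ?_⟩)
    simp only [Finset.mem_insert, Finset.mem_singleton] at hv
    rcases hv with rfl | rfl <;> assumption
  refine ⟨X, hX, ?_⟩
  by_contra hnot
  obtain ⟨x, hxN, hxX⟩ := Finset.not_subset.1 hnot
  have hbig : ∀ Y, Tight D R I Y → x ∈ Y → ¬ 2 ≤ (X ∩ Y).card := by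
    intro Y hY hxY h2
    have h3 := hmax' _ (hX.union (by omega) hI hY h2)
    have h4 : (N ∩ X).card < (N ∩ (X ∪ Y)).card := by
      refine Finset.card_lt_card ⟨Finset.inter_subset_inter_left Finset.subset_union_left, ?_⟩
      intro h5
      have := h5 (Finset.mem_inter.2 ⟨hxN, Finset.mem_union_right _ hxY⟩)
      exact hxX (Finset.mem_inter.1 this).2
    omega
  have hone : ∀ {S : Finset V} {v : V}, v ∈ S → ¬ 2 ≤ S.card → S = {v} := by
    intro S v hv hS
    exact Finset.eq_singleton_iff_unique_mem.2
      ⟨hv, fun y hy => Finset.card_le_one.1 (by omega) y hy v hv⟩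
  obtain ⟨S, hS, hSc⟩ := Finset.exists_subset_card_eq hX2
  obtain ⟨u, w, huw, rfl⟩ := Finset.card_eq_two.1 hSc
  have hu := Finset.mem_inter.1 (hS (show u ∈ {u, w} by simp))
  have hw := Finset.mem_inter.1 (hS (show w ∈ {u, w} by simp))
  obtain ⟨Y, hY, huY, hxY⟩ := h u hu.1 x hxN (by rintro rfl; exact hxX hu.2)
  obtain ⟨Z, hZ, hwZ, hxZ⟩ := h w hw.1 x hxN (by rintro rfl; exact hxX hw.2)
  have hXY := hone (Finset.mem_inter.2 ⟨hu.2, huY⟩) (hbig Y hY hxY)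
  have hXZ := hone (Finset.mem_inter.2 ⟨hw.2, hwZ⟩) (hbig Z hZ hxZ)
  by_cases hYZ : 2 ≤ (Y ∩ Z).card
  · refine hbig _ (hY.union (by omega) hI hZ hYZ) (Finset.mem_union_left _ hxY) ?_
    rw [← Finset.card_pair huw]
    refine Finset.card_le_card ?_
    intro v hv
    simp only [Finset.mem_insert, Finset.mem_singleton] at hv
    rcases hv with rfl | rfl
    · exact Finset.mem_inter.2 ⟨hu.2, Finset.mem_union_left _ huY⟩
    · exact Finset.mem_inter.2 ⟨hw.2, Finset.mem_union_right _ hwZ⟩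
  · exact not_tight_triangle hD hI hX hY hZ huw hXY hXZ
      (hone (Finset.mem_inter.2 ⟨hxY, hxZ⟩) hYZ)

/-- A sparse graph can be extended by edges joining vertices of `N` so that the resulting graph is
sparse and has a tight set containing `N`. -/
theorem exists_sparse_extension (hD : 4 ≤ D) {W : Finset (V × V × ℕ)} (hW : Sparse D R W)
    {N : Finset V} (hN : 2 ≤ N.card) :
    ∃ J : Finset (V × V × ℕ), Disjoint W J ∧ Sparse D R (W ∪ J) ∧
      (∀ e ∈ J, e.1 ∈ N ∧ e.2.1 ∈ N) ∧ ∃ X, Tight D R (W ∪ J) X ∧ N ⊆ X := by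
  let P : ℕ → Prop := fun k => ∃ J : Finset (V × V × ℕ), Disjoint W J ∧ Sparse D R (W ∪ J) ∧
    (∀ e ∈ J, e.1 ∈ N ∧ e.2.1 ∈ N) ∧ J.card = k
  have hbound : ∀ k, P k → k ≤ (vertexCount D R (verts W ∪ N)).toNat := by
    rintro k ⟨J, -, hJ, hJN, rfl⟩
    rcases J.eq_empty_or_nonempty with rfl | hne
    · simp
    · have h1 := hJ.le J Finset.subset_union_right hne
      have h2 : verts J ⊆ verts W ∪ N := by
        intro v hv
        obtain ⟨e, he, hv⟩ := mem_verts.1 hv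
        refine Finset.mem_union_right _ ?_
        rcases hv with rfl | rfl
        · exact (hJN e he).1
        · exact (hJN e he).2
      have h3 := vertexCount_mono (D := D) (R := R) (by omega) h2
      omega
  have hP0 : P 0 := ⟨∅, by simp, by simpa using hW, by simp, rfl⟩
  obtain ⟨J, hWJ, hJ, hJN, hJc⟩ := Nat.findGreatest_spec (P := P) (Nat.zero_le _) hP0
  refine ⟨J, hWJ, hJ, hJN, exists_tight_superset hD hJ hN ?_⟩
  intro u hu w hw huw
  -- A new edge `uw` violates sparsity, as `J` is as large as possible.
  obtain ⟨i, hi⟩ := Infinite.exists_notMem_finset ((W ∪ J).image (fun e => e.2.2))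
  have he : ((u, w, i) : V × V × ℕ) ∉ W ∪ J := fun h =>
    hi (Finset.mem_image.2 ⟨(u, w, i), h, rfl⟩)
  have hns : ¬ Sparse D R (insert (u, w, i) (W ∪ J)) := by
    intro hs
    have hPs : P (J.card + 1) := by
      refine ⟨insert (u, w, i) J, ?_, ?_, ?_, Finset.card_insert_of_notMem fun h =>
        he (Finset.mem_union_right _ h)⟩
      · rw [Finset.disjoint_insert_right]
        exact ⟨fun h => he (Finset.mem_union_left _ h), hWJ⟩
      · rwa [Finset.union_insert]
      · intro e he
        rcases Finset.mem_insert.1 he with rfl | he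
        · exact ⟨hu, hw⟩
        · exact hJN e he
    exact absurd ((Nat.le_findGreatest (P := P) (hbound _ hPs) hPs).trans hJc.ge) (by omega)
  have hviol : ∃ F ⊆ insert (u, w, i) (W ∪ J), F.Nonempty ∧
      vertexCount D R (verts F) < F.card := by
    by_contra! hcon
    refine hns ⟨?_, hcon⟩
    intro e he
    rcases Finset.mem_insert.1 he with rfl | he
    · exact huw
    · exact hJ.loopless e he
  obtain ⟨F, hF, hFne, hlt⟩ := hviol
  have heF : (u, w, i) ∈ F := by
    by_contra heF
    exact absurd (hJ.le F ((Finset.subset_insert_iff_of_notMem heF).1 hF) hFne) (not_le.2 hlt)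
  have hF' : F.erase (u, w, i) ⊆ W ∪ J := Finset.subset_insert_iff.1 hF
  have hFc := Finset.card_erase_add_one heF
  have huF : u ∈ verts F := mem_verts.2 ⟨_, heF, Or.inl rfl⟩
  have hwF : w ∈ verts F := mem_verts.2 ⟨_, heF, Or.inr rfl⟩
  have hne : (F.erase (u, w, i)).Nonempty := by
    by_contra hemp
    rw [Finset.not_nonempty_iff_eq_empty] at hemp
    rw [hemp, Finset.card_empty] at hFc
    have h1 : ({u, w} : Finset V) ⊆ verts F := by
      intro v hv
      simp only [Finset.mem_insert, Finset.mem_singleton] at hv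
      rcases hv with rfl | rfl <;> assumption
    have h2 := vertexCount_mono (D := D) (R := R) (by omega) h1
    rw [vertexCount_pair huw] at h2
    split_ifs at h2 <;> omega
  have hle := hJ.le _ hF' hne
  have hsub : verts (F.erase (u, w, i)) ⊆ verts F := verts_mono (Finset.erase_subset _ _)
  have heq : verts (F.erase (u, w, i)) = verts F := by
    by_contra hne'
    have := vertexCount_strictMono (D := D) (R := R) (by omega) (hsub.ssubset_of_ne hne')
    omega
  rw [heq] at hle
  exact ⟨verts F, ⟨_, hF', hne, heq, by omega⟩, huF, hwF⟩

end Sparse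

/-! ### Families of rods -/

section RodFamilies

variable {V K σ : Type*}

/-- What is needed of the polynomially parametrized family `θ` of the normal vectors of the dual
hyperplanes of rods: it contains multiples of all the vectors of the standard basis, and these are
connected by the combinations of two basis vectors that belong to the family. (By the second
property a linear map that has all the members of the family as eigenvectors is scalar.) -/
structure IsRodFamily [DecidableEq K] (θ : (σ → ℝ) → K → ℝ) : Prop where
  poly : ∀ k, (fun x => θ x k) ∈ polyFun σ
  basis : ∀ k, ∃ x c, c ≠ 0 ∧ θ x = Pi.single k c
  joined : ∀ k k', Relation.ReflTransGen
    (fun i j => ∃ x a c, a ≠ 0 ∧ c ≠ 0 ∧ i ≠ j ∧ θ x = Pi.single i a + Pi.single j c) k k'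

open Classical in
/-- The normal vectors belonging to a choice `b` of parameters for the rods `v ∈ R`; they vanish at
the bodies. -/
noncomputable def normals (R : Set V) (θ : (σ → ℝ) → K → ℝ) (b : R × σ → ℝ) (v : V) : K → ℝ :=
  if h : v ∈ R then θ (fun i => b (⟨v, h⟩, i)) else 0

theorem normals_of_mem {R : Set V} (θ : (σ → ℝ) → K → ℝ) (b : R × σ → ℝ) {v : V} (h : v ∈ R) :
    normals R θ b v = θ (fun i => b (⟨v, h⟩, i)) := dif_pos h

theorem normals_of_notMem {R : Set V} (θ : (σ → ℝ) → K → ℝ) (b : R × σ → ℝ) {v : V} (h : v ∉ R) :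
    normals R θ b v = 0 := dif_neg h

/-- The normal vectors are nondegenerate, three of them are linearly independent, and so are two of
them together with two vectors of the standard basis. -/
structure GeneralPosition [DecidableEq K] (R : Set V) (q : V → K → ℝ) : Prop
    extends Nondegenerate R q where
  triple : ∀ u ∈ R, ∀ w ∈ R, ∀ x ∈ R, u ≠ w → u ≠ x → w ≠ x →
    LinearIndependent ℝ ![q u, q w, q x]
  quad : ∀ u ∈ R, ∀ w ∈ R, u ≠ w → ∀ k k', k ≠ k' →
    LinearIndependent ℝ ![q u, q w, Pi.single k 1, Pi.single k' 1]

theorem linearIndependent_single [DecidableEq K] [Finite K] {n : ℕ} (f : Fin n → K)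
    (hf : Function.Injective f) (c : Fin n → ℝ) (hc : ∀ i, c i ≠ 0) :
    LinearIndependent ℝ (fun i => (Pi.single (f i) (c i) : K → ℝ)) := by
  rw [Fintype.linearIndependent_iff]
  intro g hg i
  have := congrFun hg (f i)
  simp only [Finset.sum_apply, Pi.smul_apply, smul_eq_mul, Pi.zero_apply] at this
  rw [Finset.sum_eq_single i] at this
  · simpa [hc i] using this
  · intro j _ hj
    rw [Pi.single_eq_of_ne (fun h => hj (hf h).symm), mul_zero]
  · simp

theorem exists_notMem_of_card_lt [Fintype K] {s : Finset K} (h : s.card < Fintype.card K) :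
    ∃ k, k ∉ s := by
  by_contra! hcon
  rw [Finset.eq_univ_iff_forall.2 hcon, Finset.card_univ] at h
  exact lt_irrefl _ h

variable [DecidableEq K] {θ : (σ → ℝ) → K → ℝ} {R : Set V}

theorem IsRodFamily.normals_poly (hθ : IsRodFamily θ) (v : V) (k : K) :
    (fun b : R × σ → ℝ => normals R θ b v k) ∈ polyFun (R × σ) := by
  by_cases h : v ∈ R
  · simp only [normals_of_mem θ _ h]
    exact comp_mem_polyFun (hθ.poly k) fun i => coord_mem_polyFun _
  · simp only [normals_of_notMem θ _ h]
    exact const_mem_polyFun 0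

theorem IsRodFamily.eventually_ne_zero (hθ : IsRodFamily θ) [Nonempty K] {u : V} (hu : u ∈ R) :
    ∀ᶠ b in generic (R × σ), normals R θ b u ≠ 0 := by
  obtain ⟨k⟩ := ‹Nonempty K›
  obtain ⟨p, c, hc, hp⟩ := hθ.basis k
  have := RodBar.eventually_ne_zero (hθ.normals_poly (R := R) u k) (b₀ := fun y => p y.2) (by
    rw [normals_of_mem θ _ hu]
    simpa [hp] using hc)
  filter_upwards [this] with b hb h
  exact hb (by simp [h])

variable [Fintype K]

theorem IsRodFamily.eventually_triple (hθ : IsRodFamily θ) (hK : 4 ≤ Fintype.card K) {u w x : V}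
    (hu : u ∈ R) (hw : w ∈ R) (hx : x ∈ R) (huw : u ≠ w) (hux : u ≠ x) (hwx : w ≠ x) :
    ∀ᶠ b in generic (R × σ), LinearIndependent ℝ
      ![normals R θ b u, normals R θ b w, normals R θ b x] := by
  classical
  obtain ⟨f⟩ : Nonempty (Fin 3 ↪ K) := Function.Embedding.nonempty_of_card_le (by simp; omega)
  choose p c hc hp using hθ.basis
  let b₀ : R × σ → ℝ := fun y => if y.1.1 = u then p (f 0) y.2 else
    if y.1.1 = w then p (f 1) y.2 else p (f 2) y.2
  refine eventually_linearIndependent (b₀ := b₀) ?_ ?_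
  · intro i k
    fin_cases i <;> exact hθ.normals_poly _ k
  · convert linearIndependent_single f f.injective (fun i => c (f i)) (fun i => hc _) using 1
    ext i : 1
    fin_cases i
    · simp [normals_of_mem θ _ hu, b₀, hp]
    · simp [normals_of_mem θ _ hw, b₀, hp, huw.symm]
    · simp [normals_of_mem θ _ hx, b₀, hp, hux.symm, hwx.symm]

theorem IsRodFamily.eventually_quad (hθ : IsRodFamily θ) (hK : 4 ≤ Fintype.card K) {u w : V}
    (hu : u ∈ R) (hw : w ∈ R) (huw : u ≠ w) {k k' : K} (hk : k ≠ k') :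
    ∀ᶠ b in generic (R × σ), LinearIndependent ℝ
      ![normals R θ b u, normals R θ b w, Pi.single k 1, Pi.single k' 1] := by
  classical
  obtain ⟨k₁, hk₁⟩ := exists_notMem_of_card_lt (s := {k, k'})
    (Finset.card_le_two.trans_lt (by omega))
  obtain ⟨k₂, hk₂⟩ := exists_notMem_of_card_lt (s := {k, k', k₁})
    (Finset.card_le_three.trans_lt (by omega))
  simp only [Finset.mem_insert, Finset.mem_singleton, not_or] at hk₁ hk₂
  choose p c hc hp using hθ.basis
  let b₀ : R × σ → ℝ := fun y => if y.1.1 = u then p k₁ y.2 else p k₂ y.2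
  refine eventually_linearIndependent (b₀ := b₀) ?_ ?_
  · intro i k
    fin_cases i
    · exact hθ.normals_poly _ k
    · exact hθ.normals_poly _ k
    · exact const_mem_polyFun _
    · exact const_mem_polyFun _
  · have hf : Function.Injective ![k₁, k₂, k, k'] := by
      intro i j hij
      fin_cases i <;> fin_cases j <;> simp_all
    convert linearIndependent_single ![k₁, k₂, k, k'] hf ![c k₁, c k₂, 1, 1] ?_ using 1
    · ext i : 1
      fin_cases i
      · simp [normals_of_mem θ _ hu, b₀, hp]
      · simp [normals_of_mem θ _ hw, b₀, hp, huw.symm]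
      · simp
      · simp
    · intro i
      fin_cases i <;> simp [hc]

theorem IsRodFamily.eventually_generalPosition (hθ : IsRodFamily θ) [Finite V]
    (hK : 4 ≤ Fintype.card K) :
    ∀ᶠ b in generic (R × σ), GeneralPosition R (normals R θ b) := by
  have hne : Nonempty K := Fintype.card_pos_iff.1 (by omega)
  have h1 : ∀ᶠ b in generic (R × σ), ∀ v ∈ R, normals R θ b v ≠ 0 := by
    simp only [Filter.eventually_all]
    exact fun v hv => hθ.eventually_ne_zero hv
  have h2 : ∀ᶠ b in generic (R × σ), ∀ u ∈ R, ∀ w ∈ R, ∀ x ∈ R, u ≠ w → u ≠ x → w ≠ x →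
      LinearIndependent ℝ ![normals R θ b u, normals R θ b w, normals R θ b x] := by
    simp only [Filter.eventually_all]
    exact fun u hu w hw x hx huw hux hwx => hθ.eventually_triple hK hu hw hx huw hux hwx
  have h3 : ∀ᶠ b in generic (R × σ), ∀ u ∈ R, ∀ w ∈ R, u ≠ w → ∀ k k', k ≠ k' →
      LinearIndependent ℝ
        ![normals R θ b u, normals R θ b w, Pi.single k 1, Pi.single k' 1] := by
    simp only [Filter.eventually_all]
    exact fun u hu w hw huw k k' hk => hθ.eventually_quad hK hu hw huw hk
  filter_upwards [h1, h2, h3] with b hb1 hb2 hb3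
  refine ⟨⟨fun v hv => normals_of_notMem θ b hv, hb1, ?_⟩, hb2, hb3⟩
  intro u hu w hw huw
  obtain ⟨k, k', hk⟩ := Fintype.exists_pair_of_one_lt_card (α := K) (by omega)
  have h := (hb3 u hu w hw huw k k' hk).comp ![0, 1] (by decide)
  convert h using 1
  ext i : 1
  fin_cases i <;> rfl

/-- A generic choice of parameters is in general position, and it minimizes the dimensions of all
the spaces of motions among the nondegenerate choices. -/
theorem IsRodFamily.eventually_minimal (hθ : IsRodFamily θ) [Finite V]
    (hK : 4 ≤ Fintype.card K) :
    ∀ᶠ b in generic (R × σ), GeneralPosition R (normals R θ b) ∧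
      ∀ S : Set (V × V), (∀ p ∈ S, p.1 ≠ p.2) → ∀ b₀, Nondegenerate R (normals R θ b₀) →
        Module.finrank ℝ (motions (normals R θ b) S) ≤
          Module.finrank ℝ (motions (normals R θ b₀) S) := by
  refine (hθ.eventually_generalPosition hK).and ?_
  rw [Filter.eventually_all]
  intro S
  rw [Filter.eventually_imp_distrib_left]
  intro hS
  by_cases hex : ∃ b₀, Nondegenerate R (normals R θ b₀)
  · obtain ⟨b₀, hb₀, hmin⟩ := exists_minimalFor_of_wellFoundedLT
      (fun b => Nondegenerate R (normals R θ b))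
      (fun b => Module.finrank ℝ (motions (normals R θ b) S)) hex
    filter_upwards [eventually_finrank_motions_le (q := normals R θ) hθ.normals_poly
      (fun b v hv => normals_of_notMem θ b hv) hb₀ hS] with b hb b₁ hb₁
    refine hb.trans ?_
    rcases le_total (Module.finrank ℝ (motions (normals R θ b₀) S))
      (Module.finrank ℝ (motions (normals R θ b₁) S)) with h | h
    · exact h
    · exact hmin hb₁ h
  · exact Filter.Eventually.of_forall fun b b₀ hb₀ => absurd ⟨b₀, hb₀⟩ hex

theorem IsRodFamily.comp_linear_poly (hθ : IsRodFamily θ) (φ : (K → ℝ) →ₗ[ℝ] ℝ) :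
    (fun x => φ (θ x)) ∈ polyFun σ := by
  have hsum : ∀ y, φ y = ∑ k, y k * φ (Pi.single k 1) := by
    intro y
    conv_lhs => rw [← Finset.univ_sum_single y]
    rw [map_sum]
    refine Finset.sum_congr rfl fun k _ => ?_
    rw [← smul_eq_mul, ← map_smul, ← Pi.single_smul, smul_eq_mul, mul_one]
  rw [show (fun x => φ (θ x)) = fun x => ∑ k, θ x k * φ (Pi.single k 1) from
    funext fun x => hsum _]
  exact sum_mem_polyFun _ fun k _ => mul_mem (hθ.poly k) (const_mem_polyFun _)

/-- Generic members of the family avoid a given proper subspace. -/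
theorem IsRodFamily.eventually_notMem (hθ : IsRodFamily θ) {P : Submodule ℝ (K → ℝ)}
    (hP : P ≠ ⊤) : ∀ᶠ x in generic σ, θ x ∉ P := by
  obtain ⟨φ, hφ, hle⟩ := P.exists_le_ker_of_lt_top (lt_top_iff_ne_top.2 hP)
  obtain ⟨k, hk⟩ : ∃ k, φ (Pi.single k 1) ≠ 0 := by
    by_contra! hcon
    refine hφ (LinearMap.pi_ext' fun k => LinearMap.ext_ring ?_)
    simpa using hcon k
  obtain ⟨x, c, hc, hx⟩ := hθ.basis k
  have h0 : φ (θ x) ≠ 0 := by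
    rw [hx, show (Pi.single k c : K → ℝ) = c • Pi.single k 1 by
      rw [← Pi.single_smul, smul_eq_mul, mul_one], map_smul]
    exact mul_ne_zero hc hk
  filter_upwards [RodBar.eventually_ne_zero (hθ.comp_linear_poly φ) h0] with y hy hyP
  exact hy (hle hyP)

end RodFamilies

/-! ### Adding a rod -/

section LinearAlgebra

variable {M E : Type*} [AddCommGroup M] [Module ℝ M]
  [AddCommGroup E] [Module ℝ E]

/-- A linear map into `E` which together with `C` spans `E` has a linear section modulo `C`. -/
theorem exists_linear_lift {Z : Submodule ℝ M} {f : M →ₗ[ℝ] E} {C : Submodule ℝ E}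
    (h : Z.map f ⊔ C = ⊤) : ∃ Θ : E →ₗ[ℝ] M, ∀ y, Θ y ∈ Z ∧ f (Θ y) - y ∈ C := by
  have h1 : LinearMap.range ((C.mkQ.comp f).domRestrict Z) = ⊤ := by
    rw [LinearMap.range_domRestrict, Submodule.map_comp, Submodule.map_mkQ_eq_top, sup_comm, h]
  obtain ⟨s, hs⟩ := LinearMap.exists_rightInverse_of_surjective _ h1
  refine ⟨Z.subtype.comp (s.comp C.mkQ), fun y => ⟨(s (C.mkQ y)).2, ?_⟩⟩
  exact (Submodule.Quotient.eq C).1 (LinearMap.congr_fun hs (C.mkQ y))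

variable [FiniteDimensional ℝ M]

theorem finrank_inf_ker_add_finrank_map (Z : Submodule ℝ M) (g : M →ₗ[ℝ] E) :
    Module.finrank ℝ (Z ⊓ LinearMap.ker g : Submodule ℝ M) + Module.finrank ℝ (Z.map g) =
      Module.finrank ℝ Z := by
  have h := LinearMap.finrank_range_add_finrank_ker (g.domRestrict Z)
  rw [LinearMap.range_domRestrict, LinearMap.ker_domRestrict] at h
  rw [← Submodule.map_comap_subtype, Submodule.finrank_map_subtype_eq, ← h, add_comm]

theorem finrank_span_le_one (a : E) : Module.finrank ℝ (Submodule.span ℝ {a}) ≤ 1 := by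
  have h := finrank_span_finset_le_card (R := ℝ) ({a} : Finset E)
  rwa [Finset.coe_singleton, Finset.card_singleton] at h

theorem finrank_span_pair_le (a b : E) : Module.finrank ℝ (Submodule.span ℝ {a, b}) ≤ 2 := by
  classical
  have h := finrank_span_finset_le_card (R := ℝ) ({a, b} : Finset E)
  rw [Finset.coe_pair] at h
  exact h.trans Finset.card_le_two

/-- If `f` takes its values on a line modulo `C`, the condition `f m ∈ C` has codimension at most
one. -/
theorem finrank_le_finrank_inf_comap_add_one {Z : Submodule ℝ M} {f : M →ₗ[ℝ] E}
    {C : Submodule ℝ E} {t : E} (h : ∀ m ∈ Z, ∃ c : ℝ, f m - c • t ∈ C) :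
    Module.finrank ℝ Z ≤ Module.finrank ℝ (Z ⊓ C.comap f : Submodule ℝ M) + 1 := by
  have h1 := finrank_inf_ker_add_finrank_map Z (C.mkQ.comp f)
  have h2 : Z.map (C.mkQ.comp f) ≤ Submodule.span ℝ {C.mkQ t} := by
    rintro _ ⟨m, hm, rfl⟩
    obtain ⟨c, hc⟩ := h m hm
    refine Submodule.mem_span_singleton.2 ⟨c, ?_⟩
    rw [← map_smul]
    exact ((Submodule.Quotient.eq C).2 hc).symm
  have h3 := (Submodule.finrank_mono h2).trans (finrank_span_le_one _)
  rw [LinearMap.ker_comp, Submodule.ker_mkQ] at h1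
  omega

variable [FiniteDimensional ℝ E]

/-- If `f` takes all values modulo `C`, the condition `f m ∈ C` has codimension at least that of
`C`. -/
theorem finrank_inf_comap_add_finrank_le {Z : Submodule ℝ M} {f : M →ₗ[ℝ] E} {C : Submodule ℝ E}
    (h : Z.map f ⊔ C = ⊤) :
    Module.finrank ℝ (Z ⊓ C.comap f : Submodule ℝ M) + Module.finrank ℝ E ≤
      Module.finrank ℝ Z + Module.finrank ℝ C := by
  have h1 := finrank_inf_ker_add_finrank_map Z (C.mkQ.comp f)
  have h2 : Z.map (C.mkQ.comp f) = ⊤ := by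
    rw [Submodule.map_comp, Submodule.map_mkQ_eq_top, sup_comm, h]
  rw [h2, finrank_top, LinearMap.ker_comp, Submodule.ker_mkQ] at h1
  have h3 := Submodule.finrank_quotient_add_finrank C
  omega

end LinearAlgebra

section RodStep

variable {V K σ : Type*} {θ : (σ → ℝ) → K → ℝ} {R : Set V}

/-- The relative motion of `u` and `w`. -/
def relative (u w : V) : (V → K → ℝ) →ₗ[ℝ] (K → ℝ) :=
  (LinearMap.proj u : (V → K → ℝ) →ₗ[ℝ] (K → ℝ)) - LinearMap.proj w

theorem relative_apply (u w : V) (m : V → K → ℝ) : relative u w m = m u - m w := rfl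

variable [DecidableEq K]

theorem GeneralPosition.independent_mod {q : V → K → ℝ} (hq : GeneralPosition R q) {u w : V}
    (hu : u ∈ R) (hw : w ∈ R) (huw : u ≠ w) (i j : K) (hij : i ≠ j) (a c : ℝ)
    (h : (Pi.single i a + Pi.single j c : K → ℝ) ∈ Submodule.span ℝ {q u, q w}) :
    a = 0 ∧ c = 0 := by
  obtain ⟨s, t, hst⟩ := Submodule.mem_span_pair.1 h
  have h1 := Fintype.linearIndependent_iff.1 (hq.quad u hu w hw huw i j hij) ![s, t, -a, -c] (by
    have h2 : ∀ (k : K) (c : ℝ), (Pi.single k c : K → ℝ) = c • Pi.single k 1 := fun k c => by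
      rw [← Pi.single_smul, smul_eq_mul, mul_one]
    simp only [Fin.sum_univ_four, Matrix.cons_val]
    rw [h2 i a, h2 j c] at hst
    rw [hst]
    module)
  exact ⟨by simpa using h1 2, by simpa using h1 3⟩

variable [Fintype K]

/-- A linear map `L` for which the members of the family are eigenvectors modulo `B` is scalar
modulo `B`, if the vectors of the standard basis are pairwise independent modulo `B`. -/
theorem IsRodFamily.exists_scalar (hθ : IsRodFamily θ) (hK : 2 ≤ Fintype.card K)
    {B : Submodule ℝ (K → ℝ)}
    (hB : ∀ i j, i ≠ j → ∀ a c : ℝ, Pi.single i a + Pi.single j c ∈ B → a = 0 ∧ c = 0)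
    (L : (K → ℝ) →ₗ[ℝ] (K → ℝ))
    (hL : ∀ x, θ x ∉ B → ∃ s : ℝ, L (θ x) - s • θ x ∈ B) :
    ∃ r : ℝ, ∀ y, L y - r • y ∈ B := by
  have hscale : ∀ (k : K) (c : ℝ), (Pi.single k c : K → ℝ) = c • Pi.single k 1 := fun k c => by
    rw [← Pi.single_smul, smul_eq_mul, mul_one]
  have hk : ∀ k, ∃ r : ℝ, ∀ c : ℝ, L (Pi.single k c) - r • Pi.single k c ∈ B := by
    intro k
    obtain ⟨x, c, hc, hx⟩ := hθ.basis k
    have : Nontrivial K := Fintype.one_lt_card_iff_nontrivial.1 (by omega)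
    obtain ⟨j, hj⟩ := exists_ne k
    obtain ⟨s, hs⟩ := hL x (by
      rw [hx]
      intro hmem
      exact hc (hB k j hj.symm c 0 (by simpa using hmem)).1)
    refine ⟨s, fun c' => ?_⟩
    have h1 := B.smul_mem (c' / c) hs
    rw [hx, smul_sub, ← map_smul, smul_comm _ s, ← Pi.single_smul, smul_eq_mul,
      div_mul_cancel₀ _ hc] at h1
    exact h1
  choose r hr using hk
  have hstep : ∀ i j, (∃ x a c, a ≠ 0 ∧ c ≠ 0 ∧ i ≠ j ∧ θ x = Pi.single i a + Pi.single j c) →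
      r i = r j := by
    rintro i j ⟨x, a, c, ha, hc, hij, hx⟩
    obtain ⟨s, hs⟩ := hL x (by
      rw [hx]
      intro hmem
      exact ha (hB i j hij a c hmem).1)
    have h1 := B.sub_mem hs (B.add_mem (hr i a) (hr j c))
    have h2 := hB i j hij ((r i - s) * a) ((r j - s) * c) (by
      convert h1 using 1
      rw [hx, map_add, hscale i ((r i - s) * a), hscale j ((r j - s) * c), hscale i a, hscale j c]
      module)
    have h3 := (mul_eq_zero.1 h2.1).resolve_right ha
    have h4 := (mul_eq_zero.1 h2.2).resolve_right hc
    linarith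
  have hconst : ∀ i j, r i = r j := by
    intro i j
    induction hθ.joined i j with
    | refl => rfl
    | tail _ h ih => exact ih.trans (hstep _ _ h)
  have : Nonempty K := Fintype.card_pos_iff.1 (by omega)
  obtain ⟨k₀⟩ := ‹Nonempty K›
  refine ⟨r k₀, fun y => ?_⟩
  rw [← Finset.univ_sum_single y, map_sum, Finset.smul_sum, ← Finset.sum_sub_distrib]
  exact sum_mem fun k _ => hconst k₀ k ▸ hr k (y k)

/-- If some member of the family is not an eigenvector of `L` modulo `B`, a generic one is not. -/
theorem IsRodFamily.eventually_not_eigenvector (hθ : IsRodFamily θ) {B : Submodule ℝ (K → ℝ)}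
    (L : (K → ℝ) →ₗ[ℝ] (K → ℝ)) {x₀ : σ → ℝ} (hx₀ : θ x₀ ∉ B)
    (hL : ∀ s : ℝ, L (θ x₀) - s • θ x₀ ∉ B) :
    ∀ᶠ x in generic σ, ∀ c s : ℝ, c • L (θ x) - s • θ x ∈ B → c = 0 := by
  let π : (K → ℝ) →ₗ[ℝ] (Fin (Module.finrank ℝ ((K → ℝ) ⧸ B)) → ℝ) :=
    (Module.finBasis ℝ ((K → ℝ) ⧸ B)).equivFun.toLinearMap.comp B.mkQ
  have hπ : ∀ y, π y = 0 ↔ y ∈ B := by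
    intro y
    simp [π]
  have h0 : LinearIndependent ℝ ![π (L (θ x₀)), π (θ x₀)] := by
    rw [LinearIndependent.pair_iff]
    intro c s hcs
    rw [← map_smul π, ← map_smul π, ← map_add, hπ] at hcs
    by_cases hc : c = 0
    · subst hc
      rw [zero_smul, zero_add] at hcs
      refine ⟨rfl, ?_⟩
      by_contra hs
      exact hx₀ ((B.smul_mem_iff hs).1 hcs)
    · refine absurd ?_ (hL (-(s / c)))
      have := B.smul_mem c⁻¹ hcs
      rw [smul_add, smul_smul, inv_mul_cancel₀ hc, one_smul, smul_smul] at this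
      convert this using 1
      rw [neg_smul, sub_neg_eq_add, div_eq_inv_mul]
  filter_upwards [eventually_linearIndependent (v := fun x => ![π (L (θ x)), π (θ x)]) (by
    intro i k
    fin_cases i
    · exact hθ.comp_linear_poly ((LinearMap.proj k).comp (π.comp L))
    · exact hθ.comp_linear_poly ((LinearMap.proj k).comp π)) h0] with x hx c s hcs
  refine (LinearIndependent.pair_iff.1 hx c (-s) ?_).1
  rw [← map_smul π, ← map_smul π, ← map_add, hπ]
  convert hcs using 1
  module

/-- Suppose that the relative motion `m w - m w'` of `m ∈ Z` takes all values modulo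
`span {q w, q w'}` and that those `m` for which it vanishes modulo this plane satisfy the conditions
for the pairs `(w, u)` and `(w', u)`. Then a generic rod `θ x` adjacent to `u`, `w`, `w'` forces the
condition for the pair `(w, w')`. Otherwise all the vectors `θ x` would be eigenvectors of linear
maps `L`, `L'` modulo `span {q w, q u}`, `span {q w', q u}`, with `L - L' = 1` modulo
`span {q w, q w'}`; then `L` and `L'` would be scalar, hence zero. -/
theorem IsRodFamily.eventually_relative_mem (hθ : IsRodFamily θ)
    (hK : 4 ≤ Fintype.card K)
    {q : V → K → ℝ} (hq : GeneralPosition R q) {w w' u : V} (hw : w ∈ R) (hw' : w' ∈ R)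
    (hu : u ∈ R) (hww' : w ≠ w') (hwu : w ≠ u) (hwu' : w' ≠ u) {Z : Submodule ℝ (V → K → ℝ)}
    (hZ : Z.map (relative w w') ⊔ Submodule.span ℝ {q w, q w'} = ⊤)
    (hZC : ∀ m ∈ Z, m w - m w' ∈ Submodule.span ℝ {q w, q w'} →
      m w - m u ∈ Submodule.span ℝ {q w, q u} ∧ m w' - m u ∈ Submodule.span ℝ {q w', q u}) :
    ∀ᶠ x in generic σ, ∀ m ∈ Z,
      (∃ s : ℝ, m w - m u - s • θ x ∈ Submodule.span ℝ {q w, q u}) →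
      (∃ s : ℝ, m w' - m u - s • θ x ∈ Submodule.span ℝ {q w', q u}) →
      (∃ c : ℝ, m w - m w' - c • θ x ∈ Submodule.span ℝ {q w, q w'}) →
      m w - m w' ∈ Submodule.span ℝ {q w, q w'} := by
  obtain ⟨Θ, hΘ⟩ := exists_linear_lift hZ
  simp only [relative_apply] at hΘ
  set C := Submodule.span ℝ {q w, q w'} with hC
  set B := Submodule.span ℝ {q w, q u} with hB
  set B' := Submodule.span ℝ {q w', q u} with hB'
  -- The lift of the component along `θ x` is subtracted from `m`.
  have hsub : ∀ x, ∀ m ∈ Z, ∀ c : ℝ, m w - m w' - c • θ x ∈ C →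
      (m w - m u) - c • relative w u (Θ (θ x)) ∈ B ∧
      (m w' - m u) - c • relative w' u (Θ (θ x)) ∈ B' := by
    intro x m hm c hc
    have h1 := hZC (m - c • Θ (θ x)) (Z.sub_mem hm (Z.smul_mem c (hΘ _).1)) (by
      have := C.sub_mem hc (C.smul_mem c (hΘ (θ x)).2)
      convert this using 1
      simp only [Pi.sub_apply, Pi.smul_apply]
      module)
    refine ⟨?_, ?_⟩
    · convert h1.1 using 1
      simp only [Pi.sub_apply, Pi.smul_apply, relative_apply]
      module
    · convert h1.2 using 1
      simp only [Pi.sub_apply, Pi.smul_apply, relative_apply]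
      module
  by_cases hL : ∀ x, θ x ∉ B → ∃ s : ℝ, (relative w u).comp Θ (θ x) - s • θ x ∈ B
  swap
  · push Not at hL
    obtain ⟨x₀, hx₀, hs⟩ := hL
    filter_upwards [hθ.eventually_not_eigenvector _ hx₀ hs] with x hx m hm ⟨s, hs⟩ _ ⟨c, hc⟩
    have h1 := hx c s (by
      have := B.sub_mem hs (hsub x m hm c hc).1
      convert this using 1
      simp only [LinearMap.comp_apply]
      module)
    rwa [h1, zero_smul, sub_zero] at hc
  by_cases hL' : ∀ x, θ x ∉ B' → ∃ s : ℝ, (relative w' u).comp Θ (θ x) - s • θ x ∈ B'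
  swap
  · push Not at hL'
    obtain ⟨x₀, hx₀, hs⟩ := hL'
    filter_upwards [hθ.eventually_not_eigenvector _ hx₀ hs] with x hx m hm _ ⟨s, hs⟩ ⟨c, hc⟩
    have h1 := hx c s (by
      have := B'.sub_mem hs (hsub x m hm c hc).2
      convert this using 1
      simp only [LinearMap.comp_apply]
      module)
    rwa [h1, zero_smul, sub_zero] at hc
  exfalso
  obtain ⟨r, hr⟩ := hθ.exists_scalar (by omega) (hq.independent_mod hw hu hwu) _ hL
  obtain ⟨r', hr'⟩ := hθ.exists_scalar (by omega) (hq.independent_mod hw' hu hwu') _ hL'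
  simp only [LinearMap.comp_apply, relative_apply] at hr hr'
  have hwC : q w ∈ C := Submodule.subset_span (by simp)
  have hwC' : q w' ∈ C := Submodule.subset_span (by simp)
  have hΘC : ∀ y ∈ C, Θ y w - Θ y u ∈ B ∧ Θ y w' - Θ y u ∈ B' := fun y hy =>
    hZC _ (hΘ y).1 (by simpa using C.add_mem (hΘ y).2 hy)
  have htriple := Fintype.linearIndependent_iff.1 (hq.triple w hw w' hw' u hu hww' hwu hwu')
  simp only [Fin.sum_univ_three, Matrix.cons_val] at htriple
  -- The lift of a vector of `C` satisfies the condition for the pair `(w, w')`, hence those for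
  -- `(w, u)` and `(w', u)`; applied to `q w'` and `q w` this gives `r = 0` and `r' = 0`.
  have hr0 : r = 0 := by
    have h1 : r • q w' ∈ B := by
      simpa using B.sub_mem (hΘC _ hwC').1 (hr (q w'))
    obtain ⟨s, t, hst⟩ := Submodule.mem_span_pair.1 h1
    have := htriple ![s, -r, t] (by
      simp only [Matrix.cons_val]
      rw [add_right_comm, hst]
      module) 1
    simpa using this
  have hr0' : r' = 0 := by
    have h1 : r' • q w ∈ B' := by
      simpa using B'.sub_mem (hΘC _ hwC).2 (hr' (q w))
    obtain ⟨s, t, hst⟩ := Submodule.mem_span_pair.1 h1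
    have := htriple ![-r', s, t] (by
      simp only [Matrix.cons_val]
      rw [add_assoc, hst]
      module) 0
    simpa using this
  have htop : Submodule.span ℝ {q w, q w', q u} = ⊤ := by
    refine Submodule.eq_top_iff'.2 fun y => ?_
    have h1 := hr y
    have h2 := hr' y
    have h3 := (hΘ y).2
    rw [hr0, zero_smul, sub_zero] at h1
    rw [hr0', zero_smul, sub_zero] at h2
    have hBle : B ≤ Submodule.span ℝ {q w, q w', q u} :=
      Submodule.span_mono (by grind)
    have hBle' : B' ≤ Submodule.span ℝ {q w, q w', q u} :=
      Submodule.span_mono (by grind)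
    have hCle : C ≤ Submodule.span ℝ {q w, q w', q u} :=
      Submodule.span_mono (by grind)
    have := Submodule.sub_mem _ (Submodule.sub_mem _ (hBle h1) (hBle' h2)) (hCle h3)
    convert this using 1
    module
  classical
  have h1 := finrank_span_finset_le_card (R := ℝ) ({q w, q w', q u} : Finset (K → ℝ))
  have h2 := Finset.card_le_three (a := q w) (b := q w') (c := q u)
  rw [Finset.coe_insert, Finset.coe_pair, Set.finrank, htop, finrank_top,
    Module.finrank_fintype_fun_eq_card] at h1
  omega

/-- The inductive step for a rod `v` with the set `N` of neighbours: a new rod can be chosen for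
`v` such that the conditions at `v` cut down the space of motions as much as is needed. Here `S`
contains the conditions for the pairs of vertices other than `v`.

Let `Z₀` be the space of the motions satisfying the conditions `S`, `Z₁` that of those which
satisfy the conditions for the pairs of neighbours too, and `Z₂` that of those which satisfy `S`
and the conditions at `v`. If `Z₂ ≤ Z₁`, then `v` loses all its freedom but a rotation about
itself, which is the first alternative. Otherwise `θ x` is, for some pair of neighbours `w`, `w'`,
the relative motion of `w` and `w'` under a member of `Z₀`, modulo the plane of `w` and `w'`; as
`θ x` is generic, these relative motions are arbitrary. So the condition for the pair `w`, `w'`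
alone has codimension at least `D - 2` in `Z₀`, while it has codimension at most one in `Z₂`. -/
theorem IsRodFamily.exists_rod [Finite V] [DecidableEq V] (hθ : IsRodFamily θ)
    (hK : 4 ≤ Fintype.card K) {q : V → K → ℝ} (hq : GeneralPosition R q) {v : V} (hv : v ∈ R)
    {N : Finset V} (hNR : ∀ w ∈ N, w ∈ R) (hvN : v ∉ N) (hN : 2 ≤ N.card) {S : Set (V × V)}
    (hSv : ∀ p ∈ S, p.1 ≠ v ∧ p.2 ≠ v) :
    ∃ x, Nondegenerate R (Function.update q v (θ x)) ∧
      (Module.finrank ℝ (motions (Function.update q v (θ x)) (S ∪ {p | p.1 = v ∧ p.2 ∈ N})) +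
          (Fintype.card K - 1) ≤
        Module.finrank ℝ (motions q (S ∪ {p | p.1 ∈ N ∧ p.2 ∈ N ∧ p.1 ≠ p.2})) ∨
      Module.finrank ℝ (motions (Function.update q v (θ x)) (S ∪ {p | p.1 = v ∧ p.2 ∈ N})) +
          (2 * Fintype.card K - 4) ≤ Module.finrank ℝ (motions q S) ∧
        (3 ≤ N.card →
          Module.finrank ℝ (motions (Function.update q v (θ x)) (S ∪ {p | p.1 = v ∧ p.2 ∈ N})) +
            (2 * Fintype.card K - 3) ≤ Module.finrank ℝ (motions q S))) := by
  let C : V → V → Submodule ℝ (K → ℝ) := fun u w => Submodule.span ℝ {q u, q w}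
  set Z₀ := motions q S with hZ₀
  set Z₁ := motions q (S ∪ {p | p.1 ∈ N ∧ p.2 ∈ N ∧ p.1 ≠ p.2}) with hZ₁
  have hCle : ∀ u w, Module.finrank ℝ (C u w) ≤ 2 := fun u w => finrank_span_pair_le _ _
  have hCtop : ∀ u w, C u w ≠ ⊤ := by
    intro u w h
    have := hCle u w
    rw [h, finrank_top, Module.finrank_fintype_fun_eq_card] at this
    omega
  have e1 : ∀ᶠ x in generic σ, ∀ u w, θ x ∉ C u w := by
    simp only [Filter.eventually_all]
    exact fun u w => hθ.eventually_notMem (hCtop u w)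
  have e2 : ∀ᶠ x in generic σ, ∀ u w, Z₀.map (relative u w) ⊔ C u w ≠ ⊤ →
      θ x ∉ Z₀.map (relative u w) ⊔ C u w := by
    simp only [Filter.eventually_all]
    exact fun u w h => hθ.eventually_notMem h
  have e3 : ∀ᶠ x in generic σ, ∀ w w' u u',
      (Z₀ ⊓ (C w w').comap (relative w w')).map (relative u u') ⊔ C u u' ≠ ⊤ →
      θ x ∉ (Z₀ ⊓ (C w w').comap (relative w w')).map (relative u u') ⊔ C u u' := by
    simp only [Filter.eventually_all]
    exact fun w w' u u' h => hθ.eventually_notMem h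
  have e4 : ∀ᶠ x in generic σ, ∀ w ∈ R, ∀ w' ∈ R, ∀ u ∈ R, w ≠ w' → w ≠ u → w' ≠ u →
      Z₀.map (relative w w') ⊔ C w w' = ⊤ →
      (∀ m ∈ Z₀, m w - m w' ∈ C w w' → m w - m u ∈ C w u ∧ m w' - m u ∈ C w' u) →
      ∀ m ∈ Z₀, (∃ s : ℝ, m w - m u - s • θ x ∈ C w u) →
        (∃ s : ℝ, m w' - m u - s • θ x ∈ C w' u) →
        (∃ c : ℝ, m w - m w' - c • θ x ∈ C w w') → m w - m w' ∈ C w w' := by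
    simp only [Filter.eventually_all]
    exact fun w hw w' hw' u hu h1 h2 h3 h4 h5 =>
      hθ.eventually_relative_mem hK hq hw hw' hu h1 h2 h3 h4 h5
  -- The properties of a generic rod that are needed, each for the finitely many tuples of vertices.
  obtain ⟨x, hx1, hx2, hx3, hx4⟩ := (e1.and (e2.and (e3.and e4))).exists
  set q' := Function.update q v (θ x) with hq'
  have hq'v : q' v = θ x := Function.update_self ..
  have hq'w : ∀ w, w ≠ v → q' w = q w := fun w hw => Function.update_of_ne hw _ _
  have hpair : ∀ w ∈ R, ∀ s t : ℝ, s • θ x + t • q w = 0 → s = 0 ∧ t = 0 := by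
    intro w hw s t hst
    have hs : s = 0 := by
      by_contra hs
      refine hx1 w w ((Submodule.smul_mem_iff _ hs).1 ?_)
      rw [eq_neg_of_add_eq_zero_left hst]
      exact Submodule.neg_mem _ (Submodule.smul_mem _ _ (Submodule.subset_span (by simp)))
    rw [hs, zero_smul, zero_add] at hst
    exact ⟨hs, (smul_eq_zero.1 hst).resolve_right (hq.ne_zero w hw)⟩
  have hnd : Nondegenerate R q' := by
    refine ⟨fun w hw => ?_, fun w hw h => ?_, fun u hu w hw huw => ?_⟩
    · rw [hq'w w (by rintro rfl; exact hw hv), hq.eq_zero w hw]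
    · by_cases hwv : w = v
      · rw [hwv, hq'v] at h
        exact hx1 v v (h ▸ Submodule.zero_mem _)
      · exact hq.ne_zero w hw (hq'w w hwv ▸ h)
    · rw [LinearIndependent.pair_iff]
      intro s t hst
      by_cases huv : u = v
      · rw [huv, hq'v, hq'w w (fun h => huw (huv.trans h.symm))] at hst
        exact hpair w hw s t hst
      · by_cases hwv : w = v
        · rw [hwv, hq'v, hq'w u huv, add_comm] at hst
          exact (hpair u hu t s hst).symm
        · rw [hq'w u huv, hq'w w hwv] at hst
          exact LinearIndependent.pair_iff.1 (hq.pair u hu w hw huw) s t hst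
  refine ⟨x, hnd, ?_⟩
  set Z₂ := motions q' (S ∪ {p | p.1 = v ∧ p.2 ∈ N}) with hZ₂
  have hNv : ∀ w ∈ N, w ≠ v := fun w hw h => hvN (h ▸ hw)
  have hZ₂₀ : Z₂ ≤ Z₀ := by
    intro m hm p hp
    have := hm p (Or.inl hp)
    rwa [hq'w _ (hSv p hp).1, hq'w _ (hSv p hp).2] at this
  have hZ₁₀ : Z₁ ≤ Z₀ := motions_anti q Set.subset_union_left
  have hZ₂v : ∀ m ∈ Z₂, ∀ w ∈ N, ∃ s t : ℝ, s • θ x + t • q w = m v - m w := by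
    intro m hm w hw
    have := hm (v, w) (Or.inr ⟨rfl, hw⟩)
    rw [hq'v, hq'w w (hNv w hw)] at this
    exact Submodule.mem_span_pair.1 this
  have hZ₂N : ∀ m ∈ Z₂, ∀ u ∈ N, ∀ w ∈ N, ∃ s : ℝ, m u - m w - s • θ x ∈ C u w := by
    intro m hm u hu w hw
    obtain ⟨s, t, h1⟩ := hZ₂v m hm u hu
    obtain ⟨s', t', h2⟩ := hZ₂v m hm w hw
    refine ⟨s' - s, Submodule.mem_span_pair.2 ⟨-t, t', ?_⟩⟩
    have h3 : m u - m w = (m v - m w) - (m v - m u) := by abel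
    rw [h3, ← h1, ← h2]
    module
  have hmemZ₁ : ∀ m, m ∈ Z₁ ↔ m ∈ Z₀ ∧ ∀ u ∈ N, ∀ w ∈ N, u ≠ w → m u - m w ∈ C u w := by
    intro m
    constructor
    · exact fun hm => ⟨hZ₁₀ hm, fun u hu w hw huw => hm (u, w) (Or.inr ⟨hu, hw, huw⟩)⟩
    · rintro ⟨h1, h2⟩ p (hp | hp)
      · exact h1 p hp
      · exact h2 _ hp.1 _ hp.2.1 hp.2.2
  have htrans : ∀ y, Pi.single v y ∈ Z₁ := by
    intro y
    have h0 : ∀ w, w ≠ v → (Pi.single v y : V → K → ℝ) w = 0 := fun w hw =>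
      Pi.single_eq_of_ne (M := fun _ => K → ℝ) hw y
    rw [hmemZ₁]
    refine ⟨fun p hp => ?_, fun u hu w hw _ => ?_⟩
    · rw [h0 _ (hSv p hp).1, h0 _ (hSv p hp).2, sub_zero]
      exact Submodule.zero_mem _
    · rw [h0 _ (hNv u hu), h0 _ (hNv w hw), sub_zero]
      exact Submodule.zero_mem _
  obtain ⟨Y, hYN, hYc⟩ := Finset.exists_subset_card_eq hN
  obtain ⟨w₁, w₂, hw₁₂, rfl⟩ := Finset.card_eq_two.1 hYc
  have hw₁ : w₁ ∈ N := hYN (by simp)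
  have hw₂ : w₂ ∈ N := hYN (by simp)
  -- The translations of `v` by a complement of the line of `θ x` are independent of `Z₂`.
  have hdrop : ∀ Z Z' : Submodule ℝ (V → K → ℝ), Z ≤ Z' → Z ≤ Z₂ → Z₁ ≤ Z' →
      Module.finrank ℝ Z + (Fintype.card K - 1) ≤ Module.finrank ℝ Z' := by
    intro Z Z' hZZ' hZ hZ'
    obtain ⟨U, hU⟩ := Submodule.exists_isCompl (Submodule.span ℝ {θ x})
    have h1 := Submodule.finrank_add_eq_of_isCompl hU
    have h2 := finrank_span_le_one (θ x)
    rw [Module.finrank_fintype_fun_eq_card] at h1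
    have h3 := finrank_add_finrank_le_of_translations hZZ' (v := v) U
      (fun y => hZ' (by convert htrans y)) (by
        intro y hyU hy
        have hy' : Pi.single v y ∈ Z₂ := hZ (by convert hy)
        obtain ⟨s, t, h1⟩ := hZ₂v _ hy' w₁ hw₁
        obtain ⟨s', t', h2⟩ := hZ₂v _ hy' w₂ hw₂
        rw [Pi.single_eq_same, Pi.single_eq_of_ne (hNv _ hw₁), sub_zero] at h1
        rw [Pi.single_eq_same, Pi.single_eq_of_ne (hNv _ hw₂), sub_zero] at h2
        have hss' : s - s' = 0 := by
          by_contra hs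
          refine hx1 w₁ w₂ ((Submodule.smul_mem_iff _ hs).1 ?_)
          refine Submodule.mem_span_pair.2 ⟨-t, t', ?_⟩
          have h3 := h1.trans h2.symm
          rw [← sub_eq_zero] at h3 ⊢
          rw [← neg_eq_zero, ← h3]
          module
        have ht := LinearIndependent.pair_iff.1 (hq.pair w₁ (hNR _ hw₁) w₂ (hNR _ hw₂) hw₁₂) t (-t')
          (by
            have h3 := h1.trans h2.symm
            rw [sub_eq_zero.1 hss', add_left_cancel_iff] at h3
            rw [h3]
            module)
        rw [ht.1, zero_smul, add_zero] at h1
        exact Submodule.disjoint_def.1 hU.disjoint y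
          (Submodule.mem_span_singleton.2 ⟨s, h1⟩) hyU)
    omega
  by_cases hle : Z₂ ≤ Z₁
  · exact Or.inl (hdrop Z₂ Z₁ hle le_rfl le_rfl)
  right
  -- A motion violating the condition for a pair makes `θ x` a member of the subspace of the pair.
  have hfull : ∀ Z : Submodule ℝ (V → K → ℝ), ∀ m ∈ Z₂, m ∈ Z → ∀ u ∈ N, ∀ w ∈ N,
      m u - m w ∉ C u w → θ x ∈ Z.map (relative u w) ⊔ C u w := by
    intro Z m hm hmZ u hu w hw hnot
    obtain ⟨s, hs⟩ := hZ₂N m hm u hu w hw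
    have hs0 : s ≠ 0 := by
      rintro rfl
      rw [zero_smul, sub_zero] at hs
      exact hnot hs
    refine (Submodule.smul_mem_iff _ hs0).1 ?_
    have h1 : m u - m w ∈ Z.map (relative u w) ⊔ C u w :=
      Submodule.mem_sup_left ⟨m, hmZ, relative_apply u w m⟩
    have h2 := Submodule.sub_mem _ h1 (Submodule.mem_sup_right hs)
    rwa [sub_sub_cancel] at h2
  have hex : ∀ m ∈ Z₂, m ∉ Z₁ → ∃ u ∈ N, ∃ w ∈ N, u ≠ w ∧ m u - m w ∉ C u w := by
    intro m hm hnot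
    by_contra! hcon
    exact hnot ((hmemZ₁ m).2 ⟨hZ₂₀ hm, hcon⟩)
  obtain ⟨m, hm, hm1⟩ := SetLike.not_le_iff_exists.1 hle
  obtain ⟨w, hw, w', hw', hww', hmw⟩ := hex m hm hm1
  have hP : Z₀.map (relative w w') ⊔ C w w' = ⊤ := by
    by_contra hP
    exact hx2 w w' hP (hfull Z₀ m hm (hZ₂₀ hm) w hw w' hw' hmw)
  set Za := Z₀ ⊓ (C w w').comap (relative w w') with hZa
  have hza := finrank_inf_comap_add_finrank_le hP
  have hz2 : Module.finrank ℝ Z₂ ≤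
      Module.finrank ℝ (Z₂ ⊓ (C w w').comap (relative w w') : Submodule ℝ (V → K → ℝ)) + 1 :=
    finrank_le_finrank_inf_comap_add_one (t := θ x) fun m hm => hZ₂N m hm w hw w' hw'
  have hCw := hCle w w'
  rw [← hZa, Module.finrank_fintype_fun_eq_card] at hza
  -- Either the condition for the pair `(w, w')` implies those for all pairs of neighbours for the
  -- members of `Z₂`, or a second pair imposes a condition of codimension `D - 2`.
  by_cases hB : Z₂ ⊓ (C w w').comap (relative w w') ≤ Z₁
  · have h1 := hdrop _ Z₁ hB inf_le_left le_rfl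
    have hZ₁a : Z₁ ≤ Za := fun m hm =>
      ⟨hZ₁₀ hm, ((hmemZ₁ m).1 hm).2 w hw w' hw' hww'⟩
    have h2 := Submodule.finrank_mono hZ₁a
    refine ⟨by omega, fun hN3 => ?_⟩
    have h3 : Module.finrank ℝ Z₁ < Module.finrank ℝ Za := by
      refine Submodule.finrank_lt_finrank_of_lt (lt_of_le_of_ne hZ₁a fun heq => hmw ?_)
      -- If `Z₁` were all of `Za`, a third neighbour would force the condition for `(w, w')` on `m`.
      obtain ⟨u, hu, huw⟩ := Finset.exists_mem_notMem_of_card_lt_card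
        (show ({w, w'} : Finset V).card < N.card from (Finset.card_le_two).trans_lt (by omega))
      simp only [Finset.mem_insert, Finset.mem_singleton, not_or] at huw
      refine hx4 w (hNR w hw) w' (hNR w' hw') u (hNR u hu) hww' (Ne.symm huw.1) (Ne.symm huw.2) hP
        ?_ m (hZ₂₀ hm) (hZ₂N m hm w hw u hu) (hZ₂N m hm w' hw' u hu) (hZ₂N m hm w hw w' hw')
      intro m' hm' hm'C
      have h4 : m' ∈ Z₁ := heq ▸ ⟨hm', hm'C⟩
      exact ⟨((hmemZ₁ m').1 h4).2 w hw u hu (Ne.symm huw.1),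
        ((hmemZ₁ m').1 h4).2 w' hw' u hu (Ne.symm huw.2)⟩
    omega
  · obtain ⟨m', hm', hm'1⟩ := SetLike.not_le_iff_exists.1 hB
    obtain ⟨u, hu, u', hu', huu', hmu⟩ := hex m' hm'.1 hm'1
    have hP2 : Za.map (relative u u') ⊔ C u u' = ⊤ := by
      by_contra hP2
      exact hx3 w w' u u' hP2 (hfull Za m' hm'.1 ⟨hZ₂₀ hm'.1, hm'.2⟩ u hu u' hu' hmu)
    have hzb := finrank_inf_comap_add_finrank_le hP2
    have hCu := hCle u u'
    rw [Module.finrank_fintype_fun_eq_card] at hzb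
    have hz3 : Module.finrank ℝ (Z₂ ⊓ (C w w').comap (relative w w') : Submodule ℝ (V → K → ℝ)) ≤
        Module.finrank ℝ ((Z₂ ⊓ (C w w').comap (relative w w')) ⊓
          (C u u').comap (relative u u') : Submodule ℝ (V → K → ℝ)) + 1 :=
      finrank_le_finrank_inf_comap_add_one (t := θ x) fun m hm => hZ₂N m hm.1 u hu u' hu'
    have h1 := hdrop ((Z₂ ⊓ (C w w').comap (relative w w')) ⊓ (C u u').comap (relative u u'))
      (Za ⊓ (C u u').comap (relative u u'))
      (inf_le_inf_right _ (inf_le_inf_right _ hZ₂₀)) (inf_le_left.trans inf_le_left)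
      (fun m hm => ⟨⟨hZ₁₀ hm, ((hmemZ₁ m).1 hm).2 w hw w' hw' hww'⟩,
        ((hmemZ₁ m).1 hm).2 u hu u' hu' huu'⟩)
    exact ⟨by omega, fun _ => by omega⟩

end RodStep

/-! ### Rods for which a sparse multigraph is independent -/

section Core

open Classical

variable {V K σ : Type*} {R : Set V}

/-- The pairs of the end vertices of the edges of `I`. -/
def pairs (I : Finset (V × V × ℕ)) : Set (V × V) := {p | ∃ e ∈ I, p = (e.1, e.2.1)}

theorem Sparse.card_le {D : ℕ} (hD : 2 ≤ D) {I F : Finset (V × V × ℕ)} (hI : Sparse D R I)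
    (hF : F ⊆ I) {X : Finset V} (hX : 2 ≤ X.card) (h : verts F ⊆ X) :
    (F.card : ℤ) ≤ vertexCount D R X := by
  rcases F.eq_empty_or_nonempty with rfl | hne
  · exact vertexCount_nonneg hD hX
  · exact (hI.le F hF hne).trans (vertexCount_mono hD h)

/-- A sparse graph all of whose vertices are rods has a vertex of degree at most `2 D - 3`. -/
theorem Sparse.exists_degree_le {D : ℕ} (hD : 2 ≤ D) {I : Finset (V × V × ℕ)} (hI : Sparse D R I)
    (hne : I.Nonempty) (hR : ∀ v ∈ verts I, v ∈ R) :
    ∃ v ∈ verts I, (I.filter fun e => e.1 = v ∨ e.2.1 = v).card ≤ 2 * D - 3 := by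
  by_contra! hcon
  have h1 : ∑ v ∈ verts I, (I.filter fun e => e.1 = v ∨ e.2.1 = v).card =
      ∑ e ∈ I, ((verts I).filter fun v => e.1 = v ∨ e.2.1 = v).card := by
    simp only [Finset.card_filter]
    exact Finset.sum_comm
  have h2 : ∑ e ∈ I, ((verts I).filter fun v => e.1 = v ∨ e.2.1 = v).card ≤ I.card * 2 := by
    refine Finset.sum_le_card_nsmul _ _ _ fun e _ => ?_
    refine (Finset.card_le_card (t := {e.1, e.2.1}) fun v hv => ?_).trans Finset.card_le_two
    simp only [Finset.mem_filter] at hv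
    simp only [Finset.mem_insert, Finset.mem_singleton]
    grind
  have h3 : (verts I).card * (2 * D - 2) ≤
      ∑ v ∈ verts I, (I.filter fun e => e.1 = v ∨ e.2.1 = v).card := by
    refine Finset.card_nsmul_le_sum _ _ _ fun v hv => ?_
    have := hcon v hv
    omega
  have h4 := hI.le I le_rfl hne
  rw [vertexCount, Finset.filter_true_of_mem hR] at h4
  have h5 : (((2 * D - 2 : ℕ) : ℕ) : ℤ) = 2 * D - 2 := by omega
  have h6 : (((verts I).card * (2 * D - 2) : ℕ) : ℤ) ≤ ((I.card * 2 : ℕ) : ℤ) := by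
    exact_mod_cast h3.trans (h1.le.trans h2)
  push_cast at h6
  rw [h5] at h6
  nlinarith

/-- The degree bound that matches the gain of dimension: if `F` is a tight set of the extension
`W ∪ J` of the graph `W` containing the neighbours of `v`, then at most `|J| + D` edges join `v` to
`W`, and one less if `v` is a rod. -/
theorem Sparse.card_star_le {D : ℕ} (hD : 2 ≤ D) {W δ J : Finset (V × V × ℕ)}
    (hI : Sparse D R (W ∪ δ)) (hδW : Disjoint W δ) {v : V} {N X : Finset V}
    (hδ : verts δ ⊆ insert v N) (hNX : N ⊆ X) (hvX : v ∉ X) (hX : Tight D R (W ∪ J) X)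
    (hN : N.Nonempty) : (δ.card : ℤ) ≤ J.card + D - if v ∈ R then 1 else 0 := by
  obtain ⟨F, hF, hFne, hFX, hFc⟩ := hX
  have h1 := hI.card_le hD (F := (F ∩ W) ∪ δ) (X := insert v X)
    (Finset.union_subset_union_left Finset.inter_subset_right) (by
      rw [Finset.card_insert_of_notMem hvX]
      have := (hN.mono hNX).card_pos
      omega) (by
      rw [verts_union]
      refine Finset.union_subset ?_ (hδ.trans (Finset.insert_subset_insert _ hNX))
      exact ((verts_mono Finset.inter_subset_left).trans hFX.subset).trans
        (Finset.subset_insert _ _))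
  rw [vertexCount_insert R hvX, Finset.card_union_of_disjoint
    (hδW.mono_left Finset.inter_subset_right)] at h1
  have h2 : F.card ≤ (F ∩ W).card + J.card := by
    refine (Finset.card_le_card fun e he => ?_).trans (Finset.card_union_le (F ∩ W) J)
    rcases Finset.mem_union.1 (hF he) with h | h
    · exact Finset.mem_union_left _ (Finset.mem_inter.2 ⟨he, h⟩)
    · exact Finset.mem_union_right _ h
  push_cast at h1
  omega

theorem finrank_span_normals_le [Finite K] {q : V → K → ℝ} (hq : Nondegenerate R q) (u w : V) :
    (Module.finrank ℝ (Submodule.span ℝ {q u, q w}) : ℤ) ≤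
      (if u ∈ R then 1 else 0) + if w ∈ R then 1 else 0 := by
  have h1 := finrank_span_pair_le (q u) (q w)
  have h2 := finrank_span_le_one (q u)
  have h3 := finrank_span_le_one (q w)
  split_ifs with hu hw hw
  · omega
  · rw [hq.eq_zero w hw, Set.pair_comm, Submodule.span_insert_zero]
    omega
  · rw [hq.eq_zero u hu, Submodule.span_insert_zero]
    omega
  · rw [hq.eq_zero u hu, hq.eq_zero w hw, Submodule.span_insert_zero, Submodule.span_zero_singleton,
      finrank_bot]
    omega

theorem finrank_motions_empty [Finite V] [Fintype K] (q : V → K → ℝ) :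
    Module.finrank ℝ (motions q (pairs (∅ : Finset (V × V × ℕ)))) =
      Fintype.card K * Nat.card V := by
  have := Fintype.ofFinite V
  have h : motions q (pairs (∅ : Finset (V × V × ℕ))) = ⊤ := by
    rw [eq_top_iff]
    rintro m - p ⟨e, he, -⟩
    exact absurd he (Finset.notMem_empty e)
  rw [h, finrank_top, Module.finrank_pi_fintype]
  simp [mul_comm]

theorem normals_update {θ : (σ → ℝ) → K → ℝ} (b : R × σ → ℝ) {v : V} (hv : v ∈ R) (x : σ → ℝ) :
    normals R θ (fun y => if y.1.1 = v then x y.2 else b y) =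
      Function.update (normals R θ b) v (θ x) := by
  ext w : 1
  by_cases hw : w = v
  · subst hw
    rw [normals_of_mem θ _ hv, Function.update_self]
    simp
  · rw [Function.update_of_ne hw]
    by_cases hwR : w ∈ R
    · rw [normals_of_mem θ _ hwR, normals_of_mem θ _ hwR]
      simp [hw]
    · rw [normals_of_notMem θ _ hwR, normals_of_notMem θ _ hwR]

variable [Finite V] [Fintype K]

/-- Adding a vertex with one neighbour. -/
theorem finrank_motions_star_one {q : V → K → ℝ} (hq : Nondegenerate R q) {v w : V} (hvw : v ≠ w)
    {S : Set (V × V)} (hSv : ∀ p ∈ S, p.1 ≠ v ∧ p.2 ≠ v) :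
    (Module.finrank ℝ (motions q (S ∪ {p | p.1 = v ∧ p.2 = w})) : ℤ) +
      (Fintype.card K - (if v ∈ R then 1 else 0) - if w ∈ R then 1 else 0) ≤
      Module.finrank ℝ (motions q S) := by
  obtain ⟨U, hU⟩ := Submodule.exists_isCompl (Submodule.span ℝ {q v, q w})
  have h1 := Submodule.finrank_add_eq_of_isCompl hU
  rw [Module.finrank_fintype_fun_eq_card] at h1
  have h2 := finrank_add_finrank_le_of_translations
    (motions_anti q (Set.subset_union_left (s := S) (t := {p | p.1 = v ∧ p.2 = w}))) (v := v) U
    (by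
      intro y p hp
      rw [Pi.single_eq_of_ne (hSv p hp).1, Pi.single_eq_of_ne (hSv p hp).2, sub_zero]
      exact Submodule.zero_mem _)
    (by
      intro y hy hm
      have := hm (v, w) (Or.inr ⟨rfl, rfl⟩)
      rw [Pi.single_eq_same, Pi.single_eq_of_ne hvw.symm, sub_zero] at this
      exact Submodule.disjoint_def.1 hU.disjoint y this hy)
  have h3 := finrank_span_normals_le hq v w
  omega

/-- Adding a body with at least two neighbours. -/
theorem finrank_motions_star_body {q : V → K → ℝ} (hq : Nondegenerate R q) {v : V} (hv : v ∉ R)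
    {N : Finset V} (hvN : v ∉ N) (hN : 2 ≤ N.card)
    {S : Set (V × V)} (hSv : ∀ p ∈ S, p.1 ≠ v ∧ p.2 ≠ v) :
    Module.finrank ℝ (motions q (S ∪ {p | p.1 = v ∧ p.2 ∈ N})) + Fintype.card K ≤
      Module.finrank ℝ (motions q (S ∪ {p | p.1 ∈ N ∧ p.2 ∈ N ∧ p.1 ≠ p.2})) := by
  have hNv : ∀ w ∈ N, w ≠ v := fun w hw h => hvN (h ▸ hw)
  have hstar : ∀ m ∈ motions q (S ∪ {p | p.1 = v ∧ p.2 ∈ N}), ∀ w ∈ N,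
      ∃ s : ℝ, s • q w = m v - m w := by
    intro m hm w hw
    have := hm (v, w) (Or.inr ⟨rfl, hw⟩)
    rw [hq.eq_zero v hv, Submodule.span_insert_zero] at this
    exact Submodule.mem_span_singleton.1 this
  have h := finrank_add_finrank_le_of_translations
    (Z₁ := motions q (S ∪ {p | p.1 ∈ N ∧ p.2 ∈ N ∧ p.1 ≠ p.2}))
    (Z₂ := motions q (S ∪ {p | p.1 = v ∧ p.2 ∈ N})) (v := v) (by
      rintro m hm p (hp | hp)
      · exact hm p (Or.inl hp)
      · obtain ⟨s, hs⟩ := hstar m hm p.1 hp.1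
        obtain ⟨t, ht⟩ := hstar m hm p.2 hp.2.1
        refine Submodule.mem_span_pair.2 ⟨-s, t, ?_⟩
        rw [neg_smul, hs, ht]
        abel) ⊤
    (by
      rintro y p (hp | hp)
      · rw [Pi.single_eq_of_ne (hSv p hp).1, Pi.single_eq_of_ne (hSv p hp).2, sub_zero]
        exact Submodule.zero_mem _
      · rw [Pi.single_eq_of_ne (hNv _ hp.1), Pi.single_eq_of_ne (hNv _ hp.2.1), sub_zero]
        exact Submodule.zero_mem _)
    (by
      intro y _ hm
      obtain ⟨w, hw, w', hw', hww'⟩ := Finset.one_lt_card.1 hN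
      obtain ⟨s, hs⟩ := hstar _ hm w hw
      obtain ⟨t, ht⟩ := hstar _ hm w' hw'
      rw [Pi.single_eq_same, Pi.single_eq_of_ne (hNv _ hw), sub_zero] at hs
      rw [Pi.single_eq_same, Pi.single_eq_of_ne (hNv _ hw'), sub_zero] at ht
      have h1 := hq.pair_eq_zero hww' (a := s) (b := -t) (by rw [neg_smul, hs, ht, add_neg_cancel])
      by_cases hwR : w ∈ R
      · rw [← hs, h1.1 hwR, zero_smul]
      · rw [← hs, hq.eq_zero w hwR, smul_zero])
  rwa [finrank_top, Module.finrank_fintype_fun_eq_card] at h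

variable [DecidableEq K] {θ : (σ → ℝ) → K → ℝ}

/-- For a sparse multigraph there are rods for which the conditions imposed by its edges on the
motions are independent. -/
theorem IsRodFamily.exists_finrank_motions_add_card_le (hθ : IsRodFamily θ)
    (hK : 4 ≤ Fintype.card K) {I : Finset (V × V × ℕ)} (hI : Sparse (Fintype.card K) R I) :
    ∃ b, Nondegenerate R (normals R θ b) ∧
      Module.finrank ℝ (motions (normals R θ b) (pairs I)) + I.card ≤
        Fintype.card K * Nat.card V := by
  induction hn : (verts I).card using Nat.strong_induction_on generalizing I with
  | _ n ih =>
  subst hn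
  obtain ⟨b, hgp, hmin⟩ := (hθ.eventually_minimal (R := R) hK).exists
  rcases I.eq_empty_or_nonempty with rfl | hne
  · exact ⟨b, hgp.toNondegenerate, by rw [finrank_motions_empty]; simp⟩
  -- A body is removed if there is one, and a rod of small degree otherwise.
  obtain ⟨v, hvI, hv⟩ : ∃ v ∈ verts I, v ∉ R ∨ (∀ w ∈ verts I, w ∈ R) ∧
      (I.filter fun e => e.1 = v ∨ e.2.1 = v).card ≤ 2 * Fintype.card K - 3 := by
    by_cases hR : ∀ w ∈ verts I, w ∈ R
    · obtain ⟨v, hv, hdeg⟩ := hI.exists_degree_le (by omega) hne hR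
      exact ⟨v, hv, Or.inr ⟨hR, hdeg⟩⟩
    · push Not at hR
      obtain ⟨v, hv, hvR⟩ := hR
      exact ⟨v, hv, Or.inl hvR⟩
  set δ := I.filter fun e => e.1 = v ∨ e.2.1 = v with hδ
  set W := I.filter fun e => ¬ (e.1 = v ∨ e.2.1 = v) with hW
  have hδI : δ ⊆ I := Finset.filter_subset _ _
  have hWI : W ⊆ I := Finset.filter_subset _ _
  have hcard : δ.card + W.card = I.card := Finset.card_filter_add_card_filter_not _
  have hWδ : W ∪ δ = I := by
    rw [Finset.union_comm]
    exact Finset.filter_union_filter_not_eq _ _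
  have hdisj : Disjoint W δ := (Finset.disjoint_filter_filter_not I I _).symm
  set N := (verts δ).erase v with hN
  have hvN : v ∉ N := Finset.notMem_erase _ _
  have hNI : N ⊆ (verts I).erase v := Finset.erase_subset_erase _ (verts_mono hδI)
  have hδN : verts δ ⊆ insert v N := by
    rw [hN]
    exact Finset.subset_insert_iff.2 subset_rfl
  have hWv : verts W ⊆ (verts I).erase v := by
    intro u hu
    refine Finset.mem_erase.2 ⟨?_, verts_mono hWI hu⟩
    rintro rfl
    obtain ⟨e, he, h⟩ := mem_verts.1 hu
    have := (Finset.mem_filter.1 he).2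
    grind
  have hSv : ∀ p ∈ pairs W, p.1 ≠ v ∧ p.2 ≠ v := by
    rintro _ ⟨e, he, rfl⟩
    have := (Finset.mem_filter.1 he).2
    exact not_or.1 this
  have hstar : ∀ q : V → K → ℝ, motions q (pairs I) ≤
      motions q (pairs W ∪ {p | p.1 = v ∧ p.2 ∈ N}) := by
    rintro q m hm p (⟨e, he, rfl⟩ | ⟨hp1, hp2⟩)
    · exact hm _ ⟨e, hWI he, rfl⟩
    · obtain ⟨hpv, hp⟩ := Finset.mem_erase.1 hp2
      obtain ⟨e, he, h⟩ := mem_verts.1 hp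
      have he' := (Finset.mem_filter.1 he).2
      have hme := hm _ ⟨e, hδI he, rfl⟩
      rcases h with h | h
      · have h' : e.2.1 = v := he'.resolve_left fun h' => hpv (h.trans h')
        rw [hp1, h, ← h', ← neg_sub, Set.pair_comm]
        exact Submodule.neg_mem _ hme
      · have h' : e.1 = v := he'.resolve_right fun h' => hpv (h.trans h')
        rw [hp1, h, ← h']
        exact hme
  -- The induction hypothesis applies to the generic choice `b` as well.
  have hind : ∀ I' : Finset (V × V × ℕ), Sparse (Fintype.card K) R I' →
      verts I' ⊆ (verts I).erase v →
      Module.finrank ℝ (motions (normals R θ b) (pairs I')) + I'.card ≤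
        Fintype.card K * Nat.card V := by
    intro I' hI' hsub
    obtain ⟨b₀, hb₀, hle⟩ := ih _ ((Finset.card_le_card hsub).trans_lt
      (Finset.card_erase_lt_of_mem hvI)) hI' rfl
    refine le_trans (Nat.add_le_add_right (hmin _ ?_ b₀ hb₀) _) hle
    rintro _ ⟨e, he, rfl⟩
    exact hI'.loopless e he
  have hz₀ := hind W (hI.mono hWI) hWv
  have hNne : N.Nonempty := by
    obtain ⟨e, he, h⟩ := mem_verts.1 hvI
    have heδ : e ∈ δ := Finset.mem_filter.2 ⟨he, by grind⟩
    have hll := hI.loopless e he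
    rcases h with h | h
    · exact ⟨e.2.1, Finset.mem_erase.2 ⟨fun h' => hll (h.symm.trans h'.symm),
        mem_verts.2 ⟨e, heδ, Or.inr rfl⟩⟩⟩
    · exact ⟨e.1, Finset.mem_erase.2 ⟨fun h' => hll (h'.trans h),
        mem_verts.2 ⟨e, heδ, Or.inl rfl⟩⟩⟩
  rcases (show 1 ≤ N.card from hNne.card_pos).eq_or_lt with hN1 | hN2
  · obtain ⟨w, hw⟩ := Finset.card_eq_one.1 hN1.symm
    have hvw : v ≠ w := by
      rintro rfl
      exact hvN (hw ▸ Finset.mem_singleton_self v)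
    have h1 := finrank_motions_star_one hgp.toNondegenerate hvw hSv
    have h2 := hI.card_le (by omega) hδI (X := {v, w}) (Finset.card_pair hvw).ge
      (hδN.trans (by rw [hw]))
    rw [vertexCount_pair hvw] at h2
    have h3 := Submodule.finrank_mono (hstar (normals R θ b))
    have h4 : {p : V × V | p.1 = v ∧ p.2 ∈ N} = {p | p.1 = v ∧ p.2 = w} := by
      simp only [hw, Finset.mem_singleton]
    rw [h4] at h3
    exact ⟨b, hgp.toNondegenerate, by omega⟩
  obtain ⟨J, hWJ, hJ, hJN, X, hX, hNX⟩ :=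
    exists_sparse_extension hK (hI.mono hWI) (N := N) hN2
  have hJv : verts (W ∪ J) ⊆ (verts I).erase v := by
    rw [verts_union]
    refine Finset.union_subset hWv fun u hu => hNI ?_
    obtain ⟨e, he, h⟩ := mem_verts.1 hu
    rcases h with rfl | rfl
    · exact (hJN e he).1
    · exact (hJN e he).2
  have hvX : v ∉ X := by
    obtain ⟨F, hF, -, rfl, -⟩ := hX
    exact fun h => Finset.notMem_erase v _ (hJv (verts_mono hF h))
  have hdeg := (hWδ ▸ hI : Sparse (Fintype.card K) R (W ∪ δ)).card_star_le (by omega) hdisj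
    hδN hNX hvX hX hNne
  have hz₁ := hind (W ∪ J) hJ hJv
  rw [Finset.card_union_of_disjoint hWJ] at hz₁
  have hz₁' : Module.finrank ℝ (motions (normals R θ b)
      (pairs W ∪ {p | p.1 ∈ N ∧ p.2 ∈ N ∧ p.1 ≠ p.2})) ≤
      Module.finrank ℝ (motions (normals R θ b) (pairs (W ∪ J))) := by
    refine Submodule.finrank_mono (motions_anti _ ?_)
    rintro _ ⟨e, he, rfl⟩
    rcases Finset.mem_union.1 he with h | h
    · exact Or.inl ⟨e, h, rfl⟩
    · exact Or.inr ⟨(hJN e h).1, (hJN e h).2, hJ.loopless e he⟩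
  rcases hv with hvR | ⟨hR, hdeg'⟩
  · have h1 := finrank_motions_star_body hgp.toNondegenerate hvR hvN hN2 hSv
    have h2 := Submodule.finrank_mono (hstar (normals R θ b))
    rw [if_neg hvR] at hdeg
    exact ⟨b, hgp.toNondegenerate, by omega⟩
  have hvR := hR v hvI
  have hNR : ∀ w ∈ N, w ∈ R := fun w hw => hR w (Finset.mem_of_mem_erase (hNI hw))
  obtain ⟨x, hnd, hx⟩ := hθ.exists_rod hK hgp hvR hNR hvN hN2 hSv
  rw [if_pos hvR] at hdeg
  rw [← normals_update b hvR x] at hnd hx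
  refine ⟨_, hnd, ?_⟩
  have h2 := Submodule.finrank_mono
    (hstar (normals R θ (fun y => if y.1.1 = v then x y.2 else b y)))
  rcases hx with hx | ⟨hx, hx3⟩
  · omega
  rcases (show 2 ≤ N.card from hN2).eq_or_lt with hN2' | hN3
  · obtain ⟨w, w', hww', hw⟩ := Finset.card_eq_two.1 hN2'.symm
    have hwN : w ∈ N := by rw [hw]; simp
    have hwN' : w' ∈ N := by rw [hw]; simp
    have hone : ∀ u ∈ N, ((δ.filter fun e => e.1 = u ∨ e.2.1 = u).card : ℤ) ≤
        Fintype.card K - 2 := by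
      intro u hu
      have hvu : v ≠ u := fun h => hvN (h ▸ hu)
      have h3 := hI.card_le (by omega)
        (F := δ.filter fun e => e.1 = u ∨ e.2.1 = u) ((Finset.filter_subset _ _).trans hδI)
        (X := {v, u}) (Finset.card_pair hvu).ge (by
          intro y hy
          obtain ⟨e, he, h⟩ := mem_verts.1 hy
          obtain ⟨he1, he2⟩ := Finset.mem_filter.1 he
          have he3 := (Finset.mem_filter.1 he1).2
          simp only [Finset.mem_insert, Finset.mem_singleton]
          grind)
      rw [vertexCount_pair hvu, if_pos hvR, if_pos (hNR u hu)] at h3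
      omega
    have h4 : δ.card ≤ (δ.filter fun e => e.1 = w ∨ e.2.1 = w).card +
        (δ.filter fun e => e.1 = w' ∨ e.2.1 = w').card := by
      refine (Finset.card_le_card fun e he => ?_).trans (Finset.card_union_le _ _)
      have h5 := hδN (mem_verts.2 ⟨e, he, Or.inl rfl⟩)
      have h6 := hδN (mem_verts.2 ⟨e, he, Or.inr rfl⟩)
      have h7 := hI.loopless e (hδI he)
      simp only [hw, Finset.mem_insert, Finset.mem_singleton] at h5 h6
      simp only [Finset.mem_union, Finset.mem_filter]
      grind
    have h5 := hone w hwN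
    have h6 := hone w' hwN'
    omega
  · have := hx3 hN3
    omega

/-- Generic rods are independent for all sparse multigraphs at once. -/
theorem IsRodFamily.eventually_finrank_motions_add_card_le (hθ : IsRodFamily θ)
    (hK : 4 ≤ Fintype.card K) :
    ∀ᶠ b in generic (R × σ), Nondegenerate R (normals R θ b) ∧
      ∀ I : Finset (V × V × ℕ), Sparse (Fintype.card K) R I →
        Module.finrank ℝ (motions (normals R θ b) (pairs I)) + I.card ≤
          Fintype.card K * Nat.card V := by
  filter_upwards [hθ.eventually_minimal hK] with b ⟨hgp, hmin⟩
  refine ⟨hgp.toNondegenerate, fun I hI => ?_⟩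
  obtain ⟨b₀, hb₀, hle⟩ := hθ.exists_finrank_motions_add_card_le hK hI
  refine le_trans (Nat.add_le_add_right (hmin _ ?_ b₀ hb₀) _) hle
  rintro _ ⟨e, he, rfl⟩
  exact hI.loopless e he

end Core

/-! ### Points in generic position -/

section GenericRepresentatives

variable {β M : Type*} [AddCommGroup M] [Module ℝ M]

/-- Points in generic position of a family of flats are linearly independent if every subfamily of
the flats spans a sufficiently large space. Indeed a minimal dependent subfamily spans the flats of
its members. -/
theorem IsGenericRepresentatives.linearIndepOn {E : Set β} {A : β → Submodule ℝ M} {x : β → M}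
    (hx : IsGenericRepresentatives E A x) {I : Finset β} (hIE : (I : Set β) ⊆ E)
    (hI : ∀ F ⊆ I, F.card ≤ Module.finrank ℝ (⨆ e ∈ F, A e : Submodule ℝ M)) :
    LinearIndepOn ℝ x (I : Set β) := by
  classical
  induction I using Finset.strongInduction with
  | H I ih =>
  have hsub : ∀ J ⊂ I, LinearIndepOn ℝ x (J : Set β) := fun J hJ =>
    ih J hJ ((Finset.coe_subset.2 hJ.1).trans hIE) fun F hF => hI F (hF.trans hJ.1)
  by_contra hdep
  have hle : ⨆ e ∈ I, A e ≤ Submodule.span ℝ (x '' (I : Set β)) := by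
    refine iSup₂_le fun e he => ?_
    have hcoe : ((I.erase e : Finset β) : Set β) = (I : Set β) \ {e} := Finset.coe_erase ..
    have h1 : x e ∈ Submodule.span ℝ (x '' ((I : Set β) \ {e})) := by
      by_contra hnot
      refine hdep ?_
      rw [← Finset.insert_erase he, Finset.coe_insert]
      refine (linearIndepOn_insert (by simp)).2 ⟨hsub _ (Finset.erase_ssubset he), ?_⟩
      rwa [hcoe]
    exact (hx.generic I hIE e he h1).trans
      (Submodule.span_mono (Set.image_mono Set.sdiff_subset))
  have hfin : FiniteDimensional ℝ (Submodule.span ℝ (x '' (I : Set β))) :=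
    FiniteDimensional.span_of_finite ℝ (I.finite_toSet.image x)
  have h2 := (hI I subset_rfl).trans (Submodule.finrank_mono hle)
  refine hdep ?_
  rw [LinearIndepOn, linearIndependent_iff_card_le_finrank_span, Set.finrank]
  rw [Set.image_eq_range] at h2
  simpa using h2

/-- Flats other than `⊥` have representative points in generic position: take points such that as
many subfamilies as possible are independent. -/
theorem exists_isGenericRepresentatives {E : Set β} (hE : E.Finite) {A : β → Submodule ℝ M}
    (hA : ∀ e ∈ E, A e ≠ ⊥) : ∃ x : β → M, IsGenericRepresentatives E A x := by
  classical
  lift E to Finset β using hE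
  let ind : (β → M) → Finset (Finset β) := fun x =>
    E.powerset.filter fun F => LinearIndepOn ℝ x (F : Set β)
  have hind : ∀ x F, F ∈ ind x ↔ F ⊆ E ∧ LinearIndepOn ℝ x (F : Set β) := by
    intro x F
    simp [ind]
  obtain ⟨x, hx, hmax⟩ : ∃ x : β → M, (∀ e ∈ E, x e ∈ A e) ∧
      ∀ y : β → M, (∀ e ∈ E, y e ∈ A e) → (ind y).card ≤ (ind x).card := by
    let P : ℕ → Prop := fun n => ∃ x : β → M, (∀ e ∈ E, x e ∈ A e) ∧ (ind x).card = n
    have hP : P (ind fun _ => 0).card := ⟨_, fun e _ => (A e).zero_mem, rfl⟩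
    have hb : ∀ x, (ind x).card ≤ E.powerset.card := fun x =>
      Finset.card_le_card (Finset.filter_subset _ _)
    obtain ⟨x, hx, hxc⟩ := Nat.findGreatest_spec (P := P) (hb _) hP
    exact ⟨x, hx, fun y hy => hxc ▸ Nat.le_findGreatest (hb y) ⟨y, hy, rfl⟩⟩
  have hgen : ∀ F ⊆ (E : Set β), ∀ e ∈ F, x e ∈ Submodule.span ℝ (x '' (F \ {e})) →
      A e ≤ Submodule.span ℝ (x '' (F \ {e})) := by
    intro F hF e he hxe y hy
    by_contra hyU
    let z : ℝ → β → M := fun t => Function.update x e (x e + t • y)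
    have hze : ∀ t, z t e = x e + t • y := fun t => Function.update_self ..
    have hz : ∀ (t : ℝ) (J : Set β), e ∉ J → z t '' J = x '' J := fun t J hJ =>
      Set.image_congr fun a ha => Function.update_of_ne (by rintro rfl; exact hJ ha) _ _
    have hzi : ∀ (t : ℝ) (J : Set β), e ∉ J → (LinearIndepOn ℝ (z t) J ↔ LinearIndepOn ℝ x J) :=
      fun t J hJ => linearIndepOn_congr fun a ha =>
        Function.update_of_ne (by rintro rfl; exact hJ ha) _ _
    -- An independent subfamily becomes dependent for at most one `t`.
    have hbad : ∀ J ∈ ind x, {t : ℝ | ¬ LinearIndepOn ℝ (z t) (J : Set β)}.Finite := by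
      intro J hJ
      have hJx := ((hind x J).1 hJ).2
      by_cases heJ : e ∈ J
      · refine Set.Subsingleton.finite ?_
        rw [← Finset.insert_erase heJ, Finset.coe_insert,
          linearIndepOn_insert (by simp)] at hJx
        have key : ∀ t : ℝ, ¬ LinearIndepOn ℝ (z t) (J : Set β) →
            x e + t • y ∈ Submodule.span ℝ (x '' ((J.erase e : Finset β) : Set β)) := by
          intro t ht
          by_contra hnot
          refine ht ?_
          rw [← Finset.insert_erase heJ, Finset.coe_insert,
            linearIndepOn_insert (by simp), hzi t _ (by simp), hz t _ (by simp), hze]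
          exact ⟨hJx.1, hnot⟩
        intro t ht t' ht'
        by_contra htt
        have h1 := key t ht
        have h2 := Submodule.sub_mem _ h1 (key t' ht')
        rw [add_sub_add_left_eq_sub, ← sub_smul,
          Submodule.smul_mem_iff _ (sub_ne_zero.2 htt)] at h2
        have h3 := Submodule.sub_mem _ h1 (Submodule.smul_mem _ t h2)
        rw [add_sub_cancel_right] at h3
        exact hJx.2 h3
      · convert Set.finite_empty (α := ℝ)
        rw [Set.eq_empty_iff_forall_notMem]
        intro t ht
        exact ht ((hzi t _ (by simpa using heJ)).2 hJx)
    obtain ⟨t, ht⟩ := (((Finset.finite_toSet (ind x)).biUnion hbad).union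
      (Set.finite_singleton (0 : ℝ))).exists_notMem
    simp only [Set.mem_union, Set.mem_iUnion, not_or, not_exists, Set.mem_singleton_iff,
      Finset.mem_coe] at ht
    obtain ⟨ht1, ht0⟩ := ht
    have hsub : ind x ⊆ ind (z t) := fun J hJ =>
      (hind _ J).2 ⟨((hind x J).1 hJ).1, not_not.1 (ht1 J hJ)⟩
    obtain ⟨J, hJF, -, hJspan, hJind⟩ := exists_linearIndepOn_extension
      (linearIndepOn_empty ℝ x) (Set.empty_subset (F \ {e}))
    have heJ : e ∉ J := fun h => (hJF h).2 rfl
    have hspan : Submodule.span ℝ (x '' (F \ {e})) = Submodule.span ℝ (x '' J) :=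
      le_antisymm (Submodule.span_le.2 hJspan) (Submodule.span_mono (Set.image_mono hJF))
    rw [hspan] at hxe hyU
    have hinsE : insert e J ⊆ (E : Set β) :=
      Set.insert_subset (hF he) ((hJF.trans Set.sdiff_subset).trans hF)
    obtain ⟨J', hJ'⟩ := ((Finset.finite_toSet E).subset hinsE).exists_finset_coe
    have hnew : J' ∈ ind (z t) := by
      rw [hind, ← Finset.coe_subset, hJ', linearIndepOn_insert heJ, hzi t J heJ, hz t J heJ, hze]
      refine ⟨hinsE, hJind, fun h => hyU ?_⟩
      have h1 := Submodule.sub_mem _ h hxe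
      rwa [add_sub_cancel_left, Submodule.smul_mem_iff _ ht0] at h1
    have hold : J' ∉ ind x := by
      rw [hind, hJ', linearIndepOn_insert heJ]
      exact fun h => h.2.2 hxe
    have hlt := Finset.card_lt_card (Finset.ssubset_iff_subset_ne.2
      ⟨hsub, fun h => hold (h ▸ hnew)⟩)
    refine absurd (hmax (z t) fun a ha => ?_) (not_le.2 hlt)
    by_cases hae : a = e
    · subst hae
      rw [hze]
      exact (A a).add_mem (hx a ha) ((A a).smul_mem t hy)
    · simpa [z, hae] using hx a ha
  refine ⟨x, hx, fun e he h0 => hA e he ?_, hgen⟩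
  have h1 := hgen {e} (by simpa using he) e rfl (by rw [h0]; exact Submodule.zero_mem _)
  simpa using h1

end GenericRepresentatives

/-! ### The flats of the edges and the motions -/

section Duality

open Classical

variable {V K : Type*} [Fintype K] {R : Set V}

/-- The vectors with `a` in the block of `u`, `-a` in the block of `w` and `0` elsewhere, for the
vectors `a` orthogonal to `q u` and `q w`; here `p = (u, w)`. -/
noncomputable def edgeFlat (q : V → K → ℝ) (p : V × V) : Submodule ℝ (V → K → ℝ) where
  carrier := {x | ∃ a, a ⬝ᵥ q p.1 = 0 ∧ a ⬝ᵥ q p.2 = 0 ∧ x = Pi.single p.1 a - Pi.single p.2 a}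
  add_mem' := by
    rintro _ _ ⟨a, ha, ha', rfl⟩ ⟨c, hc, hc', rfl⟩
    refine ⟨a + c, by rw [add_dotProduct, ha, hc, add_zero],
      by rw [add_dotProduct, ha', hc', add_zero], ?_⟩
    simp only [Pi.single_add]
    abel
  zero_mem' := ⟨0, zero_dotProduct _, zero_dotProduct _, by simp⟩
  smul_mem' := by
    rintro c _ ⟨a, ha, ha', rfl⟩
    refine ⟨c • a, by rw [smul_dotProduct, ha, smul_zero],
      by rw [smul_dotProduct, ha', smul_zero], ?_⟩
    simp only [Pi.single_smul, smul_sub]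

theorem mem_span_pair_of_orthogonal {a c y : K → ℝ}
    (h : ∀ z, z ⬝ᵥ a = 0 → z ⬝ᵥ c = 0 → z ⬝ᵥ y = 0) : y ∈ Submodule.span ℝ {a, c} := by
  let f : (K → ℝ) ≃ₗ[ℝ] Module.Dual ℝ (K → ℝ) := dotProductEquiv ℝ K
  have hf : ∀ v z, f v z = z ⬝ᵥ v := fun v z => dotProduct_comm v z
  have h1 : f y ∈ Submodule.span ℝ (Set.range fun i => f (![a, c] i)) := by
    refine mem_span_of_iInf_ker_le_ker fun z hz => ?_
    simp only [Submodule.mem_iInf, LinearMap.mem_ker, Fin.forall_fin_two, Matrix.cons_val] at hz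
    rw [LinearMap.mem_ker, hf]
    exact h z ((hf _ _).symm.trans hz.1) ((hf _ _).symm.trans hz.2)
  have h2 : Set.range (fun i => f (![a, c] i)) = f '' {a, c} := by
    rw [Set.image_pair]
    ext g
    simp [Fin.exists_fin_two, eq_comm]
  rw [h2, ← LinearEquiv.coe_coe, Submodule.span_image] at h1
  obtain ⟨y', hy', hyy'⟩ := h1
  rwa [← f.injective hyy']

variable [Fintype V]

/-- The standard scalar product on the space of motions. -/
noncomputable def blockProduct (V K : Type*) [Fintype V] [Fintype K] :
    LinearMap.BilinForm ℝ (V → K → ℝ) :=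
  LinearMap.mk₂ ℝ (fun m x => ∑ v, m v ⬝ᵥ x v)
    (fun m m' x => by simp [add_dotProduct, Finset.sum_add_distrib])
    (fun c m x => by simp [Finset.mul_sum])
    (fun m x x' => by simp [dotProduct_add, Finset.sum_add_distrib])
    (fun c m x => by simp [Finset.mul_sum])

theorem blockProduct_apply (m x : V → K → ℝ) : blockProduct V K m x = ∑ v, m v ⬝ᵥ x v := rfl

theorem blockProduct_isRefl : (blockProduct V K).IsRefl := by
  intro m x h
  rw [blockProduct_apply] at h ⊢
  simpa only [dotProduct_comm] using h

theorem blockProduct_single_left (v : V) (a : K → ℝ) (x : V → K → ℝ) :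
    blockProduct V K (Pi.single v a) x = a ⬝ᵥ x v := by
  rw [blockProduct_apply, Finset.sum_eq_single v]
  · rw [Pi.single_eq_same]
  · intro w _ hw
    rw [Pi.single_eq_of_ne hw, zero_dotProduct]
  · simp

theorem blockProduct_nondegenerate : (blockProduct V K).Nondegenerate := by
  refine (LinearMap.IsRefl.nondegenerate_iff_separatingRight blockProduct_isRefl).2 ?_
  intro x h
  ext v k
  have := h (Pi.single v (Pi.single k 1))
  rwa [blockProduct_single_left, single_one_dotProduct] at this

/-- The motions are the orthogonal complement of the span of the flats. -/
theorem orthogonal_iSup_edgeFlat (q : V → K → ℝ) (S : Set (V × V)) :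
    (blockProduct V K).orthogonal (⨆ p ∈ S, edgeFlat q p) = motions q S := by
  ext m
  rw [LinearMap.BilinForm.mem_orthogonal_iff]
  constructor
  · intro h p hp
    refine mem_span_pair_of_orthogonal fun a ha hc => ?_
    have h1 := h _ (Submodule.mem_iSup_of_mem p (Submodule.mem_iSup_of_mem hp
      (show Pi.single p.1 a - Pi.single p.2 a ∈ edgeFlat q p from ⟨a, ha, hc, rfl⟩)))
    rwa [map_sub, LinearMap.sub_apply, blockProduct_single_left,
      blockProduct_single_left, ← dotProduct_sub] at h1
  · intro hm
    have h1 : ⨆ p ∈ S, edgeFlat q p ≤ LinearMap.ker (LinearMap.flip (blockProduct V K) m) := by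
      refine iSup₂_le ?_
      rintro p hp _ ⟨a, ha, hc, rfl⟩
      obtain ⟨s, t, hst⟩ := Submodule.mem_span_pair.1 (hm p hp)
      rw [LinearMap.mem_ker, LinearMap.flip_apply, map_sub, LinearMap.sub_apply,
        blockProduct_single_left, blockProduct_single_left, ← dotProduct_sub, ← hst, dotProduct_add,
        dotProduct_smul, dotProduct_smul, ha, hc, smul_zero, smul_zero, add_zero]
    exact fun x hx => h1 hx

theorem finrank_iSup_edgeFlat_add_finrank_motions (q : V → K → ℝ) (S : Set (V × V)) :
    Module.finrank ℝ (⨆ p ∈ S, edgeFlat q p : Submodule ℝ (V → K → ℝ)) +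
      Module.finrank ℝ (motions q S) = Fintype.card K * Fintype.card V := by
  have h := LinearMap.BilinForm.finrank_orthogonal blockProduct_nondegenerate
    (⨆ p ∈ S, edgeFlat q p)
  have h1 : Module.finrank ℝ (V → K → ℝ) = Fintype.card K * Fintype.card V := by
    rw [Module.finrank_pi_fintype]
    simp [mul_comm]
  have h2 := Submodule.finrank_le (⨆ p ∈ S, edgeFlat q p)
  rw [orthogonal_iSup_edgeFlat] at h
  omega

/-- The motions under which all the bodies and rods of `X` move together, but for a rotation of
each rod about itself, the other bodies and rods moving arbitrarily. -/
noncomputable def trivialMotion (q : V → K → ℝ) (X : Finset V) :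
    ((K → ℝ) × ({v // v ∈ X ∧ v ∈ R} → ℝ) × ({v // v ∉ X} → K → ℝ)) →ₗ[ℝ] (V → K → ℝ) where
  toFun y v := if h : v ∈ X then
    y.1 + (if hR : v ∈ R then y.2.1 ⟨v, h, hR⟩ else 0) • q v else y.2.2 ⟨v, h⟩
  map_add' y z := by
    ext v k
    simp only [Prod.fst_add, Prod.snd_add, Pi.add_apply]
    split_ifs
    · simp; ring
    · simp
    · simp
  map_smul' c y := by
    ext v k
    simp only [Prod.smul_fst, Prod.smul_snd, Pi.smul_apply, RingHom.id_apply]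
    split_ifs
    · simp; ring
    · simp
    · simp

/-- The trivial motions bound the dimension of the space of motions from below. -/
theorem le_finrank_motions {q : V → K → ℝ} (hq : Nondegenerate R q) {X : Finset V}
    (hX : 2 ≤ X.card) {S : Set (V × V)} (hS : ∀ p ∈ S, p.1 ∈ X ∧ p.2 ∈ X) :
    ((Fintype.card K * Fintype.card V : ℕ) : ℤ) ≤
      Module.finrank ℝ (motions q S) + vertexCount (Fintype.card K) R X := by
  have hin : ∀ y v, (h : v ∈ X) → trivialMotion (R := R) q X y v =
      y.1 + (if hR : v ∈ R then y.2.1 ⟨v, h, hR⟩ else 0) • q v := fun y v h => dif_pos h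
  have hmem : ∀ y, trivialMotion (R := R) q X y ∈ motions q S := by
    intro y p hp
    rw [hin y _ (hS p hp).1, hin y _ (hS p hp).2, add_sub_add_left_eq_sub]
    exact Submodule.sub_mem _ (Submodule.smul_mem _ _ (Submodule.subset_span (by simp)))
      (Submodule.smul_mem _ _ (Submodule.subset_span (by simp)))
  have hinj : Function.Injective ((trivialMotion (R := R) q X).codRestrict _ hmem) := by
    rw [← LinearMap.ker_eq_bot, LinearMap.ker_codRestrict, LinearMap.ker_eq_bot']
    rintro ⟨c, r, y⟩ h
    have h1 : ∀ v, (hv : v ∈ X) → c + (if hR : v ∈ R then r ⟨v, hv, hR⟩ else 0) • q v = 0 :=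
      fun v hv => (hin (c, r, y) v hv).symm.trans (congrFun h v)
    have hr : ∀ v : {v // v ∈ X ∧ v ∈ R}, r v = 0 := by
      rintro ⟨v, hv, hvR⟩
      obtain ⟨w, hw, hwv⟩ := Finset.exists_mem_ne hX v
      have h2 := (h1 v hv).trans (h1 w hw).symm
      rw [add_left_cancel_iff, ← sub_eq_zero, sub_eq_add_neg, ← neg_smul] at h2
      have h3 := (hq.pair_eq_zero hwv.symm h2).1 hvR
      rwa [dif_pos hvR] at h3
    have hc : c = 0 := by
      obtain ⟨v, hv⟩ := Finset.card_pos.1 (by omega : 0 < X.card)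
      have h2 := h1 v hv
      split_ifs at h2 with hR
      · rwa [hr, zero_smul, add_zero] at h2
      · rwa [zero_smul, add_zero] at h2
    refine Prod.ext hc (Prod.ext (funext hr) (funext fun v => ?_))
    exact (dif_neg v.2).symm.trans (congrFun h v.1)
  have h1 := LinearMap.finrank_le_finrank_of_injective hinj
  have h2 : Fintype.card {v // v ∈ X ∧ v ∈ R} = (X.filter (· ∈ R)).card := by
    rw [Fintype.card_subtype]
    congr 1
    ext v
    simp
  have h3 : Fintype.card {v // v ∉ X} = Fintype.card V - X.card := by
    rw [Fintype.card_subtype_compl, Fintype.card_coe]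
  have h4 : Module.finrank ℝ ({v // v ∉ X} → K → ℝ) =
      Fintype.card K * (Fintype.card V - X.card) := by
    rw [Module.finrank_pi_fintype]
    simp only [Module.finrank_fintype_fun_eq_card, Finset.sum_const, Finset.card_univ, h3,
      smul_eq_mul]
    rw [mul_comm]
  rw [Module.finrank_prod, Module.finrank_prod, Module.finrank_fintype_fun_eq_card,
    Module.finrank_fintype_fun_eq_card, h2, h4] at h1
  have h5 : Fintype.card K * Fintype.card V =
      Fintype.card K * (Fintype.card V - X.card) + Fintype.card K * X.card := by
    rw [← mul_add, Nat.sub_add_cancel X.card_le_univ]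
  rw [vertexCount, mul_sub, mul_one, ← Nat.cast_mul]
  omega

end Duality

/-! ### The Plücker coordinates of rods -/

section Pluecker

variable {d : ℕ}

/-- The coefficients of the linear form `⟨·, q⟩` on `⋀² W` for the Plücker vector `q` of the rows of
the matrix `x`. -/
noncomputable def rodNormal (d : ℕ) (x : Fin (d - 1) × Fin (d + 1) → ℝ) : Wedge d 2 :=
  fun s => (-1 : ℝ) ^ (∑ i ∈ s.1, (i.val + 1)) * wedge (fun i j => x (i, j)) (complPair s)

theorem pairing_wedge (p : Wedge d 2) (b : Fin (d - 1) → Fin (d + 1) → ℝ) :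
    pairing p (wedge b) = p ⬝ᵥ rodNormal d (fun y => b y.1 y.2) := by
  refine Finset.sum_congr rfl fun s _ => ?_
  rw [rodNormal]
  ring

/-- The Plücker vectors of the bases of a subspace are proportional, so that one of them determines
the dual hyperplane. -/
theorem mem_dualHyperplane_span_iff (b : Fin (d - 1) → Fin (d + 1) → ℝ) (p : Wedge d 2) :
    p ∈ dualHyperplane (Submodule.span ℝ (Set.range b)) ↔
      p ⬝ᵥ rodNormal d (fun y => b y.1 y.2) = 0 := by
  rw [← pairing_wedge]
  constructor
  · exact fun h => h b fun i => Submodule.subset_span ⟨i, rfl⟩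
  · intro h b' hb'
    choose A hA using fun i => (Submodule.mem_span_range_iff_exists_fun ℝ).1 (hb' i)
    have hw : wedge b' = (Matrix.of A).det • wedge b := by
      ext s
      simp only [wedge, Pi.smul_apply, smul_eq_mul]
      rw [← Matrix.det_mul]
      congr 1
      ext i j
      simp [Matrix.mul_apply, ← hA]
    rw [hw]
    have h1 : pairing p ((Matrix.of A).det • wedge b) =
        (Matrix.of A).det * pairing p (wedge b) := by
      simp only [pairing, Finset.mul_sum, Pi.smul_apply, smul_eq_mul]
      refine Finset.sum_congr rfl fun s _ => ?_
      ring
    rw [h1, h, mul_zero]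

/-- The matrix whose rows are the vectors of the standard basis with the indices `f i`. -/
noncomputable def basisRows (f : Fin (d - 1) → Fin (d + 1)) : Fin (d - 1) × Fin (d + 1) → ℝ :=
  fun y => if f y.1 = y.2 then 1 else 0

theorem mem_complPair {s : Set.powersetCard (Fin (d + 1)) 2} {k : Fin (d + 1)} :
    k ∈ (complPair s).1 ↔ k ∉ s.1 := Finset.mem_compl

theorem exists_enum_compl (s : Set.powersetCard (Fin (d + 1)) 2) :
    ∃ f : Fin (d - 1) → Fin (d + 1), Function.Injective f ∧ ∀ k, k ∉ s.1 ↔ ∃ i, f i = k := by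
  refine ⟨(complPair s).1.orderEmbOfFin (complPair s).2,
    ((complPair s).1.orderEmbOfFin _).injective, fun k => ?_⟩
  have h := Finset.range_orderEmbOfFin (complPair s).1 (complPair s).2
  have h1 : k ∈ ((complPair s).1 : Set (Fin (d + 1))) ↔ k ∉ s.1 := mem_complPair
  rw [← h1, ← h, Set.mem_range]

/-- A coordinate subspace has only one nonzero Plücker coordinate. -/
theorem rodNormal_basisRows [DecidableEq (Set.powersetCard (Fin (d + 1)) 2)]
    {f : Fin (d - 1) → Fin (d + 1)}
    (hf : Function.Injective f) {s : Set.powersetCard (Fin (d + 1)) 2} (hs : ∀ i, f i ∉ s.1) :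
    ∃ c : ℝ, c ≠ 0 ∧ rodNormal d (basisRows f) = Pi.single s c := by
  have hrange : ∀ t : Set.powersetCard (Fin (d + 1)) 2, (∀ i, f i ∉ t.1) →
      (complPair t).1 = Finset.univ.image f := by
    intro t ht
    refine (Finset.eq_of_subset_of_card_le ?_ ?_).symm
    · intro k hk
      obtain ⟨i, -, rfl⟩ := Finset.mem_image.1 hk
      exact mem_complPair.2 (ht i)
    · rw [Finset.card_image_of_injective _ hf, Finset.card_univ, Fintype.card_fin]
      exact (complPair t).2.le
  refine ⟨rodNormal d (basisRows f) s, ?_, ?_⟩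
  · refine mul_ne_zero (pow_ne_zero _ (by norm_num)) ?_
    let g := (complPair s).1.orderEmbOfFin (complPair s).2
    have hg : ∀ i, ∃ j, g j = f i := by
      intro i
      have h : f i ∈ ((complPair s).1 : Set (Fin (d + 1))) := mem_complPair.2 (hs i)
      rwa [← Finset.range_orderEmbOfFin _ (complPair s).2] at h
    choose π hπ using hg
    have hπi : Function.Injective π := fun i j hij => hf (by rw [← hπ i, ← hπ j, hij])
    let e := Equiv.ofBijective π (Finite.injective_iff_bijective.1 hπi)
    have hM : (Matrix.of fun i j => basisRows f (i, g j)) =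
        (1 : Matrix (Fin (d - 1)) (Fin (d - 1)) ℝ).submatrix e id := by
      ext i j
      simp only [Matrix.of_apply, basisRows, Matrix.submatrix_apply, id, Matrix.one_apply, ← hπ i,
        g.injective.eq_iff]
      rfl
    change (Matrix.of fun i j => basisRows f (i, g j)).det ≠ 0
    rw [hM, Matrix.det_permute, Matrix.det_one, mul_one]
    exact_mod_cast (Equiv.Perm.sign e).ne_zero
  · ext t
    by_cases hts : t = s
    · rw [hts, Pi.single_eq_same]
    · rw [Pi.single_eq_of_ne hts]
      obtain ⟨i, hi⟩ : ∃ i, f i ∈ t.1 := by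
        by_contra! hcon
        refine hts (Subtype.ext ?_)
        have h := (hrange t hcon).trans (hrange s hs).symm
        exact compl_injective h
      refine mul_eq_zero_of_right _ (Matrix.det_eq_zero_of_row_eq_zero i fun j => ?_)
      refine if_neg fun h => ?_
      have h' := Finset.orderEmbOfFin_mem _ (complPair t).2 j
      rw [← show f i = (complPair t).1.orderEmbOfFin (complPair t).2 j from h] at h'
      exact mem_complPair.1 h' hi

theorem rodNormal_row_add (x y z : Fin (d - 1) × Fin (d + 1) → ℝ) (i₀ : Fin (d - 1))
    (h₀ : ∀ j, x (i₀, j) = y (i₀, j) + z (i₀, j))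
    (h : ∀ i ≠ i₀, ∀ j, y (i, j) = x (i, j) ∧ z (i, j) = x (i, j)) :
    rodNormal d x = rodNormal d y + rodNormal d z := by
  ext s
  simp only [Pi.add_apply, rodNormal, ← mul_add, wedge]
  congr 1
  let g := (complPair s).1.orderEmbOfFin (complPair s).2
  let M : Matrix (Fin (d - 1)) (Fin (d - 1)) ℝ := Matrix.of fun i j => x (i, g j)
  have h1 := Matrix.det_updateRow_add M i₀ (fun j => y (i₀, g j)) (fun j => z (i₀, g j))
  have key : ∀ w : Fin (d - 1) × Fin (d + 1) → ℝ, (∀ i ≠ i₀, ∀ j, w (i, j) = x (i, j)) →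
      M.updateRow i₀ (fun j => w (i₀, g j)) = Matrix.of fun i j => w (i, g j) := by
    intro w hw
    ext i j
    by_cases hi : i = i₀
    · subst hi
      simp
    · rw [Matrix.updateRow_ne hi]
      exact (hw i hi _).symm
  rw [key y fun i hi j => (h i hi j).1, key z fun i hi j => (h i hi j).2] at h1
  rw [← h1]
  congr 1
  rw [← key x fun _ _ _ => rfl]
  congr 1
  ext j
  exact h₀ _

theorem rodNormal_poly (s : Set.powersetCard (Fin (d + 1)) 2) :
    (fun x => rodNormal d x s) ∈ polyFun (Fin (d - 1) × Fin (d + 1)) :=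
  mul_mem (const_mem_polyFun _) (det_mem_polyFun fun _ _ => coord_mem_polyFun _)

/-- Two pairs with a common index are joined: in a coordinate subspace complementary to one of them,
a basis vector is replaced by the sum of two. -/
theorem rodNormal_joined [DecidableEq (Set.powersetCard (Fin (d + 1)) 2)]
    {s t : Set.powersetCard (Fin (d + 1)) 2} (hst : s ≠ t) {i : Fin (d + 1)} (hs : i ∈ s.1)
    (ht : i ∈ t.1) :
    ∃ x a c, a ≠ 0 ∧ c ≠ 0 ∧ s ≠ t ∧ rodNormal d x = Pi.single s a + Pi.single t c := by
  have hpair : ∀ u : Set.powersetCard (Fin (d + 1)) 2, i ∈ u.1 → ∃ j, j ≠ i ∧ u.1 = {i, j} := by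
    intro u hu
    obtain ⟨j, hj, hji⟩ := Finset.exists_mem_ne (show 1 < u.1.card from u.2.symm ▸ one_lt_two) i
    refine ⟨j, hji, (Finset.eq_of_subset_of_card_le ?_ ?_).symm⟩
    · intro k hk
      rcases Finset.mem_insert.1 hk with rfl | hk
      · exact hu
      · rwa [Finset.mem_singleton.1 hk]
    · rw [Finset.card_pair hji.symm]
      exact u.2.le
  obtain ⟨j, hji, hsj⟩ := hpair s hs
  obtain ⟨k, hki, htk⟩ := hpair t ht
  have hjk : j ≠ k := by
    rintro rfl
    exact hst (Subtype.ext (hsj.trans htk.symm))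
  obtain ⟨f, hf, hfs⟩ := exists_enum_compl s
  obtain ⟨i₀, hi₀⟩ := (hfs k).1 (by rw [hsj]; simp [hki, hjk.symm])
  have hfn : ∀ l, f l ∉ s.1 := fun l => (hfs _).2 ⟨l, rfl⟩
  have hfj : ∀ l, f l ≠ j := fun l h => hfn l (by rw [hsj, h]; simp)
  have hfi : ∀ l, f l ≠ i := fun l h => hfn l (by rw [hsj, h]; simp)
  let g := Function.update f i₀ j
  have hg₀ : g i₀ = j := Function.update_self ..
  have hg₁ : ∀ l, l ≠ i₀ → g l = f l := fun l hl => Function.update_of_ne hl _ _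
  have hg : Function.Injective g := by
    intro l l' hll
    by_cases h : l = i₀ <;> by_cases h' : l' = i₀
    · rw [h, h']
    · rw [h, hg₀, hg₁ l' h'] at hll
      exact absurd hll.symm (hfj l')
    · rw [h', hg₀, hg₁ l h] at hll
      exact absurd hll (hfj l)
    · rw [hg₁ l h, hg₁ l' h'] at hll
      exact hf hll
  have hgn : ∀ l, g l ∉ t.1 := by
    intro l
    rw [htk]
    by_cases h : l = i₀
    · rw [h, hg₀]
      simp [hji, hjk]
    · rw [hg₁ l h, ← hi₀]
      simpa [hfi l] using fun h' => h (hf h')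
  obtain ⟨a, ha, hfa⟩ := rodNormal_basisRows hf hfn
  obtain ⟨c, hc, hgc⟩ := rodNormal_basisRows hg hgn
  refine ⟨fun y => if y.1 = i₀ then basisRows f y + basisRows g y else basisRows f y, a, c, ha, hc,
    hst, ?_⟩
  rw [← hfa, ← hgc]
  refine rodNormal_row_add _ _ _ i₀ (fun l => by simp) fun l hl m => ⟨by simp [hl], ?_⟩
  simp [hl, basisRows, hg₁ l hl]

theorem isRodFamily_rodNormal [DecidableEq (Set.powersetCard (Fin (d + 1)) 2)] :
    IsRodFamily (rodNormal d) where
  poly := rodNormal_poly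
  basis := by
    intro s
    obtain ⟨f, hf, hfs⟩ := exists_enum_compl s
    obtain ⟨c, hc, h⟩ := rodNormal_basisRows hf (s := s) fun i => (hfs _).2 ⟨i, rfl⟩
    exact ⟨_, c, hc, h⟩
  joined := by
    intro s t
    have key : ∀ (s t : Set.powersetCard (Fin (d + 1)) 2) (i : Fin (d + 1)), i ∈ s.1 → i ∈ t.1 →
        Relation.ReflTransGen (fun i j => ∃ x a c, a ≠ 0 ∧ c ≠ 0 ∧ i ≠ j ∧
          rodNormal d x = Pi.single i a + Pi.single j c) s t := by
      intro s t i hs ht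
      by_cases hst : s = t
      · rw [hst]
      · exact Relation.ReflTransGen.single (rodNormal_joined hst hs ht)
    have hne : ∀ u : Set.powersetCard (Fin (d + 1)) 2, ∃ i, i ∈ u.1 := fun u =>
      Finset.card_pos.1 (u.2.symm ▸ two_pos)
    obtain ⟨i, hi⟩ := hne s
    obtain ⟨j, hj⟩ := hne t
    by_cases hij : i = j
    · exact key s t i hi (hij ▸ hj)
    · let u : Set.powersetCard (Fin (d + 1)) 2 := ⟨{i, j}, Finset.card_pair hij⟩
      exact (key s u i hi (by simp [u])).trans (key u t j (by simp [u]) hj)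

end Pluecker

/-! ### The flats of a rod-configuration -/

section Application

variable {α β : Type*}

open Classical in
/-- The extension by zero of a family of vectors indexed by a subset. -/
noncomputable def extendZero (s : Set α) (M : Type*) [AddCommGroup M] [Module ℝ M] :
    (s → M) →ₗ[ℝ] (α → M) where
  toFun y v := if h : v ∈ s then y ⟨v, h⟩ else 0
  map_add' y z := by
    ext v
    by_cases h : v ∈ s <;> simp [h]
  map_smul' c y := by
    ext v
    by_cases h : v ∈ s <;> simp [h]

theorem extendZero_injective (s : Set α) (M : Type*) [AddCommGroup M] [Module ℝ M] :
    Function.Injective (extendZero s M) := by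
  intro y z h
  ext v
  have := congrFun h v.1
  simpa [extendZero] using this

theorem extendZero_single {_ : DecidableEq α} {s : Set α} {_ : DecidableEq s} {M : Type*}
    [AddCommGroup M] [Module ℝ M] (u : s) (a : M) :
    extendZero s M (Pi.single u a) = Pi.single u.1 a := by
  ext v
  by_cases h : v ∈ s
  · simp only [extendZero, LinearMap.coe_mk, AddHom.coe_mk, h, dif_pos]
    by_cases hv : v = u.1
    · subst hv
      simp
    · rw [Pi.single_eq_of_ne hv, Pi.single_eq_of_ne fun h' => hv (congrArg Subtype.val h')]
  · have hv : v ≠ u.1 := fun h' => h (h' ▸ u.2)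
    simp [extendZero, h, hv]

open Classical

variable {G : Graph α β} {φ : G.edgeSet → G.vertexSet × G.vertexSet × ℕ}

/-- The edges of `F` in the form of triples, for an injective map `φ` that assigns to an edge its
ends and a label distinguishing it from its parallel edges. -/
noncomputable def labelled (φ : G.edgeSet → G.vertexSet × G.vertexSet × ℕ) (F : Finset β) :
    Finset (G.vertexSet × G.vertexSet × ℕ) :=
  (F.subtype (· ∈ G.edgeSet)).image φ

theorem mem_labelled {F : Finset β} {x : G.vertexSet × G.vertexSet × ℕ} :
    x ∈ labelled φ F ↔ ∃ e : G.edgeSet, e.1 ∈ F ∧ φ e = x := by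
  simp only [labelled, Finset.mem_image, Finset.mem_subtype]

theorem card_labelled (hφ : Function.Injective φ) {F : Finset β} (hF : (F : Set β) ⊆ G.edgeSet) :
    (labelled φ F).card = F.card := by
  rw [labelled, Finset.card_image_of_injective _ hφ, Finset.card_subtype,
    Finset.filter_true_of_mem fun e he => hF he]

theorem exists_labelled_eq {I : Finset β} {F' : Finset (G.vertexSet × G.vertexSet × ℕ)}
    (h : F' ⊆ labelled φ I) : ∃ F ⊆ I, (F : Set β) ⊆ G.edgeSet ∧ labelled φ F = F' := by
  obtain ⟨s, hs, rfl⟩ := Finset.subset_image_iff.1 h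
  refine ⟨s.map (Function.Embedding.subtype _), ?_, ?_, ?_⟩
  · intro e he
    obtain ⟨e', he', rfl⟩ := Finset.mem_map.1 he
    exact Finset.mem_subtype.1 (hs he')
  · intro e he
    obtain ⟨e', -, rfl⟩ := Finset.mem_map.1 he
    exact e'.2
  · ext x
    rw [mem_labelled, Finset.mem_image]
    simp

/-- `φ` assigns to each edge its two ends and a label, edges with the same ends having different
labels. -/
structure IsLabelling (G : Graph α β) (φ : G.edgeSet → G.vertexSet × G.vertexSet × ℕ) : Prop where
  isLink : ∀ e, G.IsLink e.1 (φ e).1.1 (φ e).2.1.1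
  injective : Function.Injective φ

theorem exists_isLabelling (G : Graph α β) (hE : G.edgeSet.Finite) : ∃ φ, IsLabelling G φ := by
  have := hE.countable.to_subtype
  obtain ⟨l, hl⟩ := Countable.exists_injective_nat G.edgeSet
  have h : ∀ e : G.edgeSet, ∃ u w : G.vertexSet, G.IsLink e.1 u.1 w.1 := by
    intro e
    obtain ⟨u, w, h⟩ := Graph.exists_isLink_of_mem_edgeSet e.2
    exact ⟨⟨u, h.left_mem⟩, ⟨w, h.right_mem⟩, h⟩
  choose u w huw using h
  exact ⟨fun e => (u e, w e, l e), huw, fun e e' hee =>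
    hl (congrArg (fun x : G.vertexSet × G.vertexSet × ℕ => x.2.2) hee)⟩

theorem IsLabelling.spanned_eq (hφ : IsLabelling G φ) {F : Finset β}
    (hF : (F : Set β) ⊆ G.edgeSet) :
    spanned G F = Subtype.val '' (verts (labelled φ F) : Set G.vertexSet) := by
  ext v
  simp only [Set.mem_image, Finset.mem_coe, mem_verts, mem_labelled]
  constructor
  · rintro ⟨e, he, hv⟩
    have hlink := hφ.isLink ⟨e, hF he⟩
    rcases hv.eq_or_eq_of_isLink hlink with rfl | rfl
    · exact ⟨_, ⟨_, ⟨⟨e, hF he⟩, he, rfl⟩, Or.inl rfl⟩, rfl⟩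
    · exact ⟨_, ⟨_, ⟨⟨e, hF he⟩, he, rfl⟩, Or.inr rfl⟩, rfl⟩
  · rintro ⟨_, ⟨_, ⟨e, he, rfl⟩, rfl | rfl⟩, rfl⟩
    · exact ⟨e.1, he, (hφ.isLink e).inc_left⟩
    · exact ⟨e.1, he, (hφ.isLink e).inc_right⟩

theorem IsLabelling.vertexCount_eq (hφ : IsLabelling G φ) (R : Set α) (d : ℕ) {F : Finset β}
    (hF : (F : Set β) ⊆ G.edgeSet) :
    vertexCount ((d + 1).choose 2) (Subtype.val ⁻¹' R) (verts (labelled φ F)) =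
      countFunction G R d F := by
  have h1 : spanned G F ∩ R = Subtype.val ''
      (((verts (labelled φ F)).filter (· ∈ Subtype.val ⁻¹' R) : Finset G.vertexSet) :
        Set G.vertexSet) := by
    rw [hφ.spanned_eq hF, Finset.coe_filter, ← Set.image_inter_preimage]
    rfl
  rw [countFunction, h1, hφ.spanned_eq hF, Set.ncard_image_of_injective _ Subtype.val_injective,
    Set.ncard_image_of_injective _ Subtype.val_injective, Set.ncard_coe_finset,
    Set.ncard_coe_finset, vertexCount]

theorem IsLabelling.sparse [G.Loopless] (hφ : IsLabelling G φ) (R : Set α) (d : ℕ) {I : Finset β}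
    (hI : ∀ F ⊆ I, F.Nonempty → (F.card : ℤ) ≤ countFunction G R d F) :
    Sparse ((d + 1).choose 2) (Subtype.val ⁻¹' R) (labelled φ I) := by
  refine ⟨fun x hx => ?_, fun F' hF' hne => ?_⟩
  · obtain ⟨e, -, rfl⟩ := mem_labelled.1 hx
    exact fun h => (hφ.isLink e).ne (congrArg Subtype.val h)
  · obtain ⟨F, hFI, hFE, rfl⟩ := exists_labelled_eq hF'
    rw [card_labelled hφ.injective hFE, hφ.vertexCount_eq R d hFE]
    refine hI F hFI ?_
    obtain ⟨x, hx⟩ := hne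
    obtain ⟨e, he, -⟩ := mem_labelled.1 hx
    exact ⟨e, he⟩

variable {d : ℕ} {R : Set α} {r : RodConfiguration d R} {q : G.vertexSet → Wedge d 2}

theorem IsLabelling.iSup_flat_eq (hφ : IsLabelling G φ)
    (hq : ∀ v : G.vertexSet, ∀ a, a ∈ r.hyperplane v.1 ↔ a ⬝ᵥ q v = 0)
    {F : Finset β} (hF : (F : Set β) ⊆ G.edgeSet) :
    ⨆ e ∈ F, r.flat G e = (⨆ p ∈ pairs (labelled φ F), edgeFlat q p).map
      (extendZero G.vertexSet (Wedge d 2)) := by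
  have hflat : ∀ e : G.edgeSet, r.flat G e.1 =
      (edgeFlat q ((φ e).1, (φ e).2.1)).map (extendZero G.vertexSet (Wedge d 2)) := by
    intro e
    ext x
    rw [r.mem_flat_iff G (hφ.isLink e)]
    constructor
    · rintro ⟨a, ⟨ha, ha'⟩, rfl⟩
      refine ⟨_, ⟨a, (hq _ _).1 ha, (hq _ _).1 ha', rfl⟩, ?_⟩
      rw [map_sub, extendZero_single, extendZero_single]
    · rintro ⟨_, ⟨a, ha, ha', rfl⟩, rfl⟩
      refine ⟨a, ⟨(hq _ _).2 ha, (hq _ _).2 ha'⟩, ?_⟩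
      rw [map_sub, extendZero_single, extendZero_single]
  simp only [Submodule.map_iSup]
  refine le_antisymm (iSup₂_le fun e he => ?_) (iSup₂_le ?_)
  · rw [hflat ⟨e, hF he⟩]
    exact le_iSup₂_of_le _ ⟨_, mem_labelled.2 ⟨⟨e, hF he⟩, he, rfl⟩, rfl⟩ le_rfl
  · rintro _ ⟨x, hx, rfl⟩
    obtain ⟨e, he, rfl⟩ := mem_labelled.1 hx
    rw [← hflat e]
    exact le_iSup₂_of_le e.1 he le_rfl

/-- The dimension of the span of flats of edges is the codimension of the space of motions. -/
theorem IsLabelling.finrank_iSup_flat_add_finrank_motions [Fintype G.vertexSet]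
    (hφ : IsLabelling G φ) (hq : ∀ v : G.vertexSet, ∀ a, a ∈ r.hyperplane v.1 ↔ a ⬝ᵥ q v = 0)
    {F : Finset β} (hF : (F : Set β) ⊆ G.edgeSet) :
    Module.finrank ℝ (⨆ e ∈ F, r.flat G e : Submodule ℝ (α → Wedge d 2)) +
      Module.finrank ℝ (motions q (pairs (labelled φ F))) =
      Fintype.card (Set.powersetCard (Fin (d + 1)) 2) * Fintype.card G.vertexSet := by
  rw [hφ.iSup_flat_eq hq hF, ← finrank_iSup_edgeFlat_add_finrank_motions q (pairs (labelled φ F)),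
    ← (Submodule.equivMapOfInjective _ (extendZero_injective _ _) _).finrank_eq]

theorem card_powersetCard_two (d : ℕ) :
    Fintype.card (Set.powersetCard (Fin (d + 1)) 2) = (d + 1).choose 2 := by
  rw [← Nat.card_eq_fintype_card, Set.powersetCard.card, Nat.card_eq_fintype_card,
    Fintype.card_fin]

/-- The flats of a set `F` of edges span a space of dimension at most `f F`. -/
theorem IsLabelling.finrank_iSup_flat_le [G.Loopless] [Fintype G.vertexSet]
    (hφ : IsLabelling G φ) (hq : ∀ v : G.vertexSet, ∀ a, a ∈ r.hyperplane v.1 ↔ a ⬝ᵥ q v = 0)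
    (hnd : Nondegenerate (Subtype.val ⁻¹' R) q) {F : Finset β} (hF : (F : Set β) ⊆ G.edgeSet)
    (hne : F.Nonempty) :
    (Module.finrank ℝ (⨆ e ∈ F, r.flat G e : Submodule ℝ (α → Wedge d 2)) : ℤ) ≤
      countFunction G R d F := by
  have h1 := hφ.finrank_iSup_flat_add_finrank_motions hq hF
  set X := verts (labelled φ F) with hX
  have h2 : 2 ≤ X.card := by
    obtain ⟨e, he⟩ := hne
    have he' : φ ⟨e, hF he⟩ ∈ labelled φ F := mem_labelled.2 ⟨_, he, rfl⟩
    refine Finset.one_lt_card.2 ⟨_, mem_verts.2 ⟨_, he', Or.inl rfl⟩, _,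
      mem_verts.2 ⟨_, he', Or.inr rfl⟩, fun h => ?_⟩
    exact (hφ.isLink ⟨e, hF he⟩).ne (congrArg Subtype.val h)
  have h3 := le_finrank_motions (V := G.vertexSet) hnd h2 (S := pairs (labelled φ F)) (by
    rintro _ ⟨x, hx, rfl⟩
    exact ⟨mem_verts.2 ⟨x, hx, Or.inl rfl⟩, mem_verts.2 ⟨x, hx, Or.inr rfl⟩⟩)
  rw [card_powersetCard_two] at h1 h3
  rw [← hφ.vertexCount_eq R d hF, ← hX]
  omega

/-- For generic rods, the generic matroid of the flats is the count matroid. -/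
theorem IsLabelling.isGenericMatroid [G.Loopless] [Fintype G.vertexSet] (hE : G.edgeSet.Finite)
    (hd : 3 ≤ d) (hφ : IsLabelling G φ)
    (hq : ∀ v : G.vertexSet, ∀ a, a ∈ r.hyperplane v.1 ↔ a ⬝ᵥ q v = 0)
    (hnd : Nondegenerate (Subtype.val ⁻¹' R) q)
    (hind : ∀ I, Sparse ((d + 1).choose 2) (Subtype.val ⁻¹' R) I →
      Module.finrank ℝ (motions q (pairs I)) + I.card ≤
        (d + 1).choose 2 * Fintype.card G.vertexSet) :
    IsGenericMatroid G.edgeSet (r.flat G) (countMatroid G R d (le_trans (by norm_num) hd)) := by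
  have hlower : ∀ I : Finset β, (I : Set β) ⊆ G.edgeSet →
      (∀ F ⊆ I, F.Nonempty → (F.card : ℤ) ≤ countFunction G R d F) →
      I.card ≤ Module.finrank ℝ (⨆ e ∈ I, r.flat G e : Submodule ℝ (α → Wedge d 2)) := by
    intro I hI h
    have h1 := hind _ (hφ.sparse R d h)
    have h2 := hφ.finrank_iSup_flat_add_finrank_motions hq hI
    rw [card_labelled hφ.injective hI] at h1
    rw [card_powersetCard_two] at h2
    omega
  have hD : 6 ≤ (d + 1).choose 2 := Nat.choose_le_choose 2 (show 4 ≤ d + 1 by omega)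
  refine ⟨exists_isGenericRepresentatives hE fun e he h0 => ?_, fun x hx => ?_⟩
  · have h1 := hlower {e} (by simpa using he) (by
      intro F hF hne
      rw [hne.subset_singleton_iff.1 hF, Finset.card_singleton]
      have hlink := hφ.isLink ⟨e, he⟩
      have hs : spanned G {e} = {(φ ⟨e, he⟩).1.1, (φ ⟨e, he⟩).2.1.1} := by
        ext v
        simp only [spanned, Finset.mem_singleton, exists_eq_left]
        constructor
        · exact fun h => h.eq_or_eq_of_isLink hlink
        · rintro (rfl | rfl)
          · exact hlink.inc_left
          · exact hlink.inc_right
      have h2 : (spanned G {e}).ncard = 2 := by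
        rw [hs, Set.ncard_pair hlink.ne]
      have h3 := Set.ncard_le_ncard (Set.inter_subset_left (s := spanned G {e}) (t := R))
        (spanned_finite G {e})
      rw [countFunction, h2]
      rw [h2] at h3
      push_cast
      omega)
    rw [Finset.iSup_singleton, h0, finrank_bot] at h1
    simp at h1
  · refine Matroid.ext_indep rfl fun I hI => ?_
    obtain ⟨I, rfl⟩ := (hE.subset hI).exists_finset_coe
    rw [linearMatroid_indep_iff, countMatroid, inducedMatroid_indep_iff]
    refine and_congr_right fun hIE => ⟨fun h F hF hne => ?_, fun h => ?_⟩
    · have hFE := (Finset.coe_subset.2 hF).trans hIE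
      refine le_trans ?_ (hφ.finrank_iSup_flat_le hq hnd hFE hne)
      have h1 := finrank_span_eq_card (h.mono (Finset.coe_subset.2 hF))
      rw [← Set.image_eq_range] at h1
      have h2 : Submodule.span ℝ (x '' (F : Set β)) ≤ ⨆ e ∈ F, r.flat G e := by
        rw [Submodule.span_le]
        rintro _ ⟨e, he, rfl⟩
        exact Submodule.mem_iSup_of_mem e (Submodule.mem_iSup_of_mem he (hx.mem e (hFE he)))
      rw [hφ.iSup_flat_eq hq hFE] at h2 ⊢
      have h3 := Submodule.finrank_mono h2
      rw [h1] at h3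
      simpa using h3
    · refine hx.linearIndepOn hIE fun F hF => ?_
      exact hlower F ((Finset.coe_subset.2 hF).trans hIE) fun F' hF' => h F' (hF'.trans hF)

end Application

end RodBar

theorem mainTheorem4 {α β : Type*} (G : Graph α β) [G.Loopless]
    (hV : G.vertexSet.Finite) (hE : G.edgeSet.Finite)
    (B R : Set α) (hBR : B ∪ R = G.vertexSet) (hdisj : Disjoint B R)
    (d : ℕ) (hd : 3 ≤ d) :
    RodBar.AlmostAll fun r : RodBar.RodConfiguration d R =>
      RodBar.IsGenericMatroid G.edgeSet (r.flat G)
        (RodBar.countMatroid G R d (le_trans (by norm_num) hd)) := by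
  classical
  have := hV.fintype
  obtain ⟨φ, hφ⟩ := RodBar.exists_isLabelling G hE
  have hRV : R ⊆ G.vertexSet := hBR ▸ Set.subset_union_right
  have hD : 6 ≤ (d + 1).choose 2 := Nat.choose_le_choose 2 (show 4 ≤ d + 1 by omega)
  obtain ⟨Q, hQ, h⟩ := RodBar.eventually_generic_iff.1
    ((RodBar.isRodFamily_rodNormal (d := d)).eventually_finrank_motions_add_card_le
      (V := G.vertexSet) (R := Subtype.val ⁻¹' R)
      (by rw [RodBar.card_powersetCard_two]; omega))
  -- `Q` has variables for the rods `v ∈ R` considered as elements of the type of the vertices.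
  let f : (Subtype.val ⁻¹' R : Set G.vertexSet) × Fin (d - 1) × Fin (d + 1) →
      R × Fin (d - 1) × Fin (d + 1) := fun y => (⟨y.1.1.1, y.1.2⟩, y.2)
  have hf : Function.Injective f := by
    rintro ⟨⟨⟨u, hu⟩, hu'⟩, i⟩ ⟨⟨⟨w, hw⟩, hw'⟩, j⟩ hij
    simpa [f] using hij
  refine ⟨MvPolynomial.rename f Q, fun h0 => hQ ?_, fun r b hb hQb => ?_⟩
  · exact MvPolynomial.rename_injective f hf (h0.trans (map_zero _).symm)
  rw [MvPolynomial.eval_rename] at hQb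
  obtain ⟨hnd, hind⟩ := h _ hQb
  simp only [RodBar.card_powersetCard_two, Nat.card_eq_fintype_card] at hind
  refine hφ.isGenericMatroid hE hd (fun v a => ?_) hnd hind
  by_cases hv : v.1 ∈ R
  · rw [RodBar.normals_of_mem _ _ (show v ∈ Subtype.val ⁻¹' R from hv),
      RodBar.RodConfiguration.hyperplane, dif_pos hv, ← hb ⟨v.1, hv⟩,
      RodBar.mem_dualHyperplane_span_iff]
    rfl
  · rw [RodBar.normals_of_notMem _ _ (show v ∉ Subtype.val ⁻¹' R from hv),
      RodBar.RodConfiguration.hyperplane, dif_neg hv, dotProduct_zero]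
    simp
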